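/- **Triangle presentations.** Let $F$ be a finite set. A triangle presentation of order $q\ge 2$ over $F$ is a subset $T\subset F\times F\times F$ such that, writing $i\to j$ (and calling $i$ a predecessor of $j$, and $j$ a successor of $i$) if $(i,j,k)\in T$ for some $k\in F$: (i) $(i,j,k)\in T$ implies $(k,i,j)\in T$; (ii) for all $i,j\in F$ there is at most one $k\in F$ with $(i,j,k)\in T$; (iii) any two distinct points of $F$ have exactly one common predecessor and exactly one common successor; (iv) every point of $F$ has exactly $q+1$ predecessors and exactly $q+1$ successors. **The quantum group $\mathbb G_T$.** Let $C(\mathbb G_T)$ be the universal unital $C^*$-algebra generated by elements $u_{ij}$, $i,j\in F$, such that $u=(u_{ij})$ is a unitary element of $B(\mathbb C^F)\otimes C(\mathbb G_T)$ and, for all $i,j,k\in F$, $$\sum_{(a,b,c)\in T}u_{ia}u_{jb}u_{kc}=\begin{cases}1&\text{if }(i,j,k)\in T,\\0&\text{if }(i,j,k)\notin T.\end{cases}$$ Together with the unital $*$-homomorphism $\Delta:C(\mathbb G_T)\to C(\mathbb G_T)\otimes_{\min}C(\mathbb G_T)$ determined by $\Delta(u_{ij})=\sum_k u_{ik}\otimes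 u_{kj}$, it defines a compact quantum group $\mathbb G_T$. A finite-dimensional unitary representation of $\mathbb G_T$ is a unitary matrix $v=(v_{ij})$ over $C(\mathbb G_T)$ with $\Delta(v_{ij})=\sum_k v_{ik}\otimes v_{kj}$; an intertwiner from $v$ to $w$ is a linear map $S$ with $w(S\otimes1)=(S\otimes1)v$. With these, $\mathrm{Rep}(\mathbb G_T)$ is a $C^*$-tensor category. Two compact quantum groups are monoidally equivalent if their representation categories are unitarily monoidally equivalent, i.e. if there is a linear, $*$-preserving monoidal functor between them that is an equivalence of categories and has unitary structure isomorphisms. **Partition vectors.** For $n\in\mathbb N$ let $NC_3(n)$ be the set of partitions of $3n$ linearly ordered points into $n$ noncrossing blocks of size $3$. For $p\in NC_3(n)$ let $$[p]_T=\sum_{I} e_{I_1}\otimes\cdots\otimes e_{I_{3n}}\in(\mathbb C^F)^{\otimes 3n},$$ where the sum runs over all $I\in F^{3n}$ such that $(I_i,I_j,I_k)\in T$ for every block $\{i<j<k\}$ of $p$. **Proposition.** Let $T$ and $T'$ be triangle presentations, over finite sets $F$ and $F'$, of the same order $q\geq 2$. Assume that $$\langle [p_1]_T,[p_2]_T\rangle=\langle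 [p_1]_{T'},[p_2]_{T'}\rangle$$ for all $n\in\mathbb N$ and all $p_1,p_2\in NC_3(n)$. Then $\mathbb G_T$ and $\mathbb G_{T'}$ are monoidally equivalent. -/

import Mathlib

noncomputable section
namespace TriangleQG
open scoped TensorProduct ENNReal ComplexOrder

section HilbertTensor
variable {H K : Type*} [NormedAddCommGroup H] [InnerProductSpace ℂ H]
  [NormedAddCommGroup K] [InnerProductSpace ℂ K]

variable (H K) in
/-- The Hilbert space tensor product of two Hilbert spaces (completed algebraic tensor product). -/
abbrev HilbertTensor : Type _ := UniformSpace.Completion (H ⊗[ℂ] K)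

/-- The bounded operator `S ⊗ T`. -/
def tensorOp (S : H →L[ℂ] H) (T : K →L[ℂ] K) : HilbertTensor H K →L[ℂ] HilbertTensor H K :=
  (TensorProduct.mapL S T).completion

@[simp] lemma tensorOp_coe (S : H →L[ℂ] H) (T : K →L[ℂ] K) (x : H ⊗[ℂ] K) :
    tensorOp S T (x : HilbertTensor H K) = (TensorProduct.mapL S T x : H ⊗[ℂ] K) := by
  exact ContinuousLinearMap.completion_apply_coe _ _

lemma op_ext {S T : HilbertTensor H K →L[ℂ] HilbertTensor H K}
    (h : ∀ (x : H) (y : K), S ((x ⊗ₜ[ℂ] y : H ⊗[ℂ] K) : HilbertTensor H K) =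
      T ((x ⊗ₜ[ℂ] y : H ⊗[ℂ] K) : HilbertTensor H K)) : S = T := by
  ext z
  induction z using UniformSpace.Completion.induction_on with
  | hp => exact isClosed_eq S.continuous T.continuous
  | ih z =>
    induction z using TensorProduct.induction_on with
    | zero => exact (map_zero S).trans (map_zero T).symm
    | tmul x y => exact h x y
    | add a b ha hb => simp [UniformSpace.Completion.coe_add, ha, hb]

lemma tensorOp_mul (S S' : H →L[ℂ] H) (T T' : K →L[ℂ] K) :
    tensorOp (S * S') (T * T') = tensorOp S T * tensorOp S' T' :=
  op_ext fun x y => by simp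

lemma tensorOp_star [CompleteSpace H] [CompleteSpace K] (S : H →L[ℂ] H) (T : K →L[ℂ] K) :
    tensorOp (star S) (star T) = star (tensorOp S T) := by
  rw [ContinuousLinearMap.star_eq_adjoint (tensorOp S T), ContinuousLinearMap.eq_adjoint_iff]
  intro x y
  induction x, y using UniformSpace.Completion.induction_on₂ with
  | hp => apply isClosed_eq <;> fun_prop
  | ih x y =>
    simp only [tensorOp_coe, UniformSpace.Completion.inner_coe]
    induction x using TensorProduct.induction_on with
    | zero => simp
    | add a b ha hb => simp only [map_add, inner_add_left, ha, hb]
    | tmul a b =>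
      induction y using TensorProduct.induction_on with
      | zero => simp
      | add a b ha hb => simp only [map_add, inner_add_right, ha, hb]
      | tmul c d =>
        simp [ContinuousLinearMap.star_eq_adjoint, ContinuousLinearMap.adjoint_inner_left]

variable (H K) in
/-- The *-homomorphism `S ↦ S ⊗ 1`. -/
def leftOp [CompleteSpace H] [CompleteSpace K] :
    (H →L[ℂ] H) →⋆ₐ[ℂ] (HilbertTensor H K →L[ℂ] HilbertTensor H K) where
  toFun S := tensorOp S 1
  map_one' := op_ext fun x y => by simp
  map_mul' S S' := by rw [← tensorOp_mul, mul_one]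
  map_zero' := op_ext fun x y => by simp
  map_add' S S' := op_ext fun x y => by
    simp [TensorProduct.add_tmul, UniformSpace.Completion.coe_add]
  commutes' c := op_ext fun x y => by
    simp [Algebra.algebraMap_eq_smul_one, ← TensorProduct.smul_tmul', UniformSpace.Completion.coe_smul]
  map_star' S := by rw [← tensorOp_star, star_one]

variable (H K) in
/-- The *-homomorphism `T ↦ 1 ⊗ T`. -/
def rightOp [CompleteSpace H] [CompleteSpace K] :
    (K →L[ℂ] K) →⋆ₐ[ℂ] (HilbertTensor H K →L[ℂ] HilbertTensor H K) where
  toFun T := tensorOp 1 T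
  map_one' := op_ext fun x y => by simp
  map_mul' S S' := by rw [← tensorOp_mul, mul_one]
  map_zero' := op_ext fun x y => by simp
  map_add' S S' := op_ext fun x y => by
    simp [TensorProduct.tmul_add, UniformSpace.Completion.coe_add]
  commutes' c := op_ext fun x y => by
    simp [Algebra.algebraMap_eq_smul_one]
  map_star' S := by rw [← tensorOp_star, star_one]

lemma leftOp_mul_rightOp [CompleteSpace H] [CompleteSpace K] (S : H →L[ℂ] H) (T : K →L[ℂ] K) :
    leftOp H K S * rightOp H K T = tensorOp S T := by
  change tensorOp S 1 * tensorOp 1 T = _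
  rw [← tensorOp_mul, mul_one, one_mul]

lemma rightOp_mul_leftOp [CompleteSpace H] [CompleteSpace K] (S : H →L[ℂ] H) (T : K →L[ℂ] K) :
    rightOp H K T * leftOp H K S = tensorOp S T := by
  change tensorOp 1 T * tensorOp S 1 = _
  rw [← tensorOp_mul, mul_one, one_mul]

end HilbertTensor

section BoundedProduct
variable {I : Type*} {B : I → Type*} [∀ i, Nontrivial (B i)] [∀ i, CStarAlgebra (B i)]

variable (B) in
/-- The C*-algebra of all bounded families `(x i)` with `x i ∈ B i`, with the supremum norm. -/
abbrev BoundedProduct : Type _ := lp B ∞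

/-- The C*-algebra of bounded families is a unital C*-algebra. -/
instance : CStarAlgebra (BoundedProduct B) where

/-- The *-homomorphism `a ↦ (φ i a)` into the bounded families. -/
def prodHom {A : Type*} [CStarAlgebra A] (φ : ∀ i, A →⋆ₐ[ℂ] B i) : A →⋆ₐ[ℂ] BoundedProduct B where
  toFun a := ⟨fun i => φ i a, memℓp_infty ⟨‖a‖, by
    rintro _ ⟨i, rfl⟩; exact NonUnitalStarAlgHom.norm_apply_le (φ i) a⟩⟩
  map_one' := by ext i; simp
  map_mul' a b := by ext i; simp
  map_zero' := by ext i; simp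
  map_add' a b := by ext i; exact map_add (φ i) a b
  commutes' c := by ext i; simp [Algebra.algebraMap_eq_smul_one]
  map_star' a := by ext i; simp [map_star]

end BoundedProduct

section MinTensor

attribute [local instance] CStarAlgebra.spectralOrder CStarAlgebra.spectralOrderedRing

/-- The states of a unital C*-algebra. -/
def State (A : Type*) [CStarAlgebra A] : Type _ := {f : A →ₚ[ℂ] ℂ // f 1 = 1}

variable {A B : Type*} [CStarAlgebra A] [CStarAlgebra B]

/-- The GNS Hilbert space of a state. -/
abbrev State.Space (f : State A) : Type _ := f.1.GNS

/-- The GNS representation of a state. -/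
def State.rep (f : State A) : A →⋆ₐ[ℂ] (f.Space →L[ℂ] f.Space) := f.1.gnsStarAlgHom

/-- The canonical cyclic unit vector of the GNS representation. -/
def State.vec (f : State A) : f.Space := ((f.1.toPreGNS 1 : f.1.PreGNS) : f.1.GNS)

lemma State.norm_vec (f : State A) : ‖f.vec‖ = 1 := by
  simp [State.vec, PositiveLinearMap.preGNS_norm_def, f.2]

instance (p : State A × State B) : Nontrivial (HilbertTensor p.1.Space p.2.Space) :=
  ⟨((p.1.vec ⊗ₜ[ℂ] p.2.vec : p.1.Space ⊗[ℂ] p.2.Space) : HilbertTensor p.1.Space p.2.Space), 0,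
    fun h => by
      have := congrArg norm h
      simp [State.norm_vec] at this⟩

variable (A B) in
/-- Bounded families of operators on `H_f ⊗ K_g`, for all states `f` of `A` and `g` of `B`. -/
abbrev MinTensorAmbient : Type _ :=
  BoundedProduct (fun p : State A × State B =>
    HilbertTensor p.1.Space p.2.Space →L[ℂ] HilbertTensor p.1.Space p.2.Space)

variable (A B) in
/-- `a ↦ (π_f(a) ⊗ 1)_{f, g}`. -/
def ambientLeft : A →⋆ₐ[ℂ] MinTensorAmbient A B :=
  prodHom fun p => (leftOp p.1.Space p.2.Space).comp p.1.rep

variable (A B) in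
/-- `b ↦ (1 ⊗ π_g(b))_{f, g}`. -/
def ambientRight : B →⋆ₐ[ℂ] MinTensorAmbient A B :=
  prodHom fun p => (rightOp p.1.Space p.2.Space).comp p.2.rep

variable (A B) in
/-- The C*-algebra generated by all `(π_f(a) ⊗ π_g(b))_{f, g}`. -/
def minTensorSubalgebra : StarSubalgebra ℂ (MinTensorAmbient A B) :=
  (StarAlgebra.adjoin ℂ
    (Set.range (ambientLeft A B) ∪ Set.range (ambientRight A B))).topologicalClosure

variable (A B) in
/-- The minimal (spatial) tensor product of two unital C*-algebras: the closure of the algebraic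
tensor product in the operators on `(⊕ H_f) ⊗ (⊕ K_g)`, where `f` and `g` run over all states,
so that the sums of the GNS representations are faithful. Operators that are diagonal for the
decomposition `⊕ (H_f ⊗ K_g)` are written as bounded families. -/
def MinTensor : Type _ := minTensorSubalgebra A B

variable (A B) in
/-- The C*-algebra structure of `MinTensor A B`. -/
def MinTensor.cstar : CStarAlgebra (MinTensor A B) :=
  StarSubalgebra.cstarAlgebra (minTensorSubalgebra A B)
    (h_closed := StarSubalgebra.isClosed_topologicalClosure _)

instance : CStarAlgebra (MinTensor A B) := MinTensor.cstar A B

variable (A B) in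
/-- `a ↦ a ⊗ 1`. -/
def inclLeft : A →⋆ₐ[ℂ] MinTensor A B :=
  StarAlgHom.codRestrict (ambientLeft A B) (minTensorSubalgebra A B) fun a =>
    StarSubalgebra.le_topologicalClosure _
      (StarAlgebra.subset_adjoin ℂ _ (Or.inl ⟨a, rfl⟩))

variable (A B) in
/-- `b ↦ 1 ⊗ b`. -/
def inclRight : B →⋆ₐ[ℂ] MinTensor A B :=
  StarAlgHom.codRestrict (ambientRight A B) (minTensorSubalgebra A B) fun b =>
    StarSubalgebra.le_topologicalClosure _
      (StarAlgebra.subset_adjoin ℂ _ (Or.inr ⟨b, rfl⟩))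

/-- The elementary tensor `a ⊗ b`. -/
def mtmul (a : A) (b : B) : MinTensor A B := inclLeft A B a * inclRight A B b

lemma inclRight_mul_inclLeft (a : A) (b : B) :
    inclRight A B b * inclLeft A B a = mtmul a b := by
  apply Subtype.ext
  apply Subtype.ext
  funext p
  exact (rightOp_mul_leftOp (p.1.rep a) (p.2.rep b)).trans
    (leftOp_mul_rightOp (p.1.rep a) (p.2.rep b)).symm

end MinTensor

section Universal
variable {F : Type} [Fintype F] [DecidableEq F]

/-- The defining relations of `C(𝔾_T)` for a matrix `(b i j)` over a unital C*-algebra: it is unitary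
and `∑ b_{ia} b_{jb} b_{kc}`, over all `(a, b, c) ∈ T`, is `1` if `(i, j, k) ∈ T` and `0` if not. -/
structure IsTriangleUnitary (T : Finset (F × F × F)) {B : Type*} [CStarAlgebra B]
    (b : Matrix F F B) : Prop where
  unitary : b ∈ unitary (Matrix F F B)
  rel : ∀ i j k : F, ∑ t ∈ T, b i t.1 * b j t.2.1 * b k t.2.2 = if (i, j, k) ∈ T then 1 else 0

/-- Noncommutative polynomials in the variables `u_{ij}` (left) and `u_{ij}^*` (right). -/
abbrev NCPoly (F : Type) : Type := FreeAlgebra ℂ ((F × F) ⊕ (F × F))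

/-- Evaluation of a noncommutative *-polynomial at a matrix over a C*-algebra. -/
def evalPoly {B : Type*} [CStarAlgebra B] (b : Matrix F F B) : NCPoly F →ₐ[ℂ] B :=
  FreeAlgebra.lift ℂ (Sum.elim (fun x => b x.1 x.2) (fun x => star (b x.1 x.2)))

/-- The C*-seminorms on *-polynomials that come from a nonzero unital C*-algebra with a matrix
satisfying the relations. This set indexes, up to isomorphism, all C*-algebras generated by such a
matrix. (These are separable, so that taking C*-algebras in `Type` is no restriction.) -/
def triangleSeminorms (T : Finset (F × F × F)) : Set (NCPoly F → ℝ) :=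
  {p | ∃ (B : Type) (_ : CStarAlgebra B) (b : Matrix F F B),
    Nontrivial B ∧ IsTriangleUnitary T b ∧ ∀ x, p x = ‖evalPoly b x‖}

variable {T : Finset (F × F × F)}

/-- A C*-algebra that realizes the given seminorm. -/
def Chosen (p : triangleSeminorms T) : Type := p.2.choose

instance (p : triangleSeminorms T) : CStarAlgebra (Chosen p) := p.2.choose_spec.choose

/-- The matrix, in the C*-algebra that realizes the given seminorm, satisfying the relations. -/
def chosenMatrix (p : triangleSeminorms T) : Matrix F F (Chosen p) :=
  p.2.choose_spec.choose_spec.choose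

lemma chosen_spec (p : triangleSeminorms T) :
    Nontrivial (Chosen p) ∧ IsTriangleUnitary T (chosenMatrix p) ∧
      ∀ x, p.1 x = ‖evalPoly (chosenMatrix p) x‖ :=
  p.2.choose_spec.choose_spec.choose_spec

instance (p : triangleSeminorms T) : Nontrivial (Chosen p) := (chosen_spec p).1

lemma norm_entry_le {B : Type*} [CStarAlgebra B] {b : Matrix F F B}
    (hb : b ∈ unitary (Matrix F F B)) (i j : F) : ‖b i j‖ ≤ 1 := by
  let _ := CStarAlgebra.spectralOrder B
  have := CStarAlgebra.spectralOrderedRing B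
  have h : ∑ k, star (b k j) * b k j = 1 := by
    have := congrFun (congrFun (Unitary.mem_iff.1 hb).1 j) j
    simpa [Matrix.mul_apply, Matrix.star_apply] using this
  have h1 : star (b i j) * b i j ≤ 1 := by
    rw [← h]
    exact Finset.single_le_sum (f := fun k => star (b k j) * b k j)
      (fun k _ => star_mul_self_nonneg _) (Finset.mem_univ i)
  have h2 := CStarAlgebra.norm_le_norm_of_nonneg_of_le (star_mul_self_nonneg _) h1
  rw [CStarRing.norm_star_mul_self] at h2
  have h3 : ‖(1 : B)‖ ≤ 1 := by
    rcases subsingleton_or_nontrivial B with _ | _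
    · simp [Subsingleton.elim (1 : B) 0]
    · simp
  nlinarith [norm_nonneg (b i j)]

variable (T) in
/-- The direct sum of all matrices satisfying the relations. -/
def bigMatrix : Matrix F F (BoundedProduct (Chosen (T := T))) := fun i j =>
  ⟨fun p => chosenMatrix p i j, memℓp_infty ⟨1, by
    rintro _ ⟨p, rfl⟩; exact norm_entry_le (chosen_spec p).2.1.unitary i j⟩⟩

lemma lp_coe_sum {ι I : Type*} {B : I → Type*} [∀ i, Nontrivial (B i)] [∀ i, CStarAlgebra (B i)]
    (s : Finset ι) (f : ι → BoundedProduct B) (i : I) :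
    (∑ t ∈ s, f t : BoundedProduct B) i = ∑ t ∈ s, f t i := by
  classical
  induction s using Finset.induction_on with
  | empty => rfl
  | insert a s ha ih => rw [Finset.sum_insert ha, Finset.sum_insert ha, ← ih]; rfl

lemma bigMatrix_isTriangleUnitary : IsTriangleUnitary T (bigMatrix T) where
  unitary := by
    rw [Unitary.mem_iff]
    constructor
    · ext i j p
      have := congrFun (congrFun (Unitary.mem_iff.1 (chosen_spec p).2.1.unitary).1 i) j
      simp only [Matrix.mul_apply, Matrix.star_apply] at this ⊢
      rw [lp_coe_sum]
      refine this.trans ?_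
      by_cases h : i = j <;> simp [Matrix.one_apply, h]
    · ext i j p
      have := congrFun (congrFun (Unitary.mem_iff.1 (chosen_spec p).2.1.unitary).2 i) j
      simp only [Matrix.mul_apply, Matrix.star_apply] at this ⊢
      rw [lp_coe_sum]
      refine this.trans ?_
      by_cases h : i = j <;> simp [Matrix.one_apply, h]
  rel i j k := by
    ext p
    rw [lp_coe_sum]
    refine ((chosen_spec p).2.1.rel i j k).trans ?_
    by_cases h : (i, j, k) ∈ T <;> simp [h]

lemma evalPoly_map {F : Type} {B C : Type*} [CStarAlgebra B] [CStarAlgebra C] (φ : B →⋆ₐ[ℂ] C)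
    (b : Matrix F F B) (x : NCPoly F) : φ (evalPoly b x) = evalPoly (b.map φ) x := by
  have : (φ : B →ₐ[ℂ] C).comp (evalPoly b) = evalPoly (b.map φ) := by
    apply FreeAlgebra.hom_ext
    funext s
    rcases s with s | s <;> simp [evalPoly, map_star]
  exact congrArg (fun f => f x) this

lemma exists_star_poly {F : Type} (x : NCPoly F) : ∃ y : NCPoly F, ∀ (B : Type) [CStarAlgebra B]
    (b : Matrix F F B), evalPoly b y = star (evalPoly b x) := by
  induction x using FreeAlgebra.induction with
  | grade0 c => exact ⟨algebraMap _ _ (star c), fun B _ b => by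
      simp only [AlgHom.commutes, algebraMap_star_comm]⟩
  | grade1 s =>
    rcases s with s | s
    · exact ⟨FreeAlgebra.ι ℂ (Sum.inr s), fun B _ b => by simp [evalPoly]⟩
    · exact ⟨FreeAlgebra.ι ℂ (Sum.inl s), fun B _ b => by simp [evalPoly]⟩
  | mul x y hx hy =>
    obtain ⟨x', hx⟩ := hx
    obtain ⟨y', hy⟩ := hy
    exact ⟨y' * x', fun B _ b => by simp [hx, hy]⟩
  | add x y hx hy =>
    obtain ⟨x', hx⟩ := hx
    obtain ⟨y', hy⟩ := hy
    exact ⟨x' + y', fun B _ b => by simp [hx, hy]⟩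

lemma exists_poly {B : Type} [CStarAlgebra B] (b : Matrix F F B) {z : B}
    (hz : z ∈ StarAlgebra.adjoin ℂ (Set.range fun x : F × F => b x.1 x.2)) :
    ∃ x : NCPoly F, evalPoly b x = z := by
  induction hz using StarAlgebra.adjoin_induction with
  | mem z hz => 
    obtain ⟨s, rfl⟩ := hz
    exact ⟨FreeAlgebra.ι ℂ (Sum.inl s), by simp [evalPoly]⟩
  | algebraMap c => exact ⟨algebraMap _ _ c, by simp⟩
  | add x y _ _ hx hy =>
    obtain ⟨x', rfl⟩ := hx
    obtain ⟨y', rfl⟩ := hy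
    exact ⟨x' + y', by simp⟩
  | mul x y _ _ hx hy =>
    obtain ⟨x', rfl⟩ := hx
    obtain ⟨y', rfl⟩ := hy
    exact ⟨x' * y', by simp⟩
  | star x _ hx =>
    obtain ⟨x', rfl⟩ := hx
    obtain ⟨y, hy⟩ := exists_star_poly x'
    exact ⟨y, hy B b⟩

lemma norm_evalPoly_le {B : Type} [CStarAlgebra B] {b : Matrix F F B}
    (hb : IsTriangleUnitary T b) (x : NCPoly F) :
    ‖evalPoly b x‖ ≤ ‖evalPoly (bigMatrix T) x‖ := by
  rcases subsingleton_or_nontrivial B with _ | hB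
  · simp [Subsingleton.elim (evalPoly b x) 0]
  · let p : triangleSeminorms T := ⟨fun x => ‖evalPoly b x‖, B, _, b, hB, hb, fun _ => rfl⟩
    have h1 : ‖evalPoly b x‖ = ‖evalPoly (chosenMatrix p) x‖ := (chosen_spec p).2.2 x
    have h2 : evalPoly (chosenMatrix p) x = (evalPoly (bigMatrix T) x : BoundedProduct _) p := by
      induction x using FreeAlgebra.induction with
      | grade0 c => simp [Algebra.algebraMap_eq_smul_one]
      | grade1 s => rcases s with s | s <;> simp [evalPoly, bigMatrix]
      | mul x y hx hy =>
        rw [map_mul, map_mul, hx ((chosen_spec p).2.2 x), hy ((chosen_spec p).2.2 y)]; rfl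
      | add x y hx hy =>
        rw [map_add, map_add, hx ((chosen_spec p).2.2 x), hy ((chosen_spec p).2.2 y)]; rfl
    rw [h1, h2]
    exact lp.norm_apply_le_norm (by simp) _ p

variable (T) in
/-- The C*-algebra generated by the entries of the direct sum of all such matrices. -/
def universalSubalgebra : StarSubalgebra ℂ (BoundedProduct (Chosen (T := T))) :=
  (StarAlgebra.adjoin ℂ (Set.range fun x : F × F => bigMatrix T x.1 x.2)).topologicalClosure

variable (T) in
/-- `C(𝔾_T)`, the universal unital C*-algebra generated by the entries of a matrix satisfying the
relations. Its universal property is given by `CGT.lift`, `CGT.lift_fundMatrix`, `CGT.hom_ext`. -/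
def CGT : Type := universalSubalgebra T

variable (T) in
/-- The C*-algebra structure of `CGT T`. -/
def CGT.cstar : CStarAlgebra (CGT T) :=
  StarSubalgebra.cstarAlgebra (universalSubalgebra T)
    (h_closed := StarSubalgebra.isClosed_topologicalClosure _)

instance : CStarAlgebra (CGT T) := CGT.cstar T

variable (T) in
/-- The canonical generators `u_{ij}` of `C(𝔾_T)`: the fundamental representation. -/
def fundMatrix : Matrix F F (CGT T) := fun i j =>
  ⟨bigMatrix T i j, StarSubalgebra.le_topologicalClosure _
    (StarAlgebra.subset_adjoin ℂ _ ⟨(i, j), rfl⟩)⟩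

variable (T) in
/-- The inclusion in the bounded families. -/
def CGT.incl : CGT T →⋆ₐ[ℂ] BoundedProduct (Chosen (T := T)) := (universalSubalgebra T).subtype

lemma CGT.incl_injective : Function.Injective (CGT.incl T) := Subtype.val_injective

lemma IsTriangleUnitary.of_map {B C : Type*} [CStarAlgebra B] [CStarAlgebra C] (φ : B →⋆ₐ[ℂ] C)
    (hφ : Function.Injective φ) {b : Matrix F F B} (h : IsTriangleUnitary T (b.map φ)) :
    IsTriangleUnitary T b where
  unitary := by
    rw [Unitary.mem_iff]
    constructor
    · ext i j
      apply hφ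
      have := congrFun (congrFun (Unitary.mem_iff.1 h.unitary).1 i) j
      simp only [Matrix.mul_apply, Matrix.star_apply, Matrix.map_apply] at this
      simp only [Matrix.mul_apply, Matrix.star_apply, map_sum, map_mul, map_star, this]
      by_cases h : i = j <;> simp [Matrix.one_apply, h]
    · ext i j
      apply hφ
      have := congrFun (congrFun (Unitary.mem_iff.1 h.unitary).2 i) j
      simp only [Matrix.mul_apply, Matrix.star_apply, Matrix.map_apply] at this
      simp only [Matrix.mul_apply, Matrix.star_apply, map_sum, map_mul, map_star, this]
      by_cases h : i = j <;> simp [Matrix.one_apply, h]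
  rel i j k := by
    apply hφ
    have := h.rel i j k
    simp only [Matrix.map_apply] at this
    rw [map_sum]
    simp only [map_mul, this]
    split_ifs <;> simp

variable (T) in
lemma fundMatrix_isTriangleUnitary : IsTriangleUnitary T (fundMatrix T) :=
  IsTriangleUnitary.of_map (CGT.incl T) CGT.incl_injective bigMatrix_isTriangleUnitary

variable (T) in
lemma CGT.isometry_incl : Isometry (CGT.incl T) :=
  NonUnitalStarAlgHom.isometry (CGT.incl T) CGT.incl_injective

variable (T) in
/-- The entries of the fundamental representation generate `C(𝔾_T)`. -/
lemma CGT.dense : (StarAlgebra.adjoin ℂ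
    (Set.range fun x : F × F => fundMatrix T x.1 x.2)).topologicalClosure = ⊤ := by
  rw [eq_top_iff]
  intro x _
  have hx : CGT.incl T x ∈ universalSubalgebra T := x.2
  have hmap : StarSubalgebra.map (CGT.incl T) (StarAlgebra.adjoin ℂ
      (Set.range fun x : F × F => fundMatrix T x.1 x.2)) =
      StarAlgebra.adjoin ℂ (Set.range fun x : F × F => bigMatrix T x.1 x.2) := by
    rw [StarAlgHom.map_adjoin, ← Set.range_comp]
    rfl
  have : CGT.incl T x ∈ closure (CGT.incl T '' (StarAlgebra.adjoin ℂ
      (Set.range fun x : F × F => fundMatrix T x.1 x.2) : Set (CGT T))) := by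
    rw [← StarSubalgebra.coe_map, hmap]
    exact hx
  have hind : Topology.IsInducing (CGT.incl T) :=
    (CGT.isometry_incl T).isUniformInducing.isInducing
  change x ∈ closure _
  rw [hind.closure_eq_preimage_closure_image]
  exact this

section lift
variable {B : Type} [CStarAlgebra B] {b : Matrix F F B}

/-- The C*-algebra generated by the direct sum of the universal matrix and `b`. -/
def graphSubalgebra (T : Finset (F × F × F)) (b : Matrix F F B) :
    StarSubalgebra ℂ (BoundedProduct (Chosen (T := T)) × B) :=
  (StarAlgebra.adjoin ℂ
    (Set.range fun x : F × F => (bigMatrix T x.1 x.2, b x.1 x.2))).topologicalClosure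

lemma graph_norm_le (hb : IsTriangleUnitary T b) {z} (hz : z ∈ graphSubalgebra T b) :
    ‖z.2‖ ≤ ‖z.1‖ := by
  have hcl : IsClosed {z : BoundedProduct (Chosen (T := T)) × B | ‖z.2‖ ≤ ‖z.1‖} :=
    isClosed_le (by fun_prop) (by fun_prop)
  refine closure_minimal ?_ hcl hz
  intro z hz
  obtain ⟨x, rfl⟩ := exists_poly (B := BoundedProduct (Chosen (T := T)) × B)
    (fun i j => (bigMatrix T i j, b i j)) hz
  have h1 := evalPoly_map (StarAlgHom.fst ℂ (BoundedProduct (Chosen (T := T))) B)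
    (fun i j => (bigMatrix T i j, b i j)) x
  have h2 := evalPoly_map (StarAlgHom.snd ℂ (BoundedProduct (Chosen (T := T))) B)
    (fun i j => (bigMatrix T i j, b i j)) x
  have := norm_evalPoly_le hb x
  rw [Set.mem_ofPred_eq]
  exact (congrArg norm h2).trans_le (this.trans (congrArg norm h1).symm.le)


variable (T b) in
/-- The projection of that algebra on its first summand. -/
def graphFst : graphSubalgebra T b →⋆ₐ[ℂ] BoundedProduct (Chosen (T := T)) :=
  (StarAlgHom.fst ℂ _ B).comp (graphSubalgebra T b).subtype

lemma isometry_graphFst (hb : IsTriangleUnitary T b) : Isometry (graphFst T b) := by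
  refine AddMonoidHomClass.isometry_of_norm (graphFst T b) fun z => ?_
  have := graph_norm_le hb z.2
  exact (max_eq_left this).symm

lemma universal_le_range (hb : IsTriangleUnitary T b) :
    universalSubalgebra T ≤ (graphFst T b).range := by
  have : CompleteSpace (graphSubalgebra T b) :=
    (StarSubalgebra.isClosed_topologicalClosure _).completeSpace_coe
  refine StarSubalgebra.topologicalClosure_minimal (StarAlgebra.adjoin_le ?_) ?_
  · rintro _ ⟨x, rfl⟩
    exact ⟨⟨(bigMatrix T x.1 x.2, b x.1 x.2), StarSubalgebra.le_topologicalClosure _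
      (StarAlgebra.subset_adjoin ℂ _ ⟨x, rfl⟩)⟩, rfl⟩
  · have := (isometry_graphFst hb).isClosedEmbedding.isClosed_range
    convert this using 1
    ext; rfl

/-- The *-homomorphism given by the universal property. -/
def CGT.lift (b : Matrix F F B) (hb : IsTriangleUnitary T b) : CGT T →⋆ₐ[ℂ] B :=
  ((StarAlgHom.snd ℂ _ B).comp (graphSubalgebra T b).subtype).comp
    ((StarAlgEquiv.ofInjective (graphFst T b) (isometry_graphFst hb).injective).symm :
      (graphFst T b).range →⋆ₐ[ℂ] graphSubalgebra T b) |>.comp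
    (StarAlgHom.codRestrict (CGT.incl T) _ fun x => universal_le_range hb x.2)

lemma CGT.lift_fundMatrix (hb : IsTriangleUnitary T b) (i j : F) :
    CGT.lift b hb (fundMatrix T i j) = b i j := by
  let z : graphSubalgebra T b := ⟨(bigMatrix T i j, b i j),
    StarSubalgebra.le_topologicalClosure _ (StarAlgebra.subset_adjoin ℂ _ ⟨(i, j), rfl⟩)⟩
  let e := StarAlgEquiv.ofInjective (graphFst T b) (isometry_graphFst hb).injective
  have : (⟨bigMatrix T i j, universal_le_range hb (fundMatrix T i j).2⟩ : (graphFst T b).range) =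
      e z := rfl
  change (e.symm ⟨bigMatrix T i j, _⟩ : graphSubalgebra T b).1.2 = _
  rw [this, e.symm_apply_apply]

/-- A *-homomorphism on `C(𝔾_T)` is determined by its values on the generators. -/
lemma CGT.hom_ext {φ ψ : CGT T →⋆ₐ[ℂ] B}
    (h : ∀ i j, φ (fundMatrix T i j) = ψ (fundMatrix T i j)) : φ = ψ := by
  have hcl : IsClosed {x | φ x = ψ x} :=
    isClosed_eq
      (AddMonoidHomClass.continuous_of_bound φ 1 fun x => by
        simpa using NonUnitalStarAlgHom.norm_apply_le φ x)
      (AddMonoidHomClass.continuous_of_bound ψ 1 fun x => by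
        simpa using NonUnitalStarAlgHom.norm_apply_le ψ x)
  have : StarAlgebra.adjoin ℂ (Set.range fun x : F × F => fundMatrix T x.1 x.2) ≤
      StarAlgHom.equalizer φ ψ := StarAlgebra.adjoin_le (by rintro _ ⟨x, rfl⟩; exact h _ _)
  have h2 := StarSubalgebra.topologicalClosure_minimal this hcl
  rw [CGT.dense] at h2
  exact StarAlgHom.ext fun x => h2 (StarSubalgebra.mem_top)

end lift
end Universal

section Comul
variable {F : Type} [Fintype F] [DecidableEq F]

lemma IsTriangleUnitary.map {T : Finset (F × F × F)} {B C : Type*} [CStarAlgebra B]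
    [CStarAlgebra C] (φ : B →⋆ₐ[ℂ] C) {b : Matrix F F B} (h : IsTriangleUnitary T b) :
    IsTriangleUnitary T (b.map φ) where
  unitary := by
    rw [Unitary.mem_iff]
    constructor
    · ext i j
      have := congrArg φ (congrFun (congrFun (Unitary.mem_iff.1 h.unitary).1 i) j)
      simp only [Matrix.mul_apply, Matrix.star_apply, map_sum, map_mul, map_star] at this
      simp only [Matrix.mul_apply, Matrix.star_apply, Matrix.map_apply, this]
      by_cases h : i = j <;> simp [Matrix.one_apply, h]
    · ext i j
      have := congrArg φ (congrFun (congrFun (Unitary.mem_iff.1 h.unitary).2 i) j)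
      simp only [Matrix.mul_apply, Matrix.star_apply, map_sum, map_mul, map_star] at this
      simp only [Matrix.mul_apply, Matrix.star_apply, Matrix.map_apply, this]
      by_cases h : i = j <;> simp [Matrix.one_apply, h]
  rel i j k := by
    have := congrArg φ (h.rel i j k)
    simp only [map_sum, map_mul] at this
    simp only [Matrix.map_apply, this]
    split_ifs <;> simp

lemma IsTriangleUnitary.mul {T : Finset (F × F × F)} {B : Type*} [CStarAlgebra B]
    {b c : Matrix F F B} (hb : IsTriangleUnitary T b) (hc : IsTriangleUnitary T c)
    (hbc : ∀ i j k l, c k l * b i j = b i j * c k l) : IsTriangleUnitary T (b * c) where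
  unitary := mul_mem hb.unitary hc.unitary
  rel i j k := by
    have key : ∀ x y z x' y' z' : F, b i x * c x x' * (b j y * c y y') * (b k z * c z z') =
        b i x * b j y * b k z * (c x x' * c y y' * c z z') := by
      intro x y z x' y' z'
      calc _ = b i x * (c x x' * b j y) * (c y y' * b k z) * c z z' := by simp only [mul_assoc]
        _ = b i x * b j y * (c x x' * b k z) * c y y' * c z z' := by
          rw [hbc, hbc]; simp only [mul_assoc]
        _ = _ := by rw [hbc]; simp only [mul_assoc]
    calc ∑ t ∈ T, (b * c) i t.1 * (b * c) j t.2.1 * (b * c) k t.2.2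
        = ∑ t ∈ T, ∑ z, ∑ x, ∑ y, b i x * b j y * b k z * (c x t.1 * c y t.2.1 * c z t.2.2) := by
          refine Finset.sum_congr rfl fun t _ => ?_
          simp only [Matrix.mul_apply, Finset.sum_mul, Finset.mul_sum, key]
          exact Finset.sum_congr rfl fun z _ => Finset.sum_comm
      _ = ∑ z, ∑ x, ∑ y, b i x * b j y * b k z * if (x, y, z) ∈ T then 1 else 0 := by
          rw [Finset.sum_comm]
          refine Finset.sum_congr rfl fun z _ => ?_
          rw [Finset.sum_comm]
          refine Finset.sum_congr rfl fun x _ => ?_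
          rw [Finset.sum_comm]
          refine Finset.sum_congr rfl fun y _ => ?_
          rw [← Finset.mul_sum, hc.rel]
      _ = ∑ t : F × F × F, if t ∈ T then b i t.1 * b j t.2.1 * b k t.2.2 else 0 := by
          simp only [Fintype.sum_prod_type, mul_ite, mul_one, mul_zero]
          rw [Finset.sum_comm]
          refine Finset.sum_congr rfl fun z _ => ?_
          rw [Finset.sum_comm]
      _ = _ := by
          rw [← hb.rel i j k, Finset.sum_ite_mem, Finset.univ_inter]

lemma comul_aux (T : Finset (F × F × F)) : IsTriangleUnitary T
    (Matrix.of fun i j => ∑ k, mtmul (fundMatrix T i k) (fundMatrix T k j) :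
      Matrix F F (MinTensor (CGT T) (CGT T))) :=
  ((fundMatrix_isTriangleUnitary T).map (inclLeft (CGT T) (CGT T))).mul
    ((fundMatrix_isTriangleUnitary T).map (inclRight (CGT T) (CGT T)))
    fun _ _ _ _ => inclRight_mul_inclLeft _ _

/-- The comultiplication of `𝔾_T`: the unique unital *-homomorphism
`Δ : C(𝔾_T) → C(𝔾_T) ⊗ C(𝔾_T)` (minimal tensor product) with `Δ(u_{ij}) = ∑ k, u_{ik} ⊗ u_{kj}`.
The pair `(C(𝔾_T), Δ)` is the compact quantum group `𝔾_T`. -/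
def comul (T : Finset (F × F × F)) : CGT T →⋆ₐ[ℂ] MinTensor (CGT T) (CGT T) :=
  CGT.lift _ (comul_aux T)

lemma comul_fundMatrix (T : Finset (F × F × F)) (i j : F) :
    comul T (fundMatrix T i j) = ∑ k, mtmul (fundMatrix T i k) (fundMatrix T k j) :=
  CGT.lift_fundMatrix (comul_aux T) i j
end Comul

section Rep
open CategoryTheory MonoidalCategory
open scoped Kronecker

variable {A : Type} [CStarAlgebra A]

/-- A finite-dimensional unitary representation, on the Hilbert space `ℂ^ι` for a finite index set
`ι`, of the quantum group given by a unital C*-algebra `A` with comultiplication `Δ`: a unitary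
element `(v i j)` of `B(ℂ^ι) ⊗ A` such that `Δ (v i j) = ∑ k, v i k ⊗ v k j`. -/
structure Rep (Δ : A →⋆ₐ[ℂ] MinTensor A A) where
  /-- the index set of the standard orthonormal basis -/
  ι : Type
  [fintype : Fintype ι]
  [decEq : DecidableEq ι]
  /-- the matrix coefficients -/
  mat : Matrix ι ι A
  unitary : mat ∈ unitary (Matrix ι ι A)
  comul : ∀ i j, Δ (mat i j) = ∑ k, mtmul (mat i k) (mat k j)

attribute [instance] Rep.fintype Rep.decEq

variable {Δ : A →⋆ₐ[ℂ] MinTensor A A}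

namespace Rep

/-- Intertwiners between `X` and `Y`: linear maps `S : ℂ^X.ι → ℂ^Y.ι`, given by their matrices, with
`Y (S ⊗ 1) = (S ⊗ 1) X`. -/
@[ext] structure Hom (X Y : Rep Δ) where
  /-- the matrix of the intertwiner -/
  mat : Matrix Y.ι X.ι ℂ
  comm : Y.mat * mat.map (algebraMap ℂ A) = mat.map (algebraMap ℂ A) * X.mat

lemma intertwine_iff {X Y : Rep Δ} (S : Matrix Y.ι X.ι ℂ) :
    Y.mat * S.map (algebraMap ℂ A) = S.map (algebraMap ℂ A) * X.mat ↔
      ∀ i j, ∑ k, S k j • Y.mat i k = ∑ k, S i k • X.mat k j := by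
  rw [← Matrix.ext_iff]
  simp only [Matrix.mul_apply, Matrix.map_apply, ← Algebra.commutes, ← Algebra.smul_def]

/-- The category of finite-dimensional unitary representations and intertwiners. -/
instance : Category (Rep Δ) where
  Hom := Hom
  id X := ⟨1, by simp⟩
  comp f g := ⟨g.mat * f.mat, by
    rw [Matrix.map_mul, ← Matrix.mul_assoc, g.comm, Matrix.mul_assoc, f.comm, Matrix.mul_assoc]⟩
  id_comp f := Hom.ext (Matrix.mul_one _)
  comp_id f := Hom.ext (Matrix.one_mul _)
  assoc f g h := Hom.ext (Matrix.mul_assoc _ _ _).symm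

@[ext] lemma hom_ext {X Y : Rep Δ} {f g : X ⟶ Y} (h : f.mat = g.mat) : f = g := Hom.ext h

@[simp] lemma id_mat (X : Rep Δ) : Hom.mat (𝟙 X) = 1 := rfl
@[simp] lemma comp_mat {X Y Z : Rep Δ} (f : X ⟶ Y) (g : Y ⟶ Z) :
    (f ≫ g).mat = g.mat * f.mat := rfl

instance homAdd (X Y : Rep Δ) : Add (X ⟶ Y) where
  add f g := ⟨f.mat + g.mat, by
    have hf := (intertwine_iff _).1 f.comm
    have hg := (intertwine_iff _).1 g.comm
    refine (intertwine_iff _).2 fun i j => ?_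
    simp only [Matrix.add_apply, add_smul, Finset.sum_add_distrib, hf, hg]⟩

instance homSMul (X Y : Rep Δ) : SMul ℂ (X ⟶ Y) where
  smul c f := ⟨c • f.mat, by
    have h := f.comm
    rw [intertwine_iff] at h ⊢
    intro i j
    simpa [Finset.smul_sum, mul_smul] using congrArg (c • ·) (h i j)⟩

instance homZero (X Y : Rep Δ) : Zero (X ⟶ Y) where
  zero := ⟨0, (intertwine_iff _).2 fun i j => by simp⟩

instance homNeg (X Y : Rep Δ) : Neg (X ⟶ Y) where
  neg f := ⟨-f.mat, (intertwine_iff _).2 fun i j => by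
    simpa using (intertwine_iff _).1 f.comm i j⟩

@[simp] lemma add_mat {X Y : Rep Δ} (f g : X ⟶ Y) : (f + g).mat = f.mat + g.mat := rfl
@[simp] lemma smul_mat {X Y : Rep Δ} (c : ℂ) (f : X ⟶ Y) : (c • f).mat = c • f.mat := rfl
@[simp] lemma zero_mat (X Y : Rep Δ) : (0 : X ⟶ Y).mat = 0 := rfl
@[simp] lemma neg_mat {X Y : Rep Δ} (f : X ⟶ Y) : (-f).mat = -f.mat := rfl

instance homAddCommGroup (X Y : Rep Δ) : AddCommGroup (X ⟶ Y) where
  add_assoc f g h := by ext1; simp [add_assoc]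
  zero_add f := by ext1; simp
  add_zero f := by ext1; simp
  neg_add_cancel f := by ext1; simp
  add_comm f g := by ext1; simp [add_comm]
  nsmul := nsmulRec
  zsmul := zsmulRec

instance : Preadditive (Rep Δ) where
  add_comp X Y Z f g h := by ext1; simp [Matrix.mul_add]
  comp_add X Y Z f g h := by ext1; simp [Matrix.add_mul]

instance : Linear ℂ (Rep Δ) where
  homModule X Y :=
    { one_smul := fun f => by ext1; simp
      mul_smul := fun a b f => by ext1; simp [mul_smul]
      smul_zero := fun a => by ext1; simp
      smul_add := fun a f g => by ext1; simp
      add_smul := fun a b f => by ext1; simp [add_smul]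
      zero_smul := fun f => by ext1; simp }
  smul_comp X Y Z c f g := by ext1; simp
  comp_smul X Y Z f c g := by ext1; simp

/-- The adjoint `f^*` of an intertwiner: the involution of the C*-tensor category `Rep Δ`. -/
def adj {X Y : Rep Δ} (f : X ⟶ Y) : Y ⟶ X where
  mat := f.mat.conjTranspose
  comm := by
    have h : star Y.mat * (Y.mat * f.mat.map (algebraMap ℂ A)) * star X.mat =
        star Y.mat * (f.mat.map (algebraMap ℂ A) * X.mat) * star X.mat := by rw [f.comm]
    rw [← Matrix.mul_assoc, (Unitary.mem_iff.1 Y.unitary).1, Matrix.one_mul, Matrix.mul_assoc,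
      Matrix.mul_assoc, (Unitary.mem_iff.1 X.unitary).2, Matrix.mul_one] at h
    have h2 := congrArg Matrix.conjTranspose h
    simp only [Matrix.star_eq_conjTranspose, Matrix.conjTranspose_mul,
      Matrix.conjTranspose_conjTranspose] at h2
    have h3 : (f.mat.map (algebraMap ℂ A)).conjTranspose =
        f.mat.conjTranspose.map (algebraMap ℂ A) := by
      ext i j
      rw [Matrix.conjTranspose_apply, Matrix.map_apply, Matrix.map_apply, Matrix.conjTranspose_apply,
        algebraMap_star_comm]
    rw [h3] at h2
    exact h2

/-- The tensor product `X₁₃ Y₂₃` of two representations, on `ℂ^X.ι ⊗ ℂ^Y.ι`. -/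
def tensor (X Y : Rep Δ) : Rep Δ where
  ι := X.ι × Y.ι
  mat := Matrix.of fun i j => X.mat i.1 j.1 * Y.mat i.2 j.2
  unitary := by
    have hX := Unitary.mem_iff.1 X.unitary
    have hY := Unitary.mem_iff.1 Y.unitary
    simp only [← Matrix.ext_iff, Matrix.mul_apply, Matrix.star_apply] at hX hY
    rw [Unitary.mem_iff]
    constructor
    · ext ⟨i, k⟩ ⟨j, l⟩
      simp only [Matrix.mul_apply, Matrix.star_apply, Matrix.of_apply, Fintype.sum_prod_type,
        star_mul]
      rw [Finset.sum_comm]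
      have : ∀ y, ∑ x, star (Y.mat y k) * star (X.mat x i) * (X.mat x j * Y.mat y l) =
          star (Y.mat y k) * (1 : Matrix X.ι X.ι A) i j * Y.mat y l := fun y => by
        rw [← hX.1, Finset.mul_sum, Finset.sum_mul]
        simp only [mul_assoc]
      simp only [this]
      by_cases hij : i = j
      · subst hij
        simp [hY.1, Matrix.one_apply]
      · simp [hij]
    · ext ⟨i, k⟩ ⟨j, l⟩
      simp only [Matrix.mul_apply, Matrix.star_apply, Matrix.of_apply, Fintype.sum_prod_type,
        star_mul]
      have : ∀ x, ∑ y, X.mat i x * Y.mat k y * (star (Y.mat l y) * star (X.mat j x)) =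
          X.mat i x * (1 : Matrix Y.ι Y.ι A) k l * star (X.mat j x) := fun x => by
        rw [← hY.2, Finset.mul_sum, Finset.sum_mul]
        simp only [mul_assoc]
      simp only [this]
      by_cases hij : k = l
      · subst hij
        simp [hX.2, Matrix.one_apply]
      · simp [hij]
  comul i j := by
    simp only [Matrix.of_apply, map_mul, X.comul, Y.comul, Finset.sum_mul_sum,
      Fintype.sum_prod_type, mtmul]
    refine Finset.sum_congr rfl fun k _ => Finset.sum_congr rfl fun l _ => ?_
    have h := inclRight_mul_inclLeft (Y.mat i.2 l) (X.mat k j.1)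
    rw [mtmul] at h
    simp only [mul_assoc]
    rw [← mul_assoc (inclRight A A (X.mat k j.1)), h]
    simp only [mul_assoc]

/-- The trivial representation on `ℂ`. -/
def unit (Δ : A →⋆ₐ[ℂ] MinTensor A A) : Rep Δ where
  ι := Unit
  mat := 1
  unitary := one_mem _
  comul i j := by simp [mtmul]

/-- The tensor product of intertwiners. -/
def tensorHom {X Y X' Y' : Rep Δ} (f : X ⟶ Y) (g : X' ⟶ Y') : tensor X X' ⟶ tensor Y Y' where
  mat := f.mat ⊗ₖ g.mat
  comm := by
    have hf := (intertwine_iff _).1 f.comm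
    have hg := (intertwine_iff _).1 g.comm
    refine (intertwine_iff (X := tensor X X') (Y := tensor Y Y') _).2 fun i j => ?_
    have := congrArg₂ (· * ·) (hf i.1 j.1) (hg i.2 j.2)
    simp only [Finset.sum_mul_sum, smul_mul_smul_comm, ← Fintype.sum_prod_type'] at this
    exact this

/-- The matrix of the unitary `ℂ^ι → ℂ^κ` that maps the basis vector at `x` to the one at `e x`. -/
def permMat {ι κ : Type} [DecidableEq κ] (e : ι ≃ κ) : Matrix κ ι ℂ :=
  Matrix.of fun y x => if y = e x then 1 else 0

lemma mul_permMat {ι κ l : Type} [Fintype κ] [DecidableEq κ] (e : ι ≃ κ) (M : Matrix l κ ℂ) :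
    M * permMat e = Matrix.of fun i x => M i (e x) := by
  ext i x
  simp [Matrix.mul_apply, permMat]

lemma permMat_mul {ι κ l : Type} [Fintype ι] [DecidableEq ι] [DecidableEq κ] (e : ι ≃ κ) (M : Matrix ι l ℂ) :
    permMat e * M = Matrix.of fun y j => M (e.symm y) j := by
  ext i x
  simp [Matrix.mul_apply, permMat, ← Equiv.symm_apply_eq]

lemma permMat_kronecker {ι κ ι' κ' : Type} [DecidableEq κ] [DecidableEq κ'] (e : ι ≃ κ) (f : ι' ≃ κ') :
    permMat e ⊗ₖ permMat f = permMat (e.prodCongr f) := by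
  ext ⟨i, i'⟩ ⟨j, j'⟩
  simp [permMat, Prod.ext_iff, ← ite_and, and_comm]

lemma permMat_refl {ι : Type} [DecidableEq ι] : permMat (Equiv.refl ι) = 1 := by
  ext i j
  rfl

lemma permMat_mul_permMat {ι κ l : Type} [Fintype ι] [DecidableEq ι] [DecidableEq κ]
    (e : ι ≃ κ) (f : l ≃ ι) : permMat e * permMat f = permMat (f.trans e) := by
  ext i x
  simp [Matrix.mul_apply, permMat]
  rfl

/-- The unitary isomorphism given by a bijection of index sets matching the coefficients. -/
def permIso {X Y : Rep Δ} (e : X.ι ≃ Y.ι) (h : ∀ i j, Y.mat (e i) (e j) = X.mat i j) : X ≅ Y where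
  hom := ⟨permMat e, (intertwine_iff _).2 fun i j => by
    obtain ⟨i, rfl⟩ := e.surjective i
    simp [permMat, h]⟩
  inv := ⟨permMat e.symm, (intertwine_iff _).2 fun i j => by
    obtain ⟨j, rfl⟩ := e.surjective j
    simp [permMat, h, Equiv.eq_symm_apply]⟩
  hom_inv_id := by
    ext i j
    simp [mul_permMat]
    simp [permMat, Matrix.one_apply]
  inv_hom_id := by
    ext i j
    simp [mul_permMat]
    simp [permMat, Matrix.one_apply]

@[simp] lemma permIso_hom_mat {X Y : Rep Δ} (e : X.ι ≃ Y.ι)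
    (h : ∀ i j, Y.mat (e i) (e j) = X.mat i j) : (permIso e h).hom.mat = permMat e := rfl

@[simp] lemma tensorHom_mat {X Y X' Y' : Rep Δ} (f : X ⟶ Y) (g : X' ⟶ Y') :
    (tensorHom f g).mat = f.mat ⊗ₖ g.mat := rfl

/-- Tensor products, with the canonical associators and unitors of tensor products of the
spaces `ℂ^ι`. -/
instance : MonoidalCategoryStruct (Rep Δ) where
  tensorObj := tensor
  tensorHom := tensorHom
  whiskerLeft X _ _ f := tensorHom (𝟙 X) f
  whiskerRight f Y := tensorHom f (𝟙 Y)
  tensorUnit := unit Δ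
  associator X Y Z := permIso (X := tensor (tensor X Y) Z) (Y := tensor X (tensor Y Z))
    (Equiv.prodAssoc _ _ _) fun _ _ => (mul_assoc _ _ _).symm
  leftUnitor X := permIso (X := tensor (unit Δ) X) (Equiv.punitProd _) fun _ _ => (one_mul _).symm
  rightUnitor X := permIso (X := tensor X (unit Δ)) (Equiv.prodPUnit _) fun _ _ => (mul_one _).symm

lemma tensorHom_comp {X Y Z X' Y' Z' : Rep Δ} (f : X ⟶ Y) (g : Y ⟶ Z) (f' : X' ⟶ Y')
    (g' : Y' ⟶ Z') : tensorHom (f ≫ g) (f' ≫ g') = tensorHom f f' ≫ tensorHom g g' :=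
  hom_ext (Matrix.mul_kronecker_mul _ _ _ _)

lemma tensorHom_id (X Y : Rep Δ) : tensorHom (𝟙 X) (𝟙 Y) = 𝟙 (tensor X Y) :=
  hom_ext Matrix.one_kronecker_one

instance : MonoidalCategory (Rep Δ) where
  tensorHom_def f g := by
    change tensorHom f g = tensorHom f (𝟙 _) ≫ tensorHom (𝟙 _) g
    rw [← tensorHom_comp, Category.comp_id, Category.id_comp]
  id_tensorHom_id := tensorHom_id
  tensorHom_comp_tensorHom f g h k := (tensorHom_comp _ _ _ _).symm
  whiskerLeft_id := tensorHom_id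
  id_whiskerRight := tensorHom_id
  associator_naturality {X₁ X₂ X₃ Y₁ Y₂ Y₃} f g h := by
    apply hom_ext
    change permMat (Equiv.prodAssoc Y₁.ι Y₂.ι Y₃.ι) * ((f.mat ⊗ₖ g.mat) ⊗ₖ h.mat) =
      (f.mat ⊗ₖ (g.mat ⊗ₖ h.mat)) * permMat (Equiv.prodAssoc X₁.ι X₂.ι X₃.ι)
    rw [mul_permMat, permMat_mul]
    ext ⟨a, b, c⟩ ⟨⟨a', b'⟩, c'⟩
    simp [mul_assoc]
  leftUnitor_naturality {X Y} f := by
    apply hom_ext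
    change permMat (Equiv.punitProd Y.ι) * ((1 : Matrix Unit Unit ℂ) ⊗ₖ f.mat) =
      f.mat * permMat (Equiv.punitProd X.ι)
    rw [mul_permMat, permMat_mul]
    ext a ⟨_, b⟩
    simp
  rightUnitor_naturality {X Y} f := by
    apply hom_ext
    change permMat (Equiv.prodPUnit Y.ι) * (f.mat ⊗ₖ (1 : Matrix Unit Unit ℂ)) =
      f.mat * permMat (Equiv.prodPUnit X.ι)
    rw [mul_permMat, permMat_mul]
    ext a ⟨b, _⟩
    simp
  pentagon W X Y Z := by
    apply hom_ext
    change ((1 : Matrix W.ι W.ι ℂ) ⊗ₖ permMat (Equiv.prodAssoc X.ι Y.ι Z.ι) *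
        permMat (Equiv.prodAssoc W.ι (X.ι × Y.ι) Z.ι)) *
        (permMat (Equiv.prodAssoc W.ι X.ι Y.ι) ⊗ₖ (1 : Matrix Z.ι Z.ι ℂ)) =
      permMat (Equiv.prodAssoc W.ι X.ι (Y.ι × Z.ι)) *
        permMat (Equiv.prodAssoc (W.ι × X.ι) Y.ι Z.ι)
    rw [← permMat_refl, ← permMat_refl, permMat_kronecker, permMat_kronecker, permMat_mul_permMat,
      permMat_mul_permMat, permMat_mul_permMat]
    rfl
  triangle X Y := by
    apply hom_ext
    change ((1 : Matrix X.ι X.ι ℂ) ⊗ₖ permMat (Equiv.punitProd Y.ι)) *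
        permMat (Equiv.prodAssoc X.ι Unit Y.ι) =
      permMat (Equiv.prodPUnit X.ι) ⊗ₖ (1 : Matrix Y.ι Y.ι ℂ)
    rw [mul_permMat]
    ext ⟨a, b⟩ ⟨⟨c, u⟩, d⟩
    simp [permMat, Matrix.one_apply]

end Rep

/-- Two quantum groups are monoidally equivalent if their representation categories are unitarily
monoidally equivalent: there is a monoidal functor that is an equivalence of categories, is linear
and *-preserving on intertwiners, and whose structure isomorphisms
`ε : 1 ⟶ F 1` and `μ : F X ⊗ F Y ⟶ F (X ⊗ Y)` are unitary (their inverses `η` and `δ` are their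
adjoints). -/
def MonoidallyEquivalent {A A' : Type} [CStarAlgebra A] [CStarAlgebra A']
    (Δ : A →⋆ₐ[ℂ] MinTensor A A) (Δ' : A' →⋆ₐ[ℂ] MinTensor A' A') : Prop :=
  ∃ (Φ : Rep Δ ⥤ Rep Δ') (_ : Φ.Monoidal),
    Φ.IsEquivalence ∧ Φ.Additive ∧ Φ.Linear ℂ ∧
    (∀ (X Y : Rep Δ) (f : X ⟶ Y), Φ.map (Rep.adj f) = Rep.adj (Φ.map f)) ∧
    Rep.adj (Functor.LaxMonoidal.ε Φ) = Functor.OplaxMonoidal.η Φ ∧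
    ∀ X Y : Rep Δ, Rep.adj (Functor.LaxMonoidal.μ Φ X Y) = Functor.OplaxMonoidal.δ Φ X Y

end Rep

section Presentation
variable {F : Type} [Fintype F] [DecidableEq F]

/-- `i → j`: there is `k` with `(i, j, k) ∈ T`; then `i` is a predecessor of `j` and `j` is a
successor of `i`. -/
def Arrow (T : Finset (F × F × F)) (i j : F) : Prop := ∃ k, (i, j, k) ∈ T

/-- `T` is a triangle presentation of order `q` over the finite set `F`. -/
structure IsTrianglePresentation (T : Finset (F × F × F)) (q : ℕ) : Prop where
  two_le : 2 ≤ q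
  cyclic : ∀ i j k, (i, j, k) ∈ T → (k, i, j) ∈ T
  unique : ∀ i j k l, (i, j, k) ∈ T → (i, j, l) ∈ T → k = l
  common_predecessor : ∀ i j, i ≠ j → ∃! k, Arrow T k i ∧ Arrow T k j
  common_successor : ∀ i j, i ≠ j → ∃! k, Arrow T i k ∧ Arrow T j k
  card_predecessors : ∀ i, {k | Arrow T k i}.ncard = q + 1
  card_successors : ∀ i, {k | Arrow T i k}.ncard = q + 1

/-- A partition of the `3n` points `0 < 1 < ... < 3n - 1` in noncrossing blocks of size `3`
(the number of blocks is then `n`). -/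
structure NC3 (n : ℕ) where
  /-- the underlying partition -/
  part : Finpartition (Finset.univ : Finset (Fin (3 * n)))
  card_eq_three : ∀ b ∈ part.parts, b.card = 3
  noncrossing : ∀ i j k l : Fin (3 * n), i < j → j < k → k < l →
    ∀ b ∈ part.parts, i ∈ b → k ∈ b → ∀ c ∈ part.parts, j ∈ c → l ∉ c

/-- `T`-labelings of `p`: for every block `{i < j < k}` of `p`, the labels form a triple in `T`. -/
def IsLabeling (T : Finset (F × F × F)) {n : ℕ} (p : NC3 n) (I : Fin (3 * n) → F) : Prop :=
  ∀ b ∈ p.part.parts, ∀ i ∈ b, ∀ j ∈ b, ∀ k ∈ b, i < j → j < k → (I i, I j, I k) ∈ T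

open Classical in
/-- The vector `[p]_T` of `(ℂ^F)^{⊗ 3n}`, a Hilbert space with orthonormal basis
`e_I = e_{I 0} ⊗ ... ⊗ e_{I (3n-1)}` indexed by `I ∈ F^{3n}`: the coefficient of `[p]_T` at `e_I` is
the number, `0` or `1`, of `T`-labelings of `p` whose labels are given by `I`. -/
def partitionVector (T : Finset (F × F × F)) {n : ℕ} (p : NC3 n) :
    EuclideanSpace ℂ (Fin (3 * n) → F) :=
  WithLp.toLp 2 fun I => if IsLabeling T p I then 1 else 0

end Presentation

end TriangleQG

end

noncomputable section
namespace TriangleQG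
open scoped TensorProduct ENNReal ComplexOrder Kronecker
open CategoryTheory MonoidalCategory
set_option linter.unusedSectionVars false

section
-- Adjoints and tensor products of intertwiners.
section Adjoint
variable {A : Type} [CStarAlgebra A] {Δ : A →⋆ₐ[ℂ] MinTensor A A}

namespace Rep

/-! A compact quantum group is governed by the intertwiners between tensor powers of its fundamental
representation u. For 𝔾_T these are the linear combinations of planar diagrams built from the vertex
`vertexHom` and its adjoint. So the linear relations between diagrams have to be the same for T and
T', and the representation category has to be reconstructed from the diagrams.

Relations. A diagram vanishes iff the closed diagram `Diagram.square` has value 0. Indeed, nested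
vertices join its source to a dual word. Since x, y determine z in a triple (x, y, z) of T, the
slices of the resulting vector include every basis vector, and the value is a sum of squared moduli
(`Diagram.hom_eq_zero_iff_value`). The value of a closed diagram is the vacuum expectation of a
combination of words in operators that insert or contract a vertex at a given position of a word
over F (`Diagram.value_eq`). The rules that move annihilations to the left of creations do not
involve T (`exists_normal_order`), and a normally ordered word has expectation 0 or an inner product
of two partition vectors. Hence T and T' satisfy the same relations (`Diagram.hom_eq_iff`).

Fullness. That every intertwiner between tensor words is a diagram (`mat_mem_diagramSpace`) is
proved by constructing the Haar state h by hand. The orthogonality relations predict that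
h(u^d_{xy}^* u^b_{ij}) is a matrix entry of the Hilbert-Schmidt projection onto the diagrams from d
to b. This kernel is positive (`coeffKernel_nonneg`). On its Hilbert space, left multiplication by
the generators is unitary and satisfies the triangle relations, so the universal property gives
`regularRep`, and the vector state of the vacuum is the invariant state `haar`. Averaging with it
shows that every representation is cut out of a direct sum of tensor words
(`exists_word_resolution`).

Reconstruction. Sending the intertwiner of a diagram for T to that of the same diagram for T' is a
well-defined bijection `WordTransfer` respecting composition, adjoints and tensor products. A
representation X with maps s_p from tensor words and ∑ s_p s_p^* = 1 is encoded by the projection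
with entries s_r^* s_p. The bijection carries it to a projection over T', which splits
(`Rep.exists_splitting`). Morphisms and structure maps are determined by their effect on maps out of
tensor words (`Model.hat`), so functoriality, coherence and unitarity reduce to tensor words. -/

@[simp] lemma adj_adj {X Y : Rep Δ} (f : X ⟶ Y) : adj (adj f) = f :=
  hom_ext (Matrix.conjTranspose_conjTranspose _)

@[simp] lemma adj_id (X : Rep Δ) : adj (𝟙 X) = 𝟙 X :=
  hom_ext Matrix.conjTranspose_one

@[simp] lemma adj_comp {X Y Z : Rep Δ} (f : X ⟶ Y) (g : Y ⟶ Z) : adj (f ≫ g) = adj g ≫ adj f :=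
  hom_ext (Matrix.conjTranspose_mul _ _)

@[simp] lemma adj_add {X Y : Rep Δ} (f g : X ⟶ Y) : adj (f + g) = adj f + adj g :=
  hom_ext (Matrix.conjTranspose_add _ _)

@[simp] lemma adj_zero (X Y : Rep Δ) : adj (0 : X ⟶ Y) = 0 :=
  hom_ext Matrix.conjTranspose_zero

@[simp] lemma adj_smul {X Y : Rep Δ} (c : ℂ) (f : X ⟶ Y) : adj (c • f) = star c • adj f :=
  hom_ext (Matrix.conjTranspose_smul _ _)

lemma adj_sum {X Y : Rep Δ} {κ : Type*} (s : Finset κ) (f : κ → (X ⟶ Y)) :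
    adj (∑ i ∈ s, f i) = ∑ i ∈ s, adj (f i) :=
  map_sum (AddMonoidHom.mk' (adj : (X ⟶ Y) → (Y ⟶ X)) adj_add) f s

@[simp] lemma adj_tensor {X Y X' Y' : Rep Δ} (f : X ⟶ Y) (g : X' ⟶ Y') :
    adj (f ⊗ₘ g) = adj f ⊗ₘ adj g :=
  hom_ext (Matrix.conjTranspose_kronecker _ _)

lemma conjTranspose_permMat {ι κ : Type} [DecidableEq ι] [DecidableEq κ] (e : ι ≃ κ) :
    (permMat e).conjTranspose = permMat e.symm := by
  ext x y
  simp only [permMat, Matrix.conjTranspose_apply, Matrix.of_apply, Equiv.eq_symm_apply]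
  split_ifs with h1 h2 h2 <;> simp_all

lemma adj_permIso_hom {X Y : Rep Δ} (e : X.ι ≃ Y.ι) (h : ∀ i j, Y.mat (e i) (e j) = X.mat i j) :
    adj (permIso e h).hom = (permIso e h).inv :=
  hom_ext (conjTranspose_permMat e)

@[simp] lemma adj_associator_hom (X Y Z : Rep Δ) : adj (α_ X Y Z).hom = (α_ X Y Z).inv :=
  adj_permIso_hom _ _

@[simp] lemma adj_associator_inv (X Y Z : Rep Δ) : adj (α_ X Y Z).inv = (α_ X Y Z).hom := by
  rw [← adj_associator_hom, adj_adj]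

@[simp] lemma adj_leftUnitor_hom (X : Rep Δ) : adj (λ_ X).hom = (λ_ X).inv :=
  adj_permIso_hom _ _

@[simp] lemma adj_leftUnitor_inv (X : Rep Δ) : adj (λ_ X).inv = (λ_ X).hom := by
  rw [← adj_leftUnitor_hom, adj_adj]

@[simp] lemma adj_rightUnitor_hom (X : Rep Δ) : adj (ρ_ X).hom = (ρ_ X).inv :=
  adj_permIso_hom _ _

@[simp] lemma adj_rightUnitor_inv (X : Rep Δ) : adj (ρ_ X).inv = (ρ_ X).hom := by
  rw [← adj_rightUnitor_hom, adj_adj]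

lemma add_tensor {X Y X' Y' : Rep Δ} (f f' : X ⟶ Y) (g : X' ⟶ Y') :
    (f + f') ⊗ₘ g = f ⊗ₘ g + f' ⊗ₘ g := hom_ext (Matrix.add_kronecker _ _ _)

lemma tensor_add {X Y X' Y' : Rep Δ} (f : X ⟶ Y) (g g' : X' ⟶ Y') :
    f ⊗ₘ (g + g') = f ⊗ₘ g + f ⊗ₘ g' := hom_ext (Matrix.kronecker_add _ _ _)

lemma sum_tensor {X Y X' Y' : Rep Δ} {κ : Type*} (s : Finset κ) (f : κ → (X ⟶ Y)) (g : X' ⟶ Y') :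
    (∑ i ∈ s, f i) ⊗ₘ g = ∑ i ∈ s, f i ⊗ₘ g :=
  map_sum (AddMonoidHom.mk' (fun f : X ⟶ Y => f ⊗ₘ g) fun f f' => add_tensor f f' g) f s

lemma tensor_sum {X Y X' Y' : Rep Δ} {κ : Type*} (s : Finset κ) (f : X ⟶ Y) (g : κ → (X' ⟶ Y')) :
    f ⊗ₘ (∑ i ∈ s, g i) = ∑ i ∈ s, f ⊗ₘ g i :=
  map_sum (AddMonoidHom.mk' (fun g : X' ⟶ Y' => f ⊗ₘ g) fun g g' => tensor_add f g g') g s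

end Rep
end Adjoint

/-! ### Tensor words, formal planar diagrams and their intertwiners. -/

/-- Bracketed tensor words in the fundamental representation. -/
inductive Word : Type
  | unit : Word
  | gen : Word
  | tensor (a b : Word) : Word

/-- Formal linear combinations of planar diagrams, built from the trivalent vertex and its adjoint. -/
inductive Diagram : Word → Word → Type
  | id (a : Word) : Diagram a a
  | comp {a b c : Word} (f : Diagram a b) (g : Diagram b c) : Diagram a c
  | tensor {a b c d : Word} (f : Diagram a b) (g : Diagram c d) :
      Diagram (a.tensor c) (b.tensor d)
  | assoc (a b c : Word) : Diagram ((a.tensor b).tensor c) (a.tensor (b.tensor c))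
  | assocInv (a b c : Word) : Diagram (a.tensor (b.tensor c)) ((a.tensor b).tensor c)
  | leftUnitor (a : Word) : Diagram (Word.unit.tensor a) a
  | leftUnitorInv (a : Word) : Diagram a (Word.unit.tensor a)
  | rightUnitor (a : Word) : Diagram (a.tensor Word.unit) a
  | rightUnitorInv (a : Word) : Diagram a (a.tensor Word.unit)
  | vertex : Diagram Word.unit (Word.gen.tensor (Word.gen.tensor Word.gen))
  | covertex : Diagram (Word.gen.tensor (Word.gen.tensor Word.gen)) Word.unit
  | zero (a b : Word) : Diagram a b
  | add {a b : Word} (f g : Diagram a b) : Diagram a b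
  | smul {a b : Word} (c : ℂ) (f : Diagram a b) : Diagram a b

/-- The reflected diagram. -/
def Diagram.dag {a b : Word} : Diagram a b → Diagram b a
  | id a => id a
  | comp f g => comp g.dag f.dag
  | tensor f g => tensor f.dag g.dag
  | assoc a b c => assocInv a b c
  | assocInv a b c => assoc a b c
  | leftUnitor a => leftUnitorInv a
  | leftUnitorInv a => leftUnitor a
  | rightUnitor a => rightUnitorInv a
  | rightUnitorInv a => rightUnitor a
  | vertex => covertex
  | covertex => vertex
  | zero a b => zero b a
  | add f g => add f.dag g.dag
  | smul c f => smul (star c) f.dag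

variable {F : Type} [Fintype F] [DecidableEq F]

/-- The fundamental representation of `𝔾_T`. -/
def fundRep (T : Finset (F × F × F)) : Rep (comul T) where
  ι := F
  mat := fundMatrix T
  unitary := (fundMatrix_isTriangleUnitary T).unitary
  comul := comul_fundMatrix T

/-- The invariant vector `∑ e_a ⊗ e_b ⊗ e_c`, over all `(a, b, c) ∈ T`. -/
def vertexHom (T : Finset (F × F × F)) :
    𝟙_ (Rep (comul T)) ⟶ fundRep T ⊗ (fundRep T ⊗ fundRep T) where
  mat := fun (x : F × F × F) _ => if x ∈ T then 1 else 0
  comm := (Rep.intertwine_iff (X := Rep.unit (comul T))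
      (Y := Rep.tensor (fundRep T) (Rep.tensor (fundRep T) (fundRep T))) _).2 <| by
    rintro ⟨(i : F), (j : F), (k : F)⟩ ⟨⟩
    have h := (fundMatrix_isTriangleUnitary T).rel i j k
    have h2 : ∀ x : F × F × F, (if x ∈ T then (1 : ℂ) else 0) •
        (fundMatrix T i x.1 * (fundMatrix T j x.2.1 * fundMatrix T k x.2.2)) =
        if x ∈ T then fundMatrix T i x.1 * fundMatrix T j x.2.1 * fundMatrix T k x.2.2 else 0 := by
      intro x
      split_ifs <;> simp [mul_assoc]
    calc _ = ∑ x : F × F × F, (if x ∈ T then (1 : ℂ) else 0) •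
        (fundMatrix T i x.1 * (fundMatrix T j x.2.1 * fundMatrix T k x.2.2)) := rfl
      _ = if (i, j, k) ∈ T then 1 else 0 := by
        rw [Finset.sum_congr rfl fun x _ => h2 x, Finset.sum_ite_mem, Finset.univ_inter, h]
      _ = ∑ x : Unit, (if (i, j, k) ∈ T then (1 : ℂ) else 0) • (1 : Matrix Unit Unit (CGT T)) x () := by
        by_cases h : (i, j, k) ∈ T <;> simp [h]

/-- The representation given by a tensor word. -/
def wordRep (T : Finset (F × F × F)) : Word → Rep (comul T)
  | .unit => 𝟙_ _
  | .gen => fundRep T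
  | .tensor a b => wordRep T a ⊗ wordRep T b

/-- The intertwiner given by a diagram. -/
def Diagram.hom (T : Finset (F × F × F)) {a b : Word} :
    Diagram a b → (wordRep T a ⟶ wordRep T b)
  | id a => 𝟙 (wordRep T a)
  | comp f g => f.hom T ≫ g.hom T
  | @tensor a b c d f g => show wordRep T a ⊗ wordRep T c ⟶ wordRep T b ⊗ wordRep T d from
      f.hom T ⊗ₘ g.hom T
  | assoc a b c => (α_ (wordRep T a) (wordRep T b) (wordRep T c)).hom
  | assocInv a b c => (α_ (wordRep T a) (wordRep T b) (wordRep T c)).inv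
  | leftUnitor a => (λ_ (wordRep T a)).hom
  | leftUnitorInv a => (λ_ (wordRep T a)).inv
  | rightUnitor a => (ρ_ (wordRep T a)).hom
  | rightUnitorInv a => (ρ_ (wordRep T a)).inv
  | vertex => vertexHom T
  | covertex => Rep.adj (vertexHom T)
  | zero a b => (0 : wordRep T a ⟶ wordRep T b)
  | add f g => f.hom T + g.hom T
  | smul c f => c • f.hom T

lemma Diagram.hom_dag (T : Finset (F × F × F)) {a b : Word} (d : Diagram a b) :
    d.dag.hom T = Rep.adj (d.hom T) := by
  induction d with
  | id a => exact (Rep.adj_id _).symm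
  | comp f g hf hg => exact (congrArg₂ _ hg hf).trans (Rep.adj_comp _ _).symm
  | tensor f g hf hg => exact (congrArg₂ _ hf hg).trans (Rep.adj_tensor _ _).symm
  | assoc a b c => exact (Rep.adj_associator_hom _ _ _).symm
  | assocInv a b c => exact (Rep.adj_associator_inv _ _ _).symm
  | leftUnitor a => exact (Rep.adj_leftUnitor_hom _).symm
  | leftUnitorInv a => exact (Rep.adj_leftUnitor_inv _).symm
  | rightUnitor a => exact (Rep.adj_rightUnitor_hom _).symm
  | rightUnitorInv a => exact (Rep.adj_rightUnitor_inv _).symm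
  | vertex => rfl
  | covertex => exact (Rep.adj_adj _).symm
  | zero a b => exact (Rep.adj_zero _ _).symm
  | add f g hf hg => exact (congrArg₂ _ hf hg).trans (Rep.adj_add _ _).symm
  | smul c f hf => exact (congrArg _ hf).trans (Rep.adj_smul _ _).symm

/-- The matrices of the diagrams from `a` to `b`. -/
def diagramSpace (T : Finset (F × F × F)) (a b : Word) :
    Submodule ℂ (Matrix (wordRep T b).ι (wordRep T a).ι ℂ) where
  carrier := Set.range fun d : Diagram a b => (d.hom T).mat
  zero_mem' := ⟨.zero a b, rfl⟩
  add_mem' := by rintro _ _ ⟨d, rfl⟩ ⟨e, rfl⟩; exact ⟨.add d e, rfl⟩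
  smul_mem' := by rintro c _ ⟨d, rfl⟩; exact ⟨.smul c d, rfl⟩

variable {T : Finset (F × F × F)}

lemma one_mem_diagramSpace (a : Word) : 1 ∈ diagramSpace T a a := ⟨.id a, rfl⟩

lemma mul_mem_diagramSpace {a b c : Word} {R : Matrix (wordRep T c).ι (wordRep T b).ι ℂ}
    {S : Matrix (wordRep T b).ι (wordRep T a).ι ℂ} (hR : R ∈ diagramSpace T b c)
    (hS : S ∈ diagramSpace T a b) : R * S ∈ diagramSpace T a c := by
  obtain ⟨d, rfl⟩ := hR
  obtain ⟨e, rfl⟩ := hS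
  exact ⟨.comp e d, rfl⟩

lemma conjTranspose_mem_diagramSpace {a b : Word} {R : Matrix (wordRep T b).ι (wordRep T a).ι ℂ}
    (hR : R ∈ diagramSpace T a b) : R.conjTranspose ∈ diagramSpace T b a := by
  obtain ⟨d, rfl⟩ := hR
  exact ⟨d.dag, congrArg Rep.Hom.mat (d.hom_dag T)⟩

lemma kronecker_mem_diagramSpace {a b c d : Word} {R : Matrix (wordRep T b).ι (wordRep T a).ι ℂ}
    {S : Matrix (wordRep T d).ι (wordRep T c).ι ℂ} (hR : R ∈ diagramSpace T a b)
    (hS : S ∈ diagramSpace T c d) : (R ⊗ₖ S : Matrix ((wordRep T b).ι × (wordRep T d).ι)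
      ((wordRep T a).ι × (wordRep T c).ι) ℂ) ∈ diagramSpace T (a.tensor c) (b.tensor d) := by
  obtain ⟨x, rfl⟩ := hR
  obtain ⟨y, rfl⟩ := hS
  exact ⟨.tensor x y, rfl⟩

end

section
-- Creation and annihilation operators on the Fock space, and normal ordering.
section ListOperators

variable {F : Type} [Fintype F] [DecidableEq F]

/-- Functions on words in `F`: the coefficients of vectors in the full Fock space over `ℂ^F`. -/
abbrev FockFun (F : Type) : Type := List F → ℂ

/-- The functions `s ↦ φ (x :: s)`. -/
def consPullback (x : F) : FockFun F →ₗ[ℂ] FockFun F where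
  toFun φ s := φ (x :: s)
  map_add' _ _ := rfl
  map_smul' _ _ := rfl

/-- Insertion of the vector `∑ e_a ⊗ e_b ⊗ e_c`, over all `(a, b, c) ∈ T`, at position `n`. -/
def creation (T : Finset (F × F × F)) : ℕ → FockFun F → FockFun F
  | 0, φ, x :: y :: z :: r => if (x, y, z) ∈ T then φ r else 0
  | 0, _, [_, _] => 0
  | 0, _, [_] => 0
  | 0, _, [] => 0
  | n + 1, φ, x :: r => creation T n (consPullback x φ) r
  | _ + 1, _, [] => 0

/-- Contraction with the vector `∑ e_a ⊗ e_b ⊗ e_c`, over all `(a, b, c) ∈ T`, at position `n`. -/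
def annihilation (T : Finset (F × F × F)) : ℕ → FockFun F → FockFun F
  | 0, φ, r => ∑ t ∈ T, φ (t.1 :: t.2.1 :: t.2.2 :: r)
  | n + 1, φ, x :: r => annihilation T n (consPullback x φ) r
  | _ + 1, _, [] => 0

variable (T : Finset (F × F × F))

@[simp] lemma creation_zero_cons (φ : FockFun F) (x y z : F) (r : List F) :
    creation T 0 φ (x :: y :: z :: r) = if (x, y, z) ∈ T then φ r else 0 := by rw [creation]

@[simp] lemma creation_succ_cons (n : ℕ) (φ : FockFun F) (x : F) (r : List F) :
    creation T (n + 1) φ (x :: r) = creation T n (consPullback x φ) r := by rw [creation]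

@[simp] lemma creation_succ_nil (n : ℕ) (φ : FockFun F) : creation T (n + 1) φ [] = 0 := by
  rw [creation]

@[simp] lemma annihilation_zero (φ : FockFun F) (r : List F) :
    annihilation T 0 φ r = ∑ t ∈ T, φ (t.1 :: t.2.1 :: t.2.2 :: r) := by rw [annihilation]

@[simp] lemma annihilation_succ_cons (n : ℕ) (φ : FockFun F) (x : F) (r : List F) :
    annihilation T (n + 1) φ (x :: r) = annihilation T n (consPullback x φ) r := by
  rw [annihilation]

@[simp] lemma annihilation_succ_nil (n : ℕ) (φ : FockFun F) :
    annihilation T (n + 1) φ [] = 0 := by rw [annihilation]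

lemma creation_eq_zero (n : ℕ) (φ : FockFun F) (r : List F) (h : r.length < n + 3) :
    creation T n φ r = 0 := by
  induction n generalizing φ r with
  | zero =>
    rcases r with _ | ⟨x, _ | ⟨y, _ | ⟨z, r⟩⟩⟩
    · simp [creation]
    · simp [creation]
    · simp [creation]
    · simp at h
      omega
  | succ n ih =>
    rcases r with _ | ⟨x, r⟩
    · simp
    · simp only [creation_succ_cons]
      exact ih _ _ (by simp at h; omega)

lemma creation_add (n : ℕ) (φ ψ : FockFun F) :
    creation T n (φ + ψ) = creation T n φ + creation T n ψ := by
  funext r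
  induction n generalizing φ ψ r with
  | zero =>
    rcases r with _ | ⟨x, _ | ⟨y, _ | ⟨z, r⟩⟩⟩ <;> simp [creation]
    split_ifs <;> simp
  | succ n ih =>
    rcases r with _ | ⟨x, r⟩
    · simp
    · simp [ih]

lemma creation_smul (n : ℕ) (c : ℂ) (φ : FockFun F) :
    creation T n (c • φ) = c • creation T n φ := by
  funext r
  induction n generalizing φ r with
  | zero => rcases r with _ | ⟨x, _ | ⟨y, _ | ⟨z, r⟩⟩⟩ <;> simp [creation]
  | succ n ih =>
    rcases r with _ | ⟨x, r⟩
    · simp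
    · simp [ih]

lemma annihilation_add (n : ℕ) (φ ψ : FockFun F) :
    annihilation T n (φ + ψ) = annihilation T n φ + annihilation T n ψ := by
  funext r
  induction n generalizing φ ψ r with
  | zero => simp [Finset.sum_add_distrib]
  | succ n ih =>
    rcases r with _ | ⟨x, r⟩
    · simp
    · simp [ih]

lemma annihilation_smul (n : ℕ) (c : ℂ) (φ : FockFun F) :
    annihilation T n (c • φ) = c • annihilation T n φ := by
  funext r
  induction n generalizing φ r with
  | zero => simp [Finset.mul_sum]
  | succ n ih =>
    rcases r with _ | ⟨x, r⟩
    · simp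
    · simp [ih]

/-- `creation` as a linear operator. -/
def creationOp (n : ℕ) : Module.End ℂ (FockFun F) where
  toFun := creation T n
  map_add' := creation_add T n
  map_smul' := creation_smul T n

/-- `annihilation` as a linear operator. -/
def annihilationOp (n : ℕ) : Module.End ℂ (FockFun F) where
  toFun := annihilation T n
  map_add' := annihilation_add T n
  map_smul' := annihilation_smul T n

@[simp] lemma creationOp_apply (n : ℕ) (φ : FockFun F) : creationOp T n φ = creation T n φ := rfl

@[simp] lemma annihilationOp_apply (n : ℕ) (φ : FockFun F) :
    annihilationOp T n φ = annihilation T n φ := rfl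

/-- The contraction is performed before the insertion, so the two never touch the same letters.
Doing the insertion first pushes the contracted position back by three. -/
lemma creation_annihilation_of_le {i j : ℕ} (h : i ≤ j) (φ : FockFun F) :
    creation T i (annihilation T j φ) = annihilation T (j + 3) (creation T i φ) := by
  funext r
  induction i generalizing j φ r with
  | zero =>
    rcases r with _ | ⟨x, _ | ⟨y, _ | ⟨z, r⟩⟩⟩
    · simp [creation]
    · simp [creation]
    · simp [creation]
    · simp only [creation_zero_cons, annihilation_succ_cons]
      split_ifs with hT
      · congr 1
        funext s
        simp [consPullback, hT]
      · have : consPullback z (consPullback y (consPullback x (creation T 0 φ))) = (0 : ℂ) • φ := by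
          funext s
          simp [consPullback, hT]
        rw [this, annihilation_smul]
        simp
  | succ i ih =>
    obtain ⟨j, rfl⟩ := Nat.exists_eq_succ_of_ne_zero (show j ≠ 0 by omega)
    rcases r with _ | ⟨x, r⟩
    · simp [Nat.succ_eq_add_one]
    · have := ih (j := j) (by omega) (consPullback x φ) r
      simp only [Nat.succ_eq_add_one, creation_succ_cons,
        show j + 1 + 3 = (j + 3) + 1 by omega, annihilation_succ_cons]
      exact this

/-- Here the contracted letters lie in front of the insertion. While they are still present, the
insertion point is three places further on. -/
lemma creation_annihilation_of_lt {i j : ℕ} (h : j < i) (φ : FockFun F) :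
    creation T i (annihilation T j φ) = annihilation T j (creation T (i + 3) φ) := by
  funext r
  induction j generalizing i φ r with
  | zero =>
    obtain ⟨i, rfl⟩ := Nat.exists_eq_succ_of_ne_zero (show i ≠ 0 by omega)
    -- A contraction at the front is a sum of triple pullbacks, and each pullback lowers the
    -- insertion position by one.
    have key : annihilation T 0 φ =
        ∑ t ∈ T, consPullback t.2.2 (consPullback t.2.1 (consPullback t.1 φ)) := by
      funext s
      simp [consPullback]
    rw [key, ← creationOp_apply, map_sum]
    simp only [Finset.sum_apply, annihilation_zero, creationOp_apply]
    refine Finset.sum_congr rfl fun t _ => ?_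
    rw [show i.succ + 3 = (((i + 1) + 1) + 1) + 1 by omega, creation_succ_cons, creation_succ_cons,
      creation_succ_cons]
  | succ j ih =>
    obtain ⟨i, rfl⟩ := Nat.exists_eq_succ_of_ne_zero (show i ≠ 0 by omega)
    rcases r with _ | ⟨x, r⟩
    · simp
    · have := ih (i := i) (by omega) (consPullback x φ) r
      simp only [Nat.succ_eq_add_one, creation_succ_cons,
        show i + 1 + 3 = (i + 3) + 1 by omega, annihilation_succ_cons]
      exact this

/-- The operator given by a word in creation and annihilation operators. -/
def opWord : FreeMonoid (ℕ ⊕ ℕ) →* Module.End ℂ (FockFun F) :=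
  FreeMonoid.lift (Sum.elim (creationOp T) (annihilationOp T))

/-- The composition of the annihilation operators at the listed positions. -/
def annihilations (L : List ℕ) : Module.End ℂ (FockFun F) := (L.map (annihilationOp T)).prod

/-- The composition of the creation operators at the listed positions. -/
def creations (L : List ℕ) : Module.End ℂ (FockFun F) := (L.map (creationOp T)).prod

/-- The positions are chosen before F and T: the exchange rules depend on positions only. This
uniformity is what later makes T and T' comparable. -/
lemma exists_creation_mul_annihilations (L : List ℕ) (i : ℕ) : ∃ (L' : List ℕ) (i' : ℕ),
    ∀ (F : Type) [Fintype F] [DecidableEq F] (T : Finset (F × F × F)),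
      creationOp T i * annihilations T L = annihilations T L' * creationOp T i' := by
  induction L generalizing i with
  | nil => exact ⟨[], i, fun F _ _ T => by simp [annihilations]⟩
  | cons j L ih =>
    rcases le_or_gt i j with h | h
    · obtain ⟨L', i', h'⟩ := ih i
      refine ⟨(j + 3) :: L', i', fun F _ _ T => ?_⟩
      have := h' F T
      simp only [annihilations, List.map_cons, List.prod_cons] at this ⊢
      rw [← mul_assoc, show creationOp T i * annihilationOp T j =
        annihilationOp T (j + 3) * creationOp T i from
        LinearMap.ext (creation_annihilation_of_le T h), mul_assoc, this, mul_assoc]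
    · obtain ⟨L', i', h'⟩ := ih (i + 3)
      refine ⟨j :: L', i', fun F _ _ T => ?_⟩
      have := h' F T
      simp only [annihilations, List.map_cons, List.prod_cons] at this ⊢
      rw [← mul_assoc, show creationOp T i * annihilationOp T j =
        annihilationOp T j * creationOp T (i + 3) from
        LinearMap.ext (creation_annihilation_of_lt T h), mul_assoc, this, mul_assoc]

/-- Normal ordering: annihilation operators can be moved to the left of creation operators. -/
lemma exists_normal_order (w : FreeMonoid (ℕ ⊕ ℕ)) : ∃ (L L' : List ℕ),
    ∀ (F : Type) [Fintype F] [DecidableEq F] (T : Finset (F × F × F)),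
      opWord T w = annihilations T L * creations T L' := by
  induction w using FreeMonoid.inductionOn' with
  | one => exact ⟨[], [], fun F _ _ T => by simp [annihilations, creations]⟩
  | of_mul x w ih =>
    obtain ⟨L, L', h⟩ := ih
    rcases x with i | j
    · obtain ⟨K, i', h'⟩ := exists_creation_mul_annihilations L i
      refine ⟨K, i' :: L', fun F _ _ T => ?_⟩
      rw [map_mul, h F T, ← mul_assoc,
        show opWord T (FreeMonoid.of (Sum.inl i)) = creationOp T i by simp [opWord], h' F T]
      simp [creations, mul_assoc]
    · refine ⟨j :: L, L', fun F _ _ T => ?_⟩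
      rw [map_mul, h F T,
        show opWord T (FreeMonoid.of (Sum.inr j)) = annihilationOp T j by simp [opWord]]
      simp [annihilations, mul_assoc]

/-- The sum of the values on words of length `m`. -/
def listSum : ℕ → FockFun F → ℂ
  | 0, φ => φ []
  | m + 1, φ => ∑ x, listSum m (fun s => φ (x :: s))

lemma listSum_eq (m : ℕ) (φ : FockFun F) : listSum m φ = ∑ I : Fin m → F, φ (List.ofFn I) := by
  induction m generalizing φ with
  | zero => simp [listSum]
  | succ m ih =>
    rw [listSum, ← (Fin.consEquiv fun _ => F).sum_comp, Fintype.sum_prod_type]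
    refine Finset.sum_congr rfl fun x _ => ?_
    rw [ih]
    simp [Fin.consEquiv, List.ofFn_succ]

/-- Insertion and contraction are transposes of each other for the bilinear pairing ∑ φ ψ. No
conjugation is needed, because the vertex has coefficients 0 and 1. -/
lemma listSum_creation_mul (m n : ℕ) (φ ψ : FockFun F) :
    listSum (m + 3) (creation T n φ * ψ) = listSum m (φ * annihilation T n ψ) := by
  induction n generalizing m φ ψ with
  | zero =>
    simp only [listSum_eq (m := m), listSum, Pi.mul_apply, creation_zero_cons, annihilation_zero,
      Finset.mul_sum]
    rw [Finset.sum_comm (s := Finset.univ) (t := T)]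
    have h1 : ∀ f : F × F × F → ℂ, ∑ t ∈ T, f t =
        ∑ x, ∑ y, ∑ z, if (x, y, z) ∈ T then f (x, y, z) else 0 := by
      intro f
      rw [← Finset.univ_inter T, ← Finset.sum_ite_mem, Fintype.sum_prod_type]
      simp [Fintype.sum_prod_type]
    rw [h1]
    refine Finset.sum_congr rfl fun x _ => Finset.sum_congr rfl fun y _ =>
      Finset.sum_congr rfl fun z _ => ?_
    split_ifs <;> simp
  | succ n ih =>
    rcases m with _ | m
    -- A word of length 3 has no room for an insertion at a positive position, and the contraction
    -- vanishes on the empty word, so both sides are 0.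
    · simp only [listSum, Pi.mul_apply, annihilation_succ_nil, mul_zero]
      refine Finset.sum_eq_zero fun x _ => Finset.sum_eq_zero fun y _ =>
        Finset.sum_eq_zero fun z _ => ?_
      rw [creation_eq_zero T _ _ _ (by simp), zero_mul]
    · rw [show m + 1 + 3 = (m + 3) + 1 by omega, listSum, listSum]
      refine Finset.sum_congr rfl fun x _ => ?_
      exact ih m (consPullback x φ) (consPullback x ψ)

/-- Iterated transposition: the order of the operators is reversed, and each one accounts for three
letters. -/
lemma listSum_mul_annihilations (L : List ℕ) (m : ℕ) (φ ψ : FockFun F) :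
    listSum m (φ * annihilations T L ψ) =
      listSum (m + 3 * L.length) (creations T L.reverse φ * ψ) := by
  induction L generalizing m φ with
  | nil => simp [annihilations, creations]
  | cons i L ih =>
    have h1 : annihilations T (i :: L) ψ = annihilation T i (annihilations T L ψ) := by
      simp [annihilations]
    have h2 : creations T (i :: L).reverse φ = creations T L.reverse (creation T i φ) := by
      simp [creations]
    rw [h1, h2, ← listSum_creation_mul, ih]
    congr 1
    simp only [List.length_cons]
    omega

/-- The vacuum vector. -/
def vacuum (F : Type) : FockFun F
  | [] => 1
  | _ :: _ => 0

/-- The vacuum expectation value of a word is a pairing of two products of creation operators. -/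
lemma annihilations_apply_nil (L : List ℕ) (ψ : FockFun F) : annihilations T L ψ [] =
    ∑ I : Fin (3 * L.length) → F,
      creations T L.reverse (vacuum F) (List.ofFn I) * ψ (List.ofFn I) := by
  have := listSum_mul_annihilations T L 0 (vacuum F) ψ
  rw [zero_add, listSum_eq (m := 3 * L.length)] at this
  simpa [listSum, vacuum] using this

/-- Grading by length: every creation operator raises the length of the words in the support by
exactly 3. -/
lemma creations_vacuum_eq_zero (L : List ℕ) (s : List F) (h : s.length ≠ 3 * L.length) :
    creations T L (vacuum F) s = 0 := by
  induction L generalizing s with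
  | nil =>
    rcases s with _ | ⟨x, s⟩
    · simp at h
    · simp [creations, vacuum]
  | cons i L ih =>
    have h1 : creations T (i :: L) (vacuum F) = creation T i (creations T L (vacuum F)) := by
      simp [creations]
    rw [h1]
    clear h1
    have key : ∀ (i m : ℕ) (φ : FockFun F), (∀ s, s.length ≠ m → φ s = 0) → ∀ s : List F,
        s.length ≠ m + 3 → creation T i φ s = 0 := by
      intro i
      induction i with
      | zero =>
        intro m φ hφ s hs
        rcases s with _ | ⟨x, _ | ⟨y, _ | ⟨z, r⟩⟩⟩ <;> simp [creation]
        intro _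
        exact hφ _ (by simpa using hs)
      | succ i ih =>
        intro m φ hφ s hs
        rcases s with _ | ⟨x, s⟩
        · simp
        · rw [creation_succ_cons]
          rcases m with _ | m
          · have : consPullback x φ = (0 : ℂ) • φ := by
              funext r
              simpa [consPullback] using hφ (x :: r) (by simp)
            rw [this, creation_smul]
            simp
          · refine ih m _ (fun r hr => hφ _ ?_) s ?_
            · simpa using hr
            · simp at hs
              omega
    exact key i _ _ ih s (by simp at h; omega)

end ListOperators

end

section
-- Products of creation operators on the vacuum as partition vectors.
section Insertion

lemma creation_eq_ite {F : Type} [Fintype F] [DecidableEq F] (T : Finset (F × F × F)) (i : ℕ)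
    (φ : FockFun F) (s : List F) (h : i + 2 < s.length) :
    creation T i φ s = if (s[i], s[i + 1], s[i + 2]) ∈ T then φ (s.take i ++ s.drop (i + 3))
      else 0 := by
  induction i generalizing φ s with
  | zero =>
    rcases s with _ | ⟨x, _ | ⟨y, _ | ⟨z, r⟩⟩⟩
    · simp at h
    · simp at h
    · simp at h
    · simp
  | succ i ih =>
    rcases s with _ | ⟨x, s⟩
    · simp at h
    · rw [creation_succ_cons, ih _ _ (by simp at h; omega)]
      simp [consPullback, show i + 1 + 3 = (i + 3) + 1 by omega,
        show i + 1 + 2 = (i + 2) + 1 by omega]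

variable {n : ℕ}

/-- The increasing map that leaves out the three points `i`, `i + 1`, `i + 2`. -/
def skipThree (n i : ℕ) : Fin (3 * n) ↪o Fin (3 * (n + 1)) :=
  OrderEmbedding.ofStrictMono
    (fun j => ⟨if j.1 < i then j.1 else j.1 + 3, by split_ifs <;> omega⟩) fun a b h => by
      simp only [Fin.lt_def] at h ⊢
      split_ifs <;> omega

lemma skipThree_val (n i : ℕ) (j : Fin (3 * n)) :
    (skipThree n i j : ℕ) = if j.1 < i then j.1 else j.1 + 3 := rfl

/-- The block of three consecutive points starting at `i`. -/
def threeBlock (n i : ℕ) : Finset (Fin (3 * (n + 1))) :=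
  Finset.univ.filter fun j => i ≤ j.1 ∧ j.1 < i + 3

lemma mem_threeBlock {n i : ℕ} {j : Fin (3 * (n + 1))} :
    j ∈ threeBlock n i ↔ i ≤ j.1 ∧ j.1 < i + 3 := by simp [threeBlock]

lemma skipThree_notMem (n i : ℕ) (j : Fin (3 * n)) : skipThree n i j ∉ threeBlock n i := by
  rw [mem_threeBlock, skipThree_val]
  split_ifs <;> omega

lemma exists_skipThree {i : ℕ} (hi : i ≤ 3 * n) {j : Fin (3 * (n + 1))} (hj : j ∉ threeBlock n i) :
    ∃ k, skipThree n i k = j := by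
  rw [mem_threeBlock] at hj
  have := j.2
  by_cases h : j.1 < i
  · exact ⟨⟨j.1, by omega⟩, Fin.ext (by simp [skipThree_val, h])⟩
  · refine ⟨⟨j.1 - 3, by omega⟩, Fin.ext ?_⟩
    rw [skipThree_val]
    simp only
    split_ifs <;> omega

open Classical in
/-- The blocks of the partition with a block of three consecutive points inserted. -/
def insertParts (p : NC3 n) (i : ℕ) : Finset (Finset (Fin (3 * (n + 1)))) :=
  insert (threeBlock n i) (p.part.parts.image fun b => b.map (skipThree n i).toEmbedding)

lemma mem_insertParts {i : ℕ} {p : NC3 n} {b : Finset (Fin (3 * (n + 1)))} : b ∈ insertParts p i ↔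
    b = threeBlock n i ∨ ∃ c ∈ p.part.parts, c.map (skipThree n i).toEmbedding = b := by
  simp [insertParts]

/-- The partition with a block of three consecutive points inserted. -/
def NC3.insert (p : NC3 n) (i : ℕ) (hi : i ≤ 3 * n) : NC3 (n + 1) where
  part := Finpartition.ofExistsUnique (insertParts p i) (fun _ _ => Finset.subset_univ _)
    (by
      intro j _
      by_cases hj : j ∈ threeBlock n i
      · refine ⟨threeBlock n i, ⟨mem_insertParts.2 (Or.inl rfl), hj⟩, ?_⟩
        rintro b ⟨hb, hjb⟩
        rcases mem_insertParts.1 hb with rfl | ⟨c, hc, rfl⟩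
        · rfl
        · obtain ⟨k, _, rfl⟩ := Finset.mem_map.1 hjb
          exact absurd hj (skipThree_notMem n i k)
      · obtain ⟨k, rfl⟩ := exists_skipThree hi hj
        obtain ⟨c, hc, hkc⟩ := p.part.exists_mem (Finset.mem_univ k)
        refine ⟨c.map (skipThree n i).toEmbedding, ⟨mem_insertParts.2 (Or.inr ⟨c, hc, rfl⟩),
          Finset.mem_map_of_mem _ hkc⟩, ?_⟩
        rintro b ⟨hb, hjb⟩
        rcases mem_insertParts.1 hb with rfl | ⟨c', hc', rfl⟩
        · exact absurd hjb hj
        · have hk : k ∈ c' := by simpa using hjb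
          rw [p.part.eq_of_mem_parts hc' hc hk hkc])
    (by
      intro hb
      rcases mem_insertParts.1 hb with h | ⟨c, hc, h⟩
      · have : (⟨i, by omega⟩ : Fin (3 * (n + 1))) ∈ threeBlock n i :=
          mem_threeBlock.2 ⟨le_rfl, by simp⟩
        rw [← h] at this
        simp at this
      · exact (p.part.nonempty_of_mem_parts hc).ne_empty (Finset.map_eq_empty.1 h))
  card_eq_three := by
    intro b hb
    rcases mem_insertParts.1 hb with rfl | ⟨c, hc, rfl⟩
    · have : threeBlock n i = {⟨i, by omega⟩, ⟨i + 1, by omega⟩, ⟨i + 2, by omega⟩} := by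
        ext j
        simp only [mem_threeBlock, Finset.mem_insert, Finset.mem_singleton, Fin.ext_iff]
        omega
      rw [this, Finset.card_eq_three]
      exact ⟨_, _, _, by simp, by simp, by simp, rfl⟩
    · rw [Finset.card_map, p.card_eq_three c hc]
  noncrossing := by
    intro j k l m hjk hkl hlm b hb hjb hlb c hc hkc hmc
    -- Three consecutive points cross nothing, since no point of another block lies strictly between
    -- two of them. Two old blocks do not cross because `skipThree` is increasing.
    rcases mem_insertParts.1 hb with rfl | ⟨b', hb', rfl⟩ <;>
      rcases mem_insertParts.1 hc with rfl | ⟨c', hc', rfl⟩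
    · rw [mem_threeBlock] at hjb hlb hkc hmc
      simp only [Fin.lt_def] at hjk hkl hlm
      omega
    · obtain ⟨k', _, rfl⟩ := Finset.mem_map.1 hkc
      refine skipThree_notMem n i k' (mem_threeBlock.2 ?_)
      rw [mem_threeBlock] at hjb hlb
      simp only [Fin.lt_def] at hjk hkl
      change _ < (skipThree n i k').1 at hjk
      change (skipThree n i k').1 < _ at hkl
      omega
    · obtain ⟨l', _, rfl⟩ := Finset.mem_map.1 hlb
      refine skipThree_notMem n i l' (mem_threeBlock.2 ?_)
      rw [mem_threeBlock] at hkc hmc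
      simp only [Fin.lt_def] at hkl hlm
      change _ < (skipThree n i l').1 at hkl
      change (skipThree n i l').1 < _ at hlm
      omega
    · obtain ⟨j', hj', rfl⟩ := Finset.mem_map.1 hjb
      obtain ⟨k', hk', rfl⟩ := Finset.mem_map.1 hkc
      obtain ⟨l', hl', rfl⟩ := Finset.mem_map.1 hlb
      obtain ⟨m', hm', rfl⟩ := Finset.mem_map.1 hmc
      exact p.noncrossing j' k' l' m' ((skipThree n i).lt_iff_lt.1 hjk)
        ((skipThree n i).lt_iff_lt.1 hkl) ((skipThree n i).lt_iff_lt.1 hlm) b' hb' hj' hl' c' hc'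
        hk' hm'

/-- The only new condition comes from the inserted block; the old blocks keep the order of their
points under `skipThree`. -/
lemma isLabeling_insert {i : ℕ} (hi : i ≤ 3 * n) {F : Type} [Fintype F] [DecidableEq F] (T : Finset (F × F × F))
    (p : NC3 n) (I : Fin (3 * (n + 1)) → F) : IsLabeling T (p.insert i hi) I ↔
      (I ⟨i, by omega⟩, I ⟨i + 1, by omega⟩, I ⟨i + 2, by omega⟩) ∈ T ∧
        IsLabeling T p (I ∘ skipThree n i) := by
  constructor
  · intro h
    constructor
    · refine h (threeBlock n i) (mem_insertParts.2 (Or.inl rfl)) _ ?_ _ ?_ _ ?_ ?_ ?_ <;>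
        simp [mem_threeBlock]
    · intro b hb j hj k hk l hl hjk hkl
      exact h (b.map (skipThree n i).toEmbedding) (mem_insertParts.2 (Or.inr ⟨b, hb, rfl⟩))
        _ (Finset.mem_map_of_mem _ hj) _ (Finset.mem_map_of_mem _ hk) _
        (Finset.mem_map_of_mem _ hl) ((skipThree n i).lt_iff_lt.2 hjk)
        ((skipThree n i).lt_iff_lt.2 hkl)
  · rintro ⟨h1, h2⟩ b hb j hj k hk l hl hjk hkl
    rcases mem_insertParts.1 hb with rfl | ⟨c, hc, rfl⟩
    · rw [mem_threeBlock] at hj hk hl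
      simp only [Fin.lt_def] at hjk hkl
      have e1 : j = ⟨i, by omega⟩ := Fin.ext (by simp only; omega)
      have e2 : k = ⟨i + 1, by omega⟩ := Fin.ext (by simp only; omega)
      have e3 : l = ⟨i + 2, by omega⟩ := Fin.ext (by simp only; omega)
      rw [e1, e2, e3]
      exact h1
    · obtain ⟨j', hj', rfl⟩ := Finset.mem_map.1 hj
      obtain ⟨k', hk', rfl⟩ := Finset.mem_map.1 hk
      obtain ⟨l', hl', rfl⟩ := Finset.mem_map.1 hl
      exact h2 c hc j' hj' k' hk' l' hl' ((skipThree n i).lt_iff_lt.1 hjk)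
        ((skipThree n i).lt_iff_lt.1 hkl)

/-- The partition of the empty set of points. -/
def NC3.empty : NC3 0 where
  part := Finpartition.ofExistsUnique ∅ (by simp) (fun j => j.elim0) (by simp)
  card_eq_three := by simp [Finpartition.ofExistsUnique]
  noncrossing i := i.elim0

open Classical in
/-- Products of creation operators applied to the vacuum give partition vectors. -/
lemma creations_vacuum (L : List ℕ) :
    (∀ (F : Type) [Fintype F] [DecidableEq F] (T : Finset (F × F × F)),
      creations T L (vacuum F) = 0) ∨
    ∃ p : NC3 L.length, ∀ (F : Type) [Fintype F] [DecidableEq F] (T : Finset (F × F × F))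
      (I : Fin (3 * L.length) → F),
      creations T L (vacuum F) (List.ofFn I) = if IsLabeling T p I then 1 else 0 := by
  induction L with
  | nil =>
    refine Or.inr ⟨NC3.empty, fun F _ _ T I => ?_⟩
    rw [if_pos]
    · simp [creations, vacuum]
    · intro b hb
      simp [NC3.empty, Finpartition.ofExistsUnique] at hb
  | cons i L ih =>
    have hcons : ∀ (F : Type) [Fintype F] [DecidableEq F] (T : Finset (F × F × F)),
        creations T (i :: L) (vacuum F) = creation T i (creations T L (vacuum F)) := by
      intro F _ _ T
      simp [creations]
    -- If the position lies beyond the end of the words already created, the result is 0 for every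
    -- T. Otherwise a block of three consecutive points is inserted at i.
    by_cases hi : i ≤ 3 * L.length
    · rcases ih with h | ⟨p, hp⟩
      · left
        intro F _ _ T
        rw [hcons, h, ← creationOp_apply, map_zero]
      · right
        refine ⟨p.insert i hi, fun F _ _ T I => ?_⟩
        have hlen : i + 2 < (List.ofFn I).length := by simp; omega
        have hl : (List.ofFn I).take i ++ (List.ofFn I).drop (i + 3) =
            List.ofFn (I ∘ skipThree L.length i) := by
          apply List.ext_getElem
          · simp
            omega
          · intro j h1 h2
            rw [List.getElem_ofFn]
            by_cases hj : j < i
            · rw [List.getElem_append_left (by simp; omega)]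
              simp only [List.getElem_take, List.getElem_ofFn, Function.comp_apply]
              congr 1
              exact Fin.ext (by simp [skipThree_val, hj])
            · rw [List.getElem_append_right (by simp; omega)]
              simp only [List.getElem_drop, List.getElem_ofFn, Function.comp_apply]
              congr 1
              refine Fin.ext ?_
              simp only [List.length_ofFn] at h2
              simp [skipThree_val, hj]
              omega
        rw [hcons, creation_eq_ite T i _ _ hlen, hl, hp, if_congr (isLabeling_insert hi T p I) rfl rfl,
          ite_and]
        simp only [List.getElem_ofFn]
    · left
      intro F _ _ T
      funext s
      by_cases hs : s.length = 3 * (i :: L).length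
      · rw [hcons, creation_eq_zero]
        · rfl
        · simp at hs
          omega
      · rw [creations_vacuum_eq_zero T _ s hs]
        rfl

open Classical in
/-- The vacuum expectation of a linear combination of words is determined by the scalar products of
partition vectors. -/
lemma vacuum_expectation_eq {F F' : Type} [Fintype F] [DecidableEq F] [Fintype F'] [DecidableEq F']
    (T : Finset (F × F × F)) (T' : Finset (F' × F' × F'))
    (h : ∀ (n : ℕ) (p₁ p₂ : NC3 n), inner ℂ (partitionVector T p₁) (partitionVector T p₂) =
      inner ℂ (partitionVector T' p₁) (partitionVector T' p₂)) (w : FreeMonoid (ℕ ⊕ ℕ)) :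
    opWord T w (vacuum F) [] = opWord T' w (vacuum F') [] := by
  obtain ⟨L, L', hw⟩ := exists_normal_order w
  rw [hw F T, hw F' T', Module.End.mul_apply, Module.End.mul_apply, annihilations_apply_nil,
    annihilations_apply_nil]
  by_cases hl : L.length = L'.length
  · rcases creations_vacuum L.reverse with h0 | ⟨p, hp⟩
    · simp [h0]
    rcases creations_vacuum L' with h0 | ⟨p', hp'⟩
    · simp [h0]
    -- The two partitions live on index types that are only propositionally equal; both are moved to
    -- a common n, still uniformly in F and T.
    have key : ∀ n (hn : L.reverse.length = n) (hn' : L'.length = n), ∃ p₁ p₂ : NC3 n,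
        ∀ (F : Type) [Fintype F] [DecidableEq F] (T : Finset (F × F × F)),
          ∑ I : Fin (3 * n) → F, creations T L.reverse (vacuum F) (List.ofFn I) *
            creations T L' (vacuum F) (List.ofFn I) =
            inner ℂ (partitionVector T p₁) (partitionVector T p₂) := by
      rintro n hn rfl
      have h3 : ∃ p₁ : NC3 L'.length, ∀ (F : Type) [Fintype F] [DecidableEq F]
          (T : Finset (F × F × F)) (I : Fin (3 * L'.length) → F),
          creations T L.reverse (vacuum F) (List.ofFn I) = if IsLabeling T p₁ I then 1 else 0 := by
        rw [← hn]
        exact ⟨p, hp⟩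
      obtain ⟨p₁, hp₁⟩ := h3
      refine ⟨p₁, p', fun F _ _ T => ?_⟩
      simp only [hp₁, hp', partitionVector, PiLp.inner_apply]
      refine Finset.sum_congr rfl fun I _ => ?_
      split_ifs <;> simp
    obtain ⟨p₁, p₂, hp⟩ := key L.length (by simp) hl.symm
    rw [hp, hp, h]
  -- With unequal numbers of creations and annihilations, both expectations vanish by the grading.
  · rw [Finset.sum_eq_zero, Finset.sum_eq_zero]
    · intro I _
      rw [creations_vacuum_eq_zero T' L', mul_zero]
      simpa using hl
    · intro I _
      rw [creations_vacuum_eq_zero T L', mul_zero]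
      simpa using hl

end Insertion

end

section
-- Diagrams as combinations of creation and annihilation operators.
section Flatten
variable {F : Type} [Fintype F] [DecidableEq F] (T : Finset (F × F × F))

/-- The number of letters of a tensor word. -/
def Word.size : Word → ℕ
  | .unit => 0
  | .gen => 1
  | .tensor a b => a.size + b.size

/-- The word in `F` of a basis vector of a tensor word. -/
def flatten : (a : Word) → (wordRep T a).ι → List F
  | .unit, _ => []
  | .gen, x => [(show F from x)]
  | .tensor a b, x => flatten a (show (wordRep T a).ι × (wordRep T b).ι from x).1 ++
      flatten b (show (wordRep T a).ι × (wordRep T b).ι from x).2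

lemma length_flatten (a : Word) (x : (wordRep T a).ι) : (flatten T a x).length = a.size := by
  induction a with
  | unit => rfl
  | gen => rfl
  | tensor a b ha hb =>
    obtain ⟨x, y⟩ := (show (wordRep T a).ι × (wordRep T b).ι from x)
    exact (List.length_append).trans (congrArg₂ _ (ha x) (hb y))

/-- The combination of words in creation and annihilation operators that realizes a diagram at
position `n`. -/
def Diagram.element {a b : Word} : Diagram a b → ℕ → MonoidAlgebra ℂ (FreeMonoid (ℕ ⊕ ℕ))
  | id _, _ => 1
  | comp f g, n => g.element n * f.element n
  | @tensor a _ _ _ f g, n => f.element n * g.element (n + a.size)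
  | assoc _ _ _, _ => 1
  | assocInv _ _ _, _ => 1
  | leftUnitor _, _ => 1
  | leftUnitorInv _, _ => 1
  | rightUnitor _, _ => 1
  | rightUnitorInv _, _ => 1
  | vertex, n => MonoidAlgebra.of ℂ _ (FreeMonoid.of (Sum.inl n))
  | covertex, n => MonoidAlgebra.of ℂ _ (FreeMonoid.of (Sum.inr n))
  | zero _ _, _ => 0
  | add f g, n => f.element n + g.element n
  | smul c f, n => c • f.element n

/-- The operator given by a combination of words in creation and annihilation operators. -/
def opAlg : MonoidAlgebra ℂ (FreeMonoid (ℕ ⊕ ℕ)) →ₐ[ℂ] Module.End ℂ (FockFun F) :=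
  MonoidAlgebra.lift ℂ _ _ (opWord T)

lemma creation_append (φ : FockFun F) (l r : List F) (i j k : F) :
    creation T l.length φ (l ++ i :: j :: k :: r) = if (i, j, k) ∈ T then φ (l ++ r) else 0 := by
  induction l generalizing φ with
  | nil => simp
  | cons x l ih => simp [ih, consPullback]

lemma annihilation_append (φ : FockFun F) (l r : List F) :
    annihilation T l.length φ (l ++ r) = ∑ t ∈ T, φ (l ++ t.1 :: t.2.1 :: t.2.2 :: r) := by
  induction l generalizing φ with
  | nil => simp
  | cons x l ih => simp [ih, consPullback]

lemma sum_permIso_hom {X Y : Rep (comul T)} (e : X.ι ≃ Y.ι)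
    (h : ∀ i j, Y.mat (e i) (e j) = X.mat i j) (y : Y.ι) (f : X.ι → ℂ) :
    ∑ x, (Rep.permIso e h).hom.mat y x * f x = f (e.symm y) := by
  rw [Finset.sum_eq_single (e.symm y)]
  · simp [Rep.permMat]
  · intro x _ hx
    simp only [Rep.permIso_hom_mat, Rep.permMat, Matrix.of_apply]
    rw [if_neg, zero_mul]
    rintro rfl
    simp at hx
  · simp

lemma sum_permIso_inv {X Y : Rep (comul T)} (e : X.ι ≃ Y.ι)
    (h : ∀ i j, Y.mat (e i) (e j) = X.mat i j) (x : X.ι) (f : Y.ι → ℂ) :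
    ∑ y, (Rep.permIso e h).inv.mat x y * f y = f (e x) := by
  have : (Rep.permIso e h).inv.mat = Rep.permMat e.symm := rfl
  rw [this, Finset.sum_eq_single (e x)]
  · simp [Rep.permMat]
  · intro y _ hy
    simp only [Rep.permMat, Matrix.of_apply]
    rw [if_neg, zero_mul]
    rintro rfl
    simp at hy
  · simp

/-- Locality: placed at position |l|, the operator of a diagram leaves the prefix l and the suffix r
alone and acts on the letters between them by the matrix of the intertwiner. Associators and unitors
become trivial, as `flatten` forgets brackets. -/
lemma Diagram.opAlg_element {a b : Word} (d : Diagram a b) (l r : List F) (φ : FockFun F)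
    (y : (wordRep T b).ι) : opAlg T (d.element l.length) φ (l ++ flatten T b y ++ r) =
      ∑ x, (d.hom T).mat y x * φ (l ++ flatten T a x ++ r) := by
  induction d generalizing l r φ with
  | id a =>
    have : ∑ x, (1 : Matrix (wordRep T a).ι (wordRep T a).ι ℂ) y x * φ (l ++ flatten T a x ++ r) =
        φ (l ++ flatten T a y ++ r) := by simp [Matrix.one_apply]
    refine Eq.trans ?_ this.symm
    simp [element]
  | @comp a b c f g hf hg =>
    have h1 : opAlg T ((comp f g).element l.length) φ = opAlg T (g.element l.length)
        (opAlg T (f.element l.length) φ) := by simp [element]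
    have h2 : ((comp f g).hom T).mat = (g.hom T).mat * (f.hom T).mat := rfl
    rw [h1, h2, hg]
    simp only [hf, Matrix.mul_apply, Finset.mul_sum, Finset.sum_mul]
    rw [Finset.sum_comm]
    simp only [mul_assoc]
  | @tensor a b c d f g hf hg =>
    obtain ⟨y, z⟩ := (show (wordRep T b).ι × (wordRep T d).ι from y)
    have h1 : opAlg T ((tensor f g).element l.length) φ = opAlg T (f.element l.length)
        (opAlg T (g.element (l.length + a.size)) φ) := by simp [element]
    rw [h1]
    change opAlg T (f.element l.length) _ (l ++ (flatten T b y ++ flatten T d z) ++ r) =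
      ∑ p : (wordRep T a).ι × (wordRep T c).ι, ((f.hom T).mat y p.1 * (g.hom T).mat z p.2) *
        φ (l ++ (flatten T a p.1 ++ flatten T c p.2) ++ r)
    rw [Fintype.sum_prod_type, ← List.append_assoc, List.append_assoc _ _ r, hf]
    refine Finset.sum_congr rfl fun x _ => ?_
    -- The operator of f is the outer one and has already replaced its target letters by letters of
    -- its source a. The prefix seen by g therefore has length |l| + `a.size`, which explains the
    -- shift in `Diagram.element`.
    have := hg (l ++ flatten T a x) r φ z
    rw [List.length_append, length_flatten] at this
    rw [← List.append_assoc, this, Finset.mul_sum]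
    simp only [mul_assoc, List.append_assoc]
  | assoc a b c =>
    obtain ⟨x, y, z⟩ := (show (wordRep T a).ι × (wordRep T b).ι × (wordRep T c).ι from y)
    refine Eq.trans ?_ (sum_permIso_hom T (X := (wordRep T a ⊗ wordRep T b) ⊗ wordRep T c)
      (Y := wordRep T a ⊗ (wordRep T b ⊗ wordRep T c)) (Equiv.prodAssoc _ _ _) _ (x, y, z)
      (fun x => φ (l ++ flatten T ((a.tensor b).tensor c) x ++ r))).symm
    change opAlg T 1 φ (l ++ (flatten T a x ++ (flatten T b y ++ flatten T c z)) ++ r) =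
      φ (l ++ ((flatten T a x ++ flatten T b y) ++ flatten T c z) ++ r)
    simp
  | assocInv a b c =>
    obtain ⟨⟨x, y⟩, z⟩ := (show ((wordRep T a).ι × (wordRep T b).ι) × (wordRep T c).ι from y)
    refine Eq.trans ?_ (sum_permIso_inv T (X := (wordRep T a ⊗ wordRep T b) ⊗ wordRep T c)
      (Y := wordRep T a ⊗ (wordRep T b ⊗ wordRep T c)) (Equiv.prodAssoc _ _ _) _ ((x, y), z)
      (fun x => φ (l ++ flatten T (a.tensor (b.tensor c)) x ++ r))).symm
    change opAlg T 1 φ (l ++ ((flatten T a x ++ flatten T b y) ++ flatten T c z) ++ r) =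
      φ (l ++ (flatten T a x ++ (flatten T b y ++ flatten T c z)) ++ r)
    simp
  | leftUnitor a =>
    refine Eq.trans ?_ (sum_permIso_hom T (X := 𝟙_ _ ⊗ wordRep T a)
      (Y := wordRep T a) (Equiv.punitProd _) _ y
      (fun x => φ (l ++ flatten T (Word.unit.tensor a) x ++ r))).symm
    change opAlg T 1 φ (l ++ flatten T a y ++ r) = φ (l ++ ([] ++ flatten T a y) ++ r)
    simp
  | leftUnitorInv a =>
    obtain ⟨x, y⟩ := (show Unit × (wordRep T a).ι from y)
    refine Eq.trans ?_ (sum_permIso_inv T (X := 𝟙_ _ ⊗ wordRep T a)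
      (Y := wordRep T a) (Equiv.punitProd _) _ (x, y)
      (fun x => φ (l ++ flatten T a x ++ r))).symm
    change opAlg T 1 φ (l ++ ([] ++ flatten T a y) ++ r) = φ (l ++ flatten T a y ++ r)
    simp
  | rightUnitor a =>
    refine Eq.trans ?_ (sum_permIso_hom T (X := wordRep T a ⊗ 𝟙_ _)
      (Y := wordRep T a) (Equiv.prodPUnit _) _ y
      (fun x => φ (l ++ flatten T (a.tensor Word.unit) x ++ r))).symm
    change opAlg T 1 φ (l ++ flatten T a y ++ r) = φ (l ++ (flatten T a y ++ []) ++ r)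
    simp
  | rightUnitorInv a =>
    obtain ⟨y, x⟩ := (show (wordRep T a).ι × Unit from y)
    refine Eq.trans ?_ (sum_permIso_inv T (X := wordRep T a ⊗ 𝟙_ _)
      (Y := wordRep T a) (Equiv.prodPUnit _) _ (y, x)
      (fun x => φ (l ++ flatten T a x ++ r))).symm
    change opAlg T 1 φ (l ++ (flatten T a y ++ []) ++ r) = φ (l ++ flatten T a y ++ r)
    simp
  | vertex =>
    obtain ⟨i, j, k⟩ := (show F × F × F from y)
    have h1 : opAlg T (vertex.element l.length) φ = creation T l.length φ := by
      simp [element, opAlg, opWord]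
    rw [h1]
    change creation T l.length φ (l ++ [i, j, k] ++ r) =
      ∑ x : Unit, (if (i, j, k) ∈ T then 1 else 0) * φ (l ++ [] ++ r)
    have := creation_append T φ l r i j k
    simp only [List.append_assoc, List.cons_append, List.nil_append, this]
    simp
  | covertex =>
    have h1 : opAlg T (covertex.element l.length) φ = annihilation T l.length φ := by
      simp [element, opAlg, opWord]
    rw [h1]
    change annihilation T l.length φ (l ++ [] ++ r) =
      ∑ x : F × F × F, star (if x ∈ T then (1 : ℂ) else 0) * φ (l ++ [x.1, x.2.1, x.2.2] ++ r)
    have := annihilation_append T φ l r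
    have h2 : ∀ f : F × F × F → ℂ, ∑ t ∈ T, f t = ∑ t, if t ∈ T then f t else 0 := fun f => by
      rw [Finset.sum_ite_mem, Finset.univ_inter]
    rw [List.append_nil, this, h2]
    refine Finset.sum_congr rfl fun x _ => ?_
    split_ifs <;> simp
  | zero a b => 
    have : ∑ x, (0 : Matrix (wordRep T b).ι (wordRep T a).ι ℂ) y x * φ (l ++ flatten T a x ++ r) =
        0 := by simp
    refine Eq.trans ?_ this.symm
    simp [element]
  | @add a b f g hf hg =>
    have h2 : ((add f g).hom T).mat = (f.hom T).mat + (g.hom T).mat := rfl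
    rw [h2]
    simp only [Matrix.add_apply, add_mul, Finset.sum_add_distrib, ← hf, ← hg]
    simp [element]
  | @smul a b c f hf =>
    have h2 : ((smul c f).hom T).mat = c • (f.hom T).mat := rfl
    rw [h2]
    simp only [Matrix.smul_apply, smul_eq_mul, mul_assoc, ← Finset.mul_sum, ← hf]
    simp [element]

/-- The value of a closed diagram. -/
def Diagram.value (d : Diagram .unit .unit) : ℂ := (d.hom T).mat () ()

/-- Locality with empty prefix and suffix; the vacuum takes the value 1 on the empty word. -/
lemma Diagram.value_eq (d : Diagram .unit .unit) :
    d.value T = opAlg T (d.element 0) (vacuum F) [] := by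
  refine Eq.symm ((d.opAlg_element T [] [] (vacuum F) ()).trans ?_)
  change ∑ x : Unit, (d.hom T).mat () x * 1 = (d.hom T).mat () ()
  exact (Fintype.sum_unique _).trans (mul_one _)

end Flatten

/-! ### Closed diagrams detect the vanishing of diagrams. -/

variable {F F' : Type} [Fintype F] [DecidableEq F] [Fintype F'] [DecidableEq F']

/-- The element of the monoid algebra attached to d does not depend on T, so linearity reduces the
claim to single words, that is, to `vacuum_expectation_eq`. -/
lemma Diagram.value_congr {T : Finset (F × F × F)} {T' : Finset (F' × F' × F')}
    (h : ∀ (n : ℕ) (p₁ p₂ : NC3 n), inner ℂ (partitionVector T p₁) (partitionVector T p₂) =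
      inner ℂ (partitionVector T' p₁) (partitionVector T' p₂)) (d : Diagram .unit .unit) :
    d.value T = d.value T' := by
  rw [value_eq, value_eq]
  generalize d.element 0 = w
  induction w using MonoidAlgebra.induction_on with
  | of w => simpa [opAlg] using vacuum_expectation_eq T T' h w
  | add x y hx hy => simp [hx, hy]
  | smul c x hx => simp [hx]

/-- The dual of a tensor word. -/
def Word.dual : Word → Word
  | .unit => .unit
  | .gen => .tensor .gen .gen
  | .tensor a b => .tensor b.dual a.dual

/-- Nested vertices, joining a tensor word to its dual. -/
def Diagram.coev : (a : Word) → Diagram .unit (a.dual.tensor a)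
  | .unit => .leftUnitorInv .unit
  | .gen => .comp .vertex (.assocInv .gen .gen .gen)
  | .tensor a b => .comp (coev b) (.comp (.tensor (.id b.dual)
      (.comp (.leftUnitorInv b) (.comp (.tensor (coev a) (.id b)) (.assoc a.dual a b))))
      (.assocInv b.dual a.dual (a.tensor b)))

variable (T : Finset (F × F × F))

/-- The coefficients of the vector given by `Diagram.coev`. -/
def coevCoeff (a : Word) (x : (wordRep T a.dual).ι) (i : (wordRep T a).ι) : ℂ :=
  (((Diagram.coev a).hom T).mat : Matrix ((wordRep T a.dual).ι × (wordRep T a).ι) Unit ℂ) (x, i) ()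

lemma coevCoeff_gen (x y z : F) : coevCoeff T .gen ((x, y) : F × F) z =
    if (x, y, z) ∈ T then 1 else 0 := by
  change ((Rep.permMat (Equiv.prodAssoc F F F).symm *
    (Matrix.of fun (x : F × F × F) (_ : Unit) => if x ∈ T then (1 : ℂ) else 0))
      ((x, y), z) () : ℂ) = _
  rw [Rep.permMat_mul]
  rfl

/-- The vertices ending in a are nested inside those ending in b. This is why the dual reverses the
order, and why the coefficients simply multiply. -/
lemma coevCoeff_tensor (a b : Word) (x : (wordRep T a.dual).ι) (y : (wordRep T b.dual).ι)
    (i : (wordRep T a).ι) (j : (wordRep T b).ι) :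
    coevCoeff T (a.tensor b) ((y, x) : (wordRep T b.dual).ι × (wordRep T a.dual).ι)
      ((i, j) : (wordRep T a).ι × (wordRep T b).ι) =
      coevCoeff T a x i * coevCoeff T b y j := by
  let M : Matrix ((wordRep T a.dual).ι × (wordRep T a).ι) Unit ℂ := ((Diagram.coev a).hom T).mat
  let N : Matrix ((wordRep T b.dual).ι × (wordRep T b).ι) Unit ℂ := ((Diagram.coev b).hom T).mat
  change ((Rep.permMat (Equiv.prodAssoc (wordRep T b.dual).ι (wordRep T a.dual).ι
      ((wordRep T a).ι × (wordRep T b).ι)).symm *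
    ((1 : Matrix (wordRep T b.dual).ι (wordRep T b.dual).ι ℂ) ⊗ₖ
      (Rep.permMat (Equiv.prodAssoc (wordRep T a.dual).ι (wordRep T a).ι (wordRep T b).ι) *
        (M ⊗ₖ (1 : Matrix (wordRep T b).ι (wordRep T b).ι ℂ)) *
        Rep.permMat (Equiv.punitProd (wordRep T b).ι).symm))) * N) ((y, x), (i, j)) () =
    M (x, i) () * N (y, j) ()
  rw [Rep.permMat_mul, Rep.permMat_mul, Rep.mul_permMat, Matrix.mul_apply, Fintype.sum_prod_type]
  change ∑ y', ∑ j', ((1 : Matrix (wordRep T b.dual).ι (wordRep T b.dual).ι ℂ) y y' *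
    (M (x, i) () * (1 : Matrix (wordRep T b).ι (wordRep T b).ι ℂ) j j')) * N (y', j') () = _
  rw [Finset.sum_eq_single y, Finset.sum_eq_single j]
  · simp
  · intro j' _ hj
    simp [Ne.symm hj]
  · simp
  · intro y' _ hy
    refine Finset.sum_eq_zero fun j' _ => ?_
    simp [Ne.symm hy]
  · simp

lemma IsTrianglePresentation.exists_triple {T : Finset (F × F × F)} {q : ℕ}
    (hT : IsTrianglePresentation T q) (k : F) : ∃ i j, (i, j, k) ∈ T := by
  have : {m | Arrow T k m}.Nonempty := by
    rw [← Set.ncard_pos (Set.toFinite _), hT.card_successors]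
    omega
  obtain ⟨i, j, h⟩ := this
  exact ⟨i, j, hT.cyclic _ _ _ (hT.cyclic _ _ _ h)⟩

/-- For one letter z, choose a triple (x, y, z) in T; as x, y determine z, the slice of the vertex
at (x, y) is the basis vector at z. Nesting multiplies slices. A diagram can thus be recovered
column by column from its composite with `Diagram.coev`. -/
lemma exists_coevCoeff_eq {T : Finset (F × F × F)} {q : ℕ} (hT : IsTrianglePresentation T q)
    (a : Word) (i : (wordRep T a).ι) : ∃ x, ∀ i', coevCoeff T a x i' = if i' = i then 1 else 0 := by
  induction a with
  | unit =>
    refine ⟨(), fun i' => ?_⟩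
    refine Eq.trans ?_ (if_pos rfl).symm
    change (if ((), ()) = (Equiv.punitProd Unit).symm () then (1 : ℂ) else 0) = 1
    exact if_pos rfl
  | gen =>
    obtain ⟨x, y, h⟩ := hT.exists_triple (show F from i)
    refine ⟨((x, y) : F × F), fun i' => ?_⟩
    refine (coevCoeff_gen T x y i').trans (if_congr ⟨fun h' => hT.unique _ _ _ _ h' h, ?_⟩ rfl rfl)
    rintro rfl
    exact h
  | tensor a b ha hb =>
    obtain ⟨i, j⟩ := (show (wordRep T a).ι × (wordRep T b).ι from i)
    obtain ⟨x, hx⟩ := ha i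
    obtain ⟨y, hy⟩ := hb j
    refine ⟨((y, x) : (wordRep T b.dual).ι × (wordRep T a.dual).ι), fun i' => ?_⟩
    obtain ⟨i', j'⟩ := (show (wordRep T a).ι × (wordRep T b).ι from i')
    refine (coevCoeff_tensor T a b x y i' j').trans ?_
    rw [hx, hy]
    by_cases hij : i' = i ∧ j' = j
    · obtain ⟨rfl, rfl⟩ := hij
      exact Eq.trans (by simp) (if_pos rfl).symm
    · refine Eq.trans ?_ (if_neg fun h => hij (Prod.mk_inj.1 h)).symm
      rw [ite_zero_mul_ite_zero, if_neg hij]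

/-- The closed diagram that computes a scalar square of the diagram `d`. -/
def Diagram.square {a b : Word} (d : Diagram a b) : Diagram .unit .unit :=
  comp (comp (coev a) (tensor (id a.dual) d)) (dag (comp (coev a) (tensor (id a.dual) d)))

/-- The closed diagram is v^* v for the vector v = (1 ⊗ d) ∘ `coev`, so its value is the squared
norm of v. -/
lemma Diagram.value_square {a b : Word} (d : Diagram a b) :
    d.square.value T = ∑ x, ∑ y, star (∑ i, (d.hom T).mat y i * coevCoeff T a x i) *
      ∑ i, (d.hom T).mat y i * coevCoeff T a x i := by
  let e : Diagram .unit (a.dual.tensor b) := .comp (coev a) (.tensor (.id a.dual) d)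
  let N : Matrix ((wordRep T a.dual).ι × (wordRep T a).ι) Unit ℂ := ((Diagram.coev a).hom T).mat
  let M : Matrix ((wordRep T a.dual).ι × (wordRep T b).ι) Unit ℂ := (e.hom T).mat
  have h1 : ∀ x y, M (x, y) () = ∑ i, (d.hom T).mat y i * coevCoeff T a x i := by
    intro x y
    change (((1 : Matrix (wordRep T a.dual).ι (wordRep T a.dual).ι ℂ) ⊗ₖ (d.hom T).mat) * N)
      (x, y) () = _
    rw [Matrix.mul_apply, Fintype.sum_prod_type, Finset.sum_eq_single x]
    · simp only [Matrix.kroneckerMap_apply, Matrix.one_apply_eq, one_mul]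
      rfl
    · intro x' _ hx
      refine Finset.sum_eq_zero fun j' _ => ?_
      simp [Ne.symm hx]
    · simp
  have h2 : d.square.value T = (M.conjTranspose * M) () () :=
    
    congrArg (fun N : Matrix Unit ((wordRep T a.dual).ι × (wordRep T b).ι) ℂ => (N * M) () ())
      (congrArg Rep.Hom.mat (e.hom_dag T))
  rw [h2, Matrix.mul_apply, Fintype.sum_prod_type]
  simp only [← h1]
  rfl

/-- If the sum of squares is 0, every term is 0; the terms at the slices from `exists_coevCoeff_eq`
are the squared moduli of the entries of d. -/
lemma Diagram.hom_eq_zero_iff_value {T : Finset (F × F × F)} {q : ℕ}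
    (hT : IsTrianglePresentation T q) {a b : Word} (d : Diagram a b) :
    d.hom T = 0 ↔ d.square.value T = 0 := by
  rw [value_square]
  constructor
  · intro h
    simp [h]
  · intro h
    rw [Finset.sum_eq_zero_iff_of_nonneg
      (fun x _ => Finset.sum_nonneg fun y _ => star_mul_self_nonneg _)] at h
    refine Rep.hom_ext ?_
    ext y i
    obtain ⟨x, hx⟩ := exists_coevCoeff_eq hT a i
    have h2 := h x (Finset.mem_univ x)
    rw [Finset.sum_eq_zero_iff_of_nonneg (fun y _ => star_mul_self_nonneg _)] at h2
    have h3 := h2 y (Finset.mem_univ y)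
    simpa [hx] using h3

/-- Vanishing is decided by the value of a closed diagram that is written down without reference to
T, and such values agree for T and T'. -/
lemma Diagram.hom_eq_zero_iff {T : Finset (F × F × F)} {T' : Finset (F' × F' × F')} {q q' : ℕ}
    (hT : IsTrianglePresentation T q) (hT' : IsTrianglePresentation T' q')
    (h : ∀ (n : ℕ) (p₁ p₂ : NC3 n), inner ℂ (partitionVector T p₁) (partitionVector T p₂) =
      inner ℂ (partitionVector T' p₁) (partitionVector T' p₂)) {a b : Word} (d : Diagram a b) :
    d.hom T = 0 ↔ d.hom T' = 0 := by
  rw [hom_eq_zero_iff_value hT, hom_eq_zero_iff_value hT', value_congr h]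

lemma Diagram.hom_eq_iff {T : Finset (F × F × F)} {T' : Finset (F' × F' × F')} {q q' : ℕ}
    (hT : IsTrianglePresentation T q) (hT' : IsTrianglePresentation T' q')
    (h : ∀ (n : ℕ) (p₁ p₂ : NC3 n), inner ℂ (partitionVector T p₁) (partitionVector T p₂) =
      inner ℂ (partitionVector T' p₁) (partitionVector T' p₂)) {a b : Word} (d e : Diagram a b) :
    d.hom T = e.hom T ↔ d.hom T' = e.hom T' := by
  have := hom_eq_zero_iff hT hT' h (.add d (.smul (-1) e))
  change d.hom T + (-1 : ℂ) • e.hom T = 0 ↔ d.hom T' + (-1 : ℂ) • e.hom T' = 0 at this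
  rwa [neg_one_smul, neg_one_smul, add_neg_eq_zero, add_neg_eq_zero] at this

end

section
-- Orthogonal projections for the Hilbert-Schmidt inner product.
section HilbertSchmidt
variable {m n m' n' : Type} [Fintype m] [Fintype n] [DecidableEq m] [DecidableEq n]
  [Fintype m'] [Fintype n'] [DecidableEq m'] [DecidableEq n']

/-- Matrices as vectors in a Euclidean space. -/
def matrixVec : Matrix m n ℂ ≃ₗ[ℂ] EuclideanSpace ℂ (m × n) where
  toFun R := WithLp.toLp 2 fun p => R p.1 p.2
  invFun v := Matrix.of fun i j => v (i, j)
  map_add' _ _ := rfl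
  map_smul' _ _ := rfl
  left_inv _ := rfl
  right_inv _ := rfl

/-- The Hilbert-Schmidt inner product. -/
def hsInner (R S : Matrix m n ℂ) : ℂ := (R.conjTranspose * S).trace

@[simp] lemma matrixVec_apply (R : Matrix m n ℂ) (p : m × n) : matrixVec R p = R p.1 p.2 := rfl

lemma inner_matrixVec (R S : Matrix m n ℂ) : inner ℂ (matrixVec R) (matrixVec S) = hsInner R S := by
  simp only [PiLp.inner_apply, matrixVec_apply,
    hsInner, Matrix.trace, Matrix.diag_apply, Matrix.mul_apply, Matrix.conjTranspose_apply]
  rw [Fintype.sum_prod_type, Finset.sum_comm]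
  simp [mul_comm]

/-- The orthogonal projection on a space of matrices, for the Hilbert-Schmidt inner product. -/
def hsProj (C : Submodule ℂ (Matrix m n ℂ)) : Matrix m n ℂ →ₗ[ℂ] Matrix m n ℂ :=
  matrixVec.symm.toLinearMap ∘ₗ
    ((C.map matrixVec.toLinearMap).starProjection : _ →L[ℂ] _).toLinearMap ∘ₗ
      matrixVec.toLinearMap

variable {C : Submodule ℂ (Matrix m n ℂ)}

lemma hsProj_mem (R : Matrix m n ℂ) : hsProj C R ∈ C := by
  have : (C.map matrixVec.toLinearMap).starProjection (matrixVec R) ∈ C.map matrixVec.toLinearMap :=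
    Submodule.starProjection_apply_mem _ _
  obtain ⟨S, hS, h⟩ := this
  have : hsProj C R = S := by
    change matrixVec.symm ((C.map matrixVec.toLinearMap).starProjection (matrixVec R)) = S
    rw [← h]
    rfl
  rwa [this]

lemma hsInner_sub_hsProj {R S : Matrix m n ℂ} (hS : S ∈ C) : hsInner (R - hsProj C R) S = 0 := by
  rw [← inner_matrixVec, map_sub]
  exact Submodule.starProjection_inner_eq_zero (K := C.map matrixVec.toLinearMap) (matrixVec R)
    (matrixVec S) ⟨S, hS, rfl⟩

lemma hsProj_eq {R P : Matrix m n ℂ} (hP : P ∈ C) (h : ∀ S ∈ C, hsInner (R - P) S = 0) :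
    hsProj C R = P := by
  change matrixVec.symm ((C.map matrixVec.toLinearMap).starProjection (matrixVec R)) = P
  rw [LinearEquiv.symm_apply_eq]
  refine Submodule.eq_starProjection_of_mem_of_inner_eq_zero ⟨P, hP, rfl⟩ ?_
  rintro _ ⟨S, hS, rfl⟩
  rw [← map_sub]
  exact (inner_matrixVec _ _).trans (h S hS)

lemma hsProj_of_mem {R : Matrix m n ℂ} (hR : R ∈ C) : hsProj C R = R :=
  hsProj_eq hR fun S _ => by simp [hsInner]

lemma hsInner_hsProj_left (R S : Matrix m n ℂ) :
    hsInner (hsProj C R) S = hsInner R (hsProj C S) := by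
  simp only [← inner_matrixVec]
  exact Submodule.inner_starProjection_left_eq_right (C.map matrixVec.toLinearMap) (matrixVec R)
    (matrixVec S)

/-- A linear map that, together with its adjoint, preserves spaces of matrices, commutes with the
projections. -/
lemma hsProj_comm {C' : Submodule ℂ (Matrix m' n' ℂ)} (L : Matrix m n ℂ →ₗ[ℂ] Matrix m' n' ℂ)
    (L' : Matrix m' n' ℂ → Matrix m n ℂ) (hadj : ∀ R S, hsInner (L R) S = hsInner R (L' S))
    (hL : ∀ R ∈ C, L R ∈ C') (hL' : ∀ S ∈ C', L' S ∈ C) (R : Matrix m n ℂ) :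
    hsProj C' (L R) = L (hsProj C R) := by
  refine hsProj_eq (hL _ (hsProj_mem R)) fun S hS => ?_
  rw [← map_sub, hadj]
  exact hsInner_sub_hsProj (hL' S hS)

lemma star_hsInner (R S : Matrix m n ℂ) : star (hsInner R S) = hsInner S R := by
  rw [hsInner, ← Matrix.trace_conjTranspose, Matrix.conjTranspose_mul,
    Matrix.conjTranspose_conjTranspose, hsInner]

lemma hsInner_conjTranspose (R S : Matrix m n ℂ) :
    hsInner R.conjTranspose S.conjTranspose = star (hsInner R S) := by
  rw [star_hsInner, hsInner, hsInner, Matrix.conjTranspose_conjTranspose, Matrix.trace_mul_comm]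

lemma hsProj_conjTranspose {C' : Submodule ℂ (Matrix n m ℂ)} (h : ∀ R ∈ C, R.conjTranspose ∈ C')
    (h' : ∀ R ∈ C', R.conjTranspose ∈ C) (R : Matrix m n ℂ) :
    hsProj C' R.conjTranspose = (hsProj C R).conjTranspose := by
  refine hsProj_eq (h _ (hsProj_mem R)) fun S hS => ?_
  rw [← Matrix.conjTranspose_sub, ← Matrix.conjTranspose_conjTranspose S, hsInner_conjTranspose,
    hsInner_sub_hsProj (h' S hS), star_zero]

lemma hsInner_single (i : m) (j : n) (S : Matrix m n ℂ) :
    hsInner (Matrix.single i j 1) S = S i j := by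
  rw [hsInner, Matrix.conjTranspose_single, star_one, Matrix.trace, Finset.sum_eq_single j]
  · simp
  · intro k _ hk
    simp [hk]
  · simp

end HilbertSchmidt

/-! ### The candidate for the Haar state on products of coefficients, and its positivity. -/

section Kernel

variable {O : Type} {ι : O → Type} [∀ o, Fintype (ι o)] [∀ o, DecidableEq (ι o)]
  (C : ∀ a b : O, Submodule ℂ (Matrix (ι b) (ι a) ℂ))

/-- The kernel of the projection on the space of morphisms from `d` to `b`. -/
def projKernel (d b : O) (i : ι b) (x : ι d) (j : ι b) (y : ι d) : ℂ :=
  hsProj (C d b) (Matrix.single j y 1) i x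

variable {C}

lemma star_projKernel (d b : O) (i : ι b) (x : ι d) (j : ι b) (y : ι d) :
    star (projKernel C d b i x j y) = projKernel C d b j y i x := by
  have key : ∀ i x j y, projKernel C d b i x j y =
      hsInner (Matrix.single i x 1) (hsProj (C d b) (Matrix.single j y 1)) :=
    fun i x j y => by rw [hsInner_single, projKernel]
  rw [key, key, star_hsInner, hsInner_hsProj_left]

/-- Conjugate transposition maps the morphism spaces onto each other, so it commutes with the
projections while exchanging source and target. This makes `coeffKernel` Hermitian. -/
lemma star_projKernel' (hstar : ∀ a b, ∀ R ∈ C a b, R.conjTranspose ∈ C b a)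
    (d b : O) (i : ι b) (x : ι d) (j : ι b) (y : ι d) :
    star (projKernel C d b i x j y) = projKernel C b d x i y j := by
  have := hsProj_conjTranspose (hstar d b) (hstar b d) (Matrix.single j y 1)
  rw [Matrix.conjTranspose_single, star_one] at this
  rw [projKernel, projKernel, this, Matrix.conjTranspose_apply]

lemma hsProj_apply (d b : O) (R : Matrix (ι b) (ι d) ℂ) (i : ι b) (x : ι d) :
    hsProj (C d b) R i x = ∑ j, ∑ y, projKernel C d b i x j y * R j y := by
  conv_lhs => rw [Matrix.matrix_eq_sum_single R]
  simp only [map_sum, Matrix.sum_apply]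
  refine Finset.sum_congr rfl fun j _ => Finset.sum_congr rfl fun y _ => ?_
  have : Matrix.single j y (R j y) = R j y • Matrix.single j y (1 : ℂ) := by
    rw [Matrix.smul_single, smul_eq_mul, mul_one]
  rw [this, map_smul, Matrix.smul_apply, smul_eq_mul, mul_comm]
  rfl

/-- Multiplication by R and its adjoint, multiplication by R^*, both preserve the morphism spaces.
Hence the projections are module maps over the category. -/
lemma hsProj_mul_left (hmul : ∀ a b c, ∀ R ∈ C b c, ∀ S ∈ C a b, R * S ∈ C a c)
    (hstar : ∀ a b, ∀ R ∈ C a b, R.conjTranspose ∈ C b a) {d b b' : O} {R : Matrix (ι b') (ι b) ℂ}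
    (hR : R ∈ C b b') (S : Matrix (ι b) (ι d) ℂ) :
    hsProj (C d b') (R * S) = R * hsProj (C d b) S := by
  refine hsProj_comm (LinearMap.mk ⟨fun S => R * S, Matrix.mul_add R⟩ fun c S => Matrix.mul_smul R c S)
    (fun S => R.conjTranspose * S) (fun S S' => ?_) (fun S hS => hmul _ _ _ _ hR _ hS)
    (fun S hS => hmul _ _ _ _ (hstar _ _ _ hR) _ hS) S
  simp [hsInner, Matrix.conjTranspose_mul, Matrix.mul_assoc]

lemma hsProj_mul_right (hmul : ∀ a b c, ∀ R ∈ C b c, ∀ S ∈ C a b, R * S ∈ C a c)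
    (hstar : ∀ a b, ∀ R ∈ C a b, R.conjTranspose ∈ C b a) {d d' b : O} {R : Matrix (ι d) (ι d') ℂ}
    (hR : R ∈ C d' d) (S : Matrix (ι b) (ι d) ℂ) :
    hsProj (C d' b) (S * R) = hsProj (C d b) S * R := by
  refine hsProj_comm (LinearMap.mk ⟨fun S => S * R, fun S S' => Matrix.add_mul S S' R⟩
      fun c S => Matrix.smul_mul c S R)
    (fun S => S * R.conjTranspose) (fun S S' => ?_) (fun S hS => hmul _ _ _ _ hS _ hR)
    (fun S hS => hmul _ _ _ _ hS _ (hstar _ _ _ hR)) S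
  simp only [LinearMap.coe_mk, AddHom.coe_mk, hsInner, Matrix.conjTranspose_mul, Matrix.mul_assoc]
  rw [Matrix.trace_mul_comm, Matrix.mul_assoc]

lemma projKernel_mul_left (hmul : ∀ a b c, ∀ R ∈ C b c, ∀ S ∈ C a b, R * S ∈ C a c)
    (hstar : ∀ a b, ∀ R ∈ C a b, R.conjTranspose ∈ C b a) {d b b' : O} {R : Matrix (ι b') (ι b) ℂ}
    (hR : R ∈ C b b') (i' : ι b') (x : ι d) (j : ι b) (y : ι d) :
    ∑ j', projKernel C d b' i' x j' y * R j' j = ∑ i, R i' i * projKernel C d b i x j y := by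
  have h := congrFun (congrFun (hsProj_mul_left hmul hstar hR (Matrix.single j y 1)) i') x
  rw [hsProj_apply, Matrix.mul_apply] at h
  refine Eq.trans (Finset.sum_congr rfl fun j' _ => ?_) h
  rw [Finset.sum_eq_single y]
  · simp
  · intro y' _ hy
    simp [Matrix.mul_apply, Ne.symm hy]
  · simp

lemma projKernel_mul_right (hmul : ∀ a b c, ∀ R ∈ C b c, ∀ S ∈ C a b, R * S ∈ C a c)
    (hstar : ∀ a b, ∀ R ∈ C a b, R.conjTranspose ∈ C b a) {d d' b : O} {R : Matrix (ι d') (ι d) ℂ}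
    (hR : R ∈ C d d') (i : ι b) (x : ι d) (j : ι b) (y' : ι d') :
    ∑ y, projKernel C d b i x j y * R y' y = ∑ x', projKernel C d' b i x' j y' * R x' x := by
  have h := congrFun (congrFun (hsProj_mul_right hmul hstar hR (Matrix.single j y' 1)) i) x
  rw [hsProj_apply, Matrix.mul_apply] at h
  refine Eq.trans ?_ h
  rw [Finset.sum_eq_single j]
  · simp
  · intro j' _ hj
    simp [Matrix.mul_apply, Ne.symm hj]
  · simp

lemma hsInner_eq_sum {m n : Type} [Fintype m] [Fintype n] (R S : Matrix m n ℂ) :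
    hsInner R S = ∑ i, ∑ x, star (R i x) * S i x := by
  simp only [hsInner, Matrix.trace, Matrix.diag_apply, Matrix.mul_apply, Matrix.conjTranspose_apply]
  exact Finset.sum_comm

/-- This is ⟨v, Pv⟩ = ‖Pv‖² for a projection P with fixed source and target. The rows here are pairs
(i, x). The kernel `coeffKernel` instead groups the indices as (x, y) and (i, j), so its positivity
does not follow directly. -/
lemma projKernel_nonneg (d b : O) (v : Matrix (ι b) (ι d) ℂ) :
    0 ≤ ∑ i, ∑ x, ∑ j, ∑ y, star (v i x) * projKernel C d b i x j y * v j y := by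
  have h1 : hsInner v (hsProj (C d b) v) = hsInner (hsProj (C d b) v) (hsProj (C d b) v) := by
    rw [hsInner_hsProj_left, hsProj_of_mem (hsProj_mem v)]
  have h2 : 0 ≤ hsInner (hsProj (C d b) v) (hsProj (C d b) v) := by
    rw [hsInner_eq_sum]
    exact Finset.sum_nonneg fun i _ => Finset.sum_nonneg fun x _ => star_mul_self_nonneg _
  rw [← h1, hsInner_eq_sum] at h2
  simpa only [hsProj_apply, Finset.mul_sum, mul_assoc] using h2

variable (ι) in
/-- Indices of matrix coefficients. -/
abbrev CoeffIndex : Type := Σ o : O, ι o × ι o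

variable (C) in
/-- The scalar product of two matrix coefficients. -/
def coeffKernel (p p' : CoeffIndex ι) : ℂ :=
  projKernel C p.1 p'.1 p'.2.1 p.2.1 p'.2.2 p.2.2

lemma star_coeffKernel (hstar : ∀ a b, ∀ R ∈ C a b, R.conjTranspose ∈ C b a)
    (p p' : CoeffIndex ι) : star (coeffKernel C p p') = coeffKernel C p' p :=
  star_projKernel' hstar _ _ _ _ _ _

/-- The image of the kernel consists of families of matrices whose transposes are natural with
respect to all morphisms. An eigenvector with t ≠ 0 is therefore natural itself. Naturality turns
the eigenvalue equation into t c_d = c_d M_d with M_d a sum of positive matrices coming from the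
projections, which forces t ‖c_d‖² ≥ 0. -/
lemma coeffKernel_eigenvalue_nonneg (hmul : ∀ a b c, ∀ R ∈ C b c, ∀ S ∈ C a b, R * S ∈ C a c)
    (hstar : ∀ a b, ∀ R ∈ C a b, R.conjTranspose ∈ C b a) (J : Finset O) (t : ℝ)
    (c : ∀ o, Matrix (ι o) (ι o) ℂ)
    (hc : ∀ d ∈ J, ∀ x y, ∑ b ∈ J, ∑ i, ∑ j, projKernel C d b i x j y * c b i j = t * c d x y)
    (hne : ∃ d ∈ J, c d ≠ 0) : 0 ≤ t := by
  rcases eq_or_ne t 0 with rfl | ht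
  · rfl
  -- The kernel applied to c, defined for every object d and not just for those in J.
  let E : ∀ d, Matrix (ι d) (ι d) ℂ := fun d => Matrix.of fun x y =>
    ∑ b ∈ J, ∑ i, ∑ j, projKernel C d b i x j y * c b i j
  have hE : ∀ d d', ∀ S ∈ C d d', ∀ x y', ∑ x', E d' x' y' * S x' x = ∑ y, S y' y * E d x y := by
    intro d d' S hS x y'
    simp only [E, Matrix.of_apply, Finset.sum_mul, Finset.mul_sum]
    rw [Finset.sum_comm, Finset.sum_comm (s := Finset.univ (α := ι d))]
    refine Finset.sum_congr rfl fun b _ => ?_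
    rw [Finset.sum_comm, Finset.sum_comm (s := Finset.univ (α := ι d))]
    refine Finset.sum_congr rfl fun i _ => ?_
    rw [Finset.sum_comm, Finset.sum_comm (s := Finset.univ (α := ι d))]
    refine Finset.sum_congr rfl fun j _ => ?_
    have := projKernel_mul_right hmul hstar hS i x j y'
    calc _ = (∑ x', projKernel C d' b i x' j y' * S x' x) * c b i j := by
          rw [Finset.sum_mul]
          exact Finset.sum_congr rfl fun _ _ => by ring
      _ = (∑ y, projKernel C d b i x j y * S y' y) * c b i j := by rw [this]
      _ = _ := by
          rw [Finset.sum_mul]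
          exact Finset.sum_congr rfl fun _ _ => by ring
  have htc : (t : ℂ) ≠ 0 := by exact_mod_cast ht
  have hcE : ∀ d ∈ J, ∀ x y, E d x y = t * c d x y := fun d hd x y => hc d hd x y
  -- Dividing by t ≠ 0 transfers the naturality of E to c.
  have hN : ∀ d ∈ J, ∀ d' ∈ J, ∀ S ∈ C d d', ∀ x y',
      ∑ x', c d' x' y' * S x' x = ∑ y, S y' y * c d x y := by
    intro d hd d' hd' S hS x y'
    have := hE d d' S hS x y'
    simp only [hcE d hd, hcE d' hd'] at this
    apply mul_left_cancel₀ htc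
    rw [Finset.mul_sum, Finset.mul_sum]
    refine Eq.trans (Finset.sum_congr rfl fun _ _ => by ring) (this.trans ?_)
    exact Finset.sum_congr rfl fun _ _ => by ring
  -- Naturality of c for the projected matrix unit, which is a morphism from d to b, replaces c b by
  -- c d in the eigenvalue equation.
  have hz : ∀ d ∈ J, ∀ x y, t * c d x y =
      ∑ b ∈ J, ∑ j, ∑ w, projKernel C d b j w j y * c d x w := by
    intro d hd x y
    rw [← hc d hd]
    refine Finset.sum_congr rfl fun b hb => ?_
    rw [Finset.sum_comm]
    refine Finset.sum_congr rfl fun j _ => ?_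
    have := hN d hd b hb _ (hsProj_mem (C := C d b) (Matrix.single j y 1)) x j
    refine Eq.trans (Finset.sum_congr rfl fun _ _ => mul_comm _ _) this
  have hpos : ∀ d ∈ J, 0 ≤ t * ∑ x, ∑ y, star (c d x y) * c d x y := by
    intro d hd
    have h1 : ∀ x, 0 ≤ ∑ y, star (c d x y) * (t * c d x y) := by
      intro x
      simp only [hz d hd, Finset.mul_sum]
      rw [Finset.sum_comm]
      refine Finset.sum_nonneg fun b _ => ?_
      rw [Finset.sum_comm]
      refine Finset.sum_nonneg fun j _ => ?_
      -- The test matrix has the conjugate of row x of c d in row j and zeros elsewhere.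
      have := projKernel_nonneg (C := C) d b
        (Matrix.of fun j' w => if j' = j then star (c d x w) else 0)
      rw [Finset.sum_eq_single j] at this
      · rw [Finset.sum_comm]
        refine this.trans_eq (Finset.sum_congr rfl fun w _ => ?_)
        rw [Finset.sum_eq_single j]
        · refine Finset.sum_congr rfl fun y _ => ?_
          simp
          ring
        · intro j' _ hj
          simp [hj]
        · simp
      · intro j' _ hj
        simp [hj]
      · simp
    have h2 := Finset.sum_nonneg fun x (_ : x ∈ Finset.univ) => h1 x
    refine h2.trans_eq ?_
    rw [Finset.mul_sum]
    refine Finset.sum_congr rfl fun x _ => ?_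
    rw [Finset.mul_sum]
    exact Finset.sum_congr rfl fun y _ => by ring
  obtain ⟨d, hd, hcd⟩ := hne
  have h1 := hpos d hd
  have h2 : ∑ x, ∑ y, star (c d x y) * c d x y = ((∑ x, ∑ y, ‖c d x y‖ ^ 2 : ℝ) : ℂ) := by
    push_cast
    refine Finset.sum_congr rfl fun x _ => Finset.sum_congr rfl fun y _ => ?_
    rw [Complex.star_def, Complex.conj_mul']
  have h3 : 0 < ∑ x, ∑ y, ‖c d x y‖ ^ 2 := by
    by_contra hle
    apply hcd
    have h4 : ∑ x, ∑ y, ‖c d x y‖ ^ 2 = 0 := le_antisymm (not_lt.1 hle) (by positivity)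
    ext x y
    rw [Finset.sum_eq_zero_iff_of_nonneg (fun _ _ => by positivity)] at h4
    have h5 := h4 x (Finset.mem_univ x)
    rw [Finset.sum_eq_zero_iff_of_nonneg (fun _ _ => by positivity)] at h5
    simpa using h5 y (Finset.mem_univ y)
  rw [h2, ← Complex.ofReal_mul, Complex.zero_le_real] at h1
  exact nonneg_of_mul_nonneg_left h1 h3

open Classical in
/-- Positivity of the scalar product of matrix coefficients. -/
lemma coeffKernel_nonneg (hmul : ∀ a b c, ∀ R ∈ C b c, ∀ S ∈ C a b, R * S ∈ C a c)
    (hstar : ∀ a b, ∀ R ∈ C a b, R.conjTranspose ∈ C b a) (v : CoeffIndex ι →₀ ℂ) :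
    0 ≤ v.sum fun p a => v.sum fun p' a' => star a * coeffKernel C p p' * a' := by
  let J : Finset O := v.support.image Sigma.fst
  -- The support is enlarged to all coefficients of the objects involved, so that an eigenvector is
  -- a family of full matrices, as the naturality argument requires.
  let S : Finset (CoeffIndex ι) := J.sigma fun _ => Finset.univ
  have hS : v.support ⊆ S := fun p hp => by
    simp only [S, Finset.mem_sigma, Finset.mem_univ, and_true]
    exact Finset.mem_image_of_mem _ hp
  let K : Matrix S S ℂ := Matrix.of fun p p' => coeffKernel C p.1 p'.1
  have hKa : ∀ p p', K p p' = coeffKernel C p.1 p'.1 := fun _ _ => rfl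
  have hK : K.IsHermitian := by
    ext p p'
    exact star_coeffKernel hstar _ _
  have hpos : K.PosSemidef := by
    rw [hK.posSemidef_iff_eigenvalues_nonneg]
    intro k
    let w : CoeffIndex ι → ℂ := fun p => if hp : p ∈ S then hK.eigenvectorBasis k ⟨p, hp⟩ else 0
    have hw : ∀ p : S, w p.1 = hK.eigenvectorBasis k p := fun p => by simp [w]
    refine coeffKernel_eigenvalue_nonneg hmul hstar J (hK.eigenvalues k)
      (fun o => Matrix.of fun i j => w ⟨o, (i, j)⟩) ?_ ?_
    · intro d hd x y
      have hp : (⟨d, (x, y)⟩ : CoeffIndex ι) ∈ S := by simp [S, hd]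
      have h1 := congrFun (hK.mulVec_eigenvectorBasis k) ⟨_, hp⟩
      simp only [Matrix.mulVec, dotProduct, Pi.smul_apply, ← hw, hKa] at h1
      rw [Finset.sum_coe_sort S fun p' => coeffKernel C ⟨d, (x, y)⟩ p' * w p',
        Finset.sum_sigma] at h1
      simpa [Fintype.sum_prod_type, coeffKernel] using h1
    · by_contra! h0
      have h1 : hK.eigenvectorBasis k = 0 := by
        ext p
        have h2 : p.1.1 ∈ J := by
          have := p.2
          simp only [S, Finset.mem_sigma] at this
          exact this.1
        rw [← hw]
        exact congrFun (congrFun (h0 _ h2) p.1.2.1) p.1.2.2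
      have h2 := hK.eigenvectorBasis.orthonormal.1 k
      rw [h1] at h2
      simp at h2
  have h := hpos.dotProduct_mulVec_nonneg fun p => v p.1
  simp only [Matrix.mulVec, dotProduct, Pi.star_apply, Finset.mul_sum, hKa] at h
  rw [Finset.sum_coe_sort S fun p => ∑ p' : S, star (v p) * (coeffKernel C p p'.1 * v p'.1)] at h
  rw [Finsupp.sum_of_support_subset _ hS _ (by simp)]
  refine h.trans_eq (Finset.sum_congr rfl fun p _ => ?_)
  rw [Finset.sum_coe_sort S fun p' => star (v p) * (coeffKernel C p p' * v p'),
    Finsupp.sum_of_support_subset _ hS _ (by simp)]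
  exact Finset.sum_congr rfl fun p' _ => by ring

end Kernel

end

section
variable {F : Type} [Fintype F] [DecidableEq F] (T : Finset (F × F × F))

/-! ### Partial traces of diagrams are diagrams. -/

section Vertices

/-- The vertex in the first three legs, next to the identity of `k`. -/
def vertexMat (k : Word) : Matrix (F × (F × (F × (wordRep T k).ι))) (wordRep T k).ι ℂ :=
  Matrix.of fun p i => if (p.1, p.2.1, p.2.2.1) ∈ T then (1 : Matrix _ _ ℂ) p.2.2.2 i else 0

lemma vertexMat_mem (k : Word) : vertexMat T k ∈
    diagramSpace T k (Word.gen.tensor (Word.gen.tensor (Word.gen.tensor k))) := by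
  refine ⟨.comp (.leftUnitorInv k) (.comp (.tensor .vertex (.id k)) (.comp (.assoc _ _ _)
    (.tensor (.id _) (.assoc _ _ _)))), ?_⟩
  ext p j
  obtain ⟨(x : F), (y : F), (z : F), i⟩ := p
  let N : Matrix (F × (F × F)) Unit ℂ := (vertexHom T).mat
  change (((((1 : Matrix F F ℂ) ⊗ₖ Rep.permMat (Equiv.prodAssoc F F (wordRep T k).ι)) *
    Rep.permMat (Equiv.prodAssoc F (F × F) (wordRep T k).ι)) *
    (N ⊗ₖ (1 : Matrix (wordRep T k).ι (wordRep T k).ι ℂ))) *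
    Rep.permMat (Equiv.punitProd (wordRep T k).ι).symm) (x, y, z, i) j = _
  rw [← Rep.permMat_refl, Rep.permMat_kronecker, Rep.permMat_mul_permMat, Rep.permMat_mul,
    Rep.mul_permMat]
  change (if (x, y, z) ∈ T then (1 : ℂ) else 0) * (1 : Matrix _ _ ℂ) i j =
    if (x, y, z) ∈ T then (1 : Matrix _ _ ℂ) i j else 0
  split_ifs <;> simp

/-- The partial trace over the first leg. -/
def partialTrace (k l : Word) : Matrix (F × (wordRep T l).ι) (F × (wordRep T k).ι) ℂ →ₗ[ℂ]
    Matrix (wordRep T l).ι (wordRep T k).ι ℂ where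
  toFun S := Matrix.of fun i j => ∑ a, S (a, i) (a, j)
  map_add' S S' := by ext i j; simp [Finset.sum_add_distrib]
  map_smul' c S := by ext i j; simp [Finset.mul_sum]

variable {T} {q : ℕ}

/-- By cyclic symmetry (x, y, z) ∈ T iff (z, x, y) ∈ T, so the pairs correspond to the successors x
of z. -/
lemma IsTrianglePresentation.card_pairs (hT : IsTrianglePresentation T q) (z : F) :
    (Finset.univ.filter fun p : F × F => (p.1, p.2, z) ∈ T).card = q + 1 := by
  classical
  rw [← hT.card_successors z, ← Set.ncard_coe_finset]
  refine Set.ncard_congr (fun p _ => p.1) ?_ ?_ ?_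
  · rintro ⟨x, y⟩ h
    simp only [Finset.coe_filter, Finset.mem_univ, true_and] at h
    exact ⟨y, hT.cyclic _ _ _ h⟩
  · rintro ⟨x, y⟩ ⟨x', y'⟩ h h' rfl
    simp only [Finset.coe_filter, Finset.mem_univ, true_and] at h h'
    exact Prod.ext rfl (hT.unique _ _ _ _ (hT.cyclic _ _ _ h) (hT.cyclic _ _ _ h'))
  · rintro x ⟨y, h⟩
    exact ⟨(x, y), by simpa using hT.cyclic _ _ _ (hT.cyclic _ _ _ h), rfl⟩

/-- The vertex, read as the map e_z ↦ ∑ e_x ⊗ e_y, is √(q+1) times an isometry. Its images of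
distinct basis vectors have disjoint supports because x, y determine z. -/
lemma IsTrianglePresentation.sum_pairs (hT : IsTrianglePresentation T q) (z z' : F) :
    ∑ x, ∑ y, (if (x, y, z') ∈ T then (if (x, y, z) ∈ T then (1 : ℂ) else 0) else 0) =
      if z' = z then (q + 1 : ℂ) else 0 := by
  rw [← Fintype.sum_prod_type' (f := fun x y =>
    (if (x, y, z') ∈ T then (if (x, y, z) ∈ T then (1 : ℂ) else 0) else 0))]
  split_ifs with h
  · subst h
    rw [← Nat.cast_one, ← Nat.cast_add, ← hT.card_pairs z', Finset.card_filter, Nat.cast_sum]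
    refine Finset.sum_congr rfl fun p _ => ?_
    split_ifs <;> simp
  · refine Finset.sum_eq_zero fun p _ => ?_
    split_ifs with h1 h2
    · exact absurd (hT.unique _ _ _ _ h1 h2) h
    · rfl
    · rfl

/-- The first leg is closed by a vertex and an adjoint vertex joined along their other two legs.
Composing 1 ⊗ 1 ⊗ S with these gives (q + 1) times the partial trace, by `sum_pairs`. -/
lemma partialTrace_mem (hT : IsTrianglePresentation T q) (k l : Word)
    (S : Matrix (F × (wordRep T l).ι) (F × (wordRep T k).ι) ℂ)
    (hS : S ∈ diagramSpace T (Word.gen.tensor k) (Word.gen.tensor l)) :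
    partialTrace T k l S ∈ diagramSpace T k l := by
  let S' : Matrix (F × (F × (F × (wordRep T l).ι))) (F × (F × (F × (wordRep T k).ι))) ℂ :=
    (1 : Matrix F F ℂ) ⊗ₖ ((1 : Matrix F F ℂ) ⊗ₖ S)
  have hS' : S' ∈ diagramSpace T (Word.gen.tensor (Word.gen.tensor (Word.gen.tensor k)))
      (Word.gen.tensor (Word.gen.tensor (Word.gen.tensor l))) :=
    kronecker_mem_diagramSpace (one_mem_diagramSpace .gen)
      (kronecker_mem_diagramSpace (one_mem_diagramSpace .gen) hS)
  have h1 : (vertexMat T l).conjTranspose * (S' * vertexMat T k) ∈ diagramSpace T k l :=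
    mul_mem_diagramSpace (conjTranspose_mem_diagramSpace (vertexMat_mem T l))
      (mul_mem_diagramSpace hS' (vertexMat_mem T k))
  have h2 : (vertexMat T l).conjTranspose * (S' * vertexMat T k) =
      (q + 1 : ℂ) • partialTrace T k l S := by
    ext i j
    have h3 : ∀ x y z' i', (S' * vertexMat T k) (x, y, z', i') j =
        ∑ z, if (x, y, z) ∈ T then S (z', i') (z, j) else 0 := by
      intro x y z' i'
      rw [Matrix.mul_apply, Fintype.sum_prod_type, Finset.sum_eq_single x,
        Fintype.sum_prod_type, Finset.sum_eq_single y, Fintype.sum_prod_type]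
      · refine Finset.sum_congr rfl fun z _ => ?_
        rw [Finset.sum_eq_single j]
        · simp [S', vertexMat]
        · intro j' _ hj
          simp [vertexMat, hj]
        · simp
      · intro y' _ hy
        refine Finset.sum_eq_zero fun p _ => ?_
        simp [S', Ne.symm hy]
      · simp
      · intro x' _ hx
        refine Finset.sum_eq_zero fun p _ => ?_
        simp [S', Ne.symm hx]
      · simp
    rw [Matrix.mul_apply, Fintype.sum_prod_type]
    simp only [Fintype.sum_prod_type, h3, Matrix.conjTranspose_apply]
    have h4 : ∀ x y, (∑ z', ∑ i', star (vertexMat T l (x, y, z', i') i) *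
        ∑ z, if (x, y, z) ∈ T then S (z', i') (z, j) else 0) = ∑ z', ∑ z,
        (if (x, y, z') ∈ T then (if (x, y, z) ∈ T then (1 : ℂ) else 0) else 0) *
          S (z', i) (z, j) := by
      intro x y
      refine Finset.sum_congr rfl fun z' _ => ?_
      rw [Finset.sum_eq_single i, Finset.mul_sum]
      · refine Finset.sum_congr rfl fun z _ => ?_
        simp only [vertexMat, Matrix.of_apply, Matrix.one_apply_eq]
        split_ifs <;> simp
      · intro i' _ hi
        simp [vertexMat, hi]
      · simp
    have h5 : ∀ f : F → F → F → F → ℂ, ∑ x, ∑ y, ∑ z', ∑ z, f x y z' z =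
        ∑ z', ∑ z, ∑ x, ∑ y, f x y z' z := by
      intro f
      calc _ = ∑ x, ∑ z', ∑ z, ∑ y, f x y z' z := by
            refine Finset.sum_congr rfl fun x _ => ?_
            rw [Finset.sum_comm]
            exact Finset.sum_congr rfl fun z' _ => Finset.sum_comm
        _ = _ := by
            rw [Finset.sum_comm]
            exact Finset.sum_congr rfl fun z' _ => Finset.sum_comm
    simp only [h4]
    rw [h5]
    have h6 : ∀ z' z, ∑ x, ∑ y, (if (x, y, z') ∈ T then (if (x, y, z) ∈ T then (1 : ℂ) else 0)
        else 0) * S (z', i) (z, j) = (if z' = z then (q + 1 : ℂ) else 0) * S (z', i) (z, j) := by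
      intro z' z
      simp only [← hT.sum_pairs, Finset.sum_mul]
    simp only [h6]
    simp [partialTrace, Finset.mul_sum]
  rw [h2] at h1
  have h0 : (q + 1 : ℂ) ≠ 0 := by exact_mod_cast Nat.succ_ne_zero q
  exact (Submodule.smul_mem_iff _ h0).1 h1

lemma hsInner_partialTrace (k l : Word) (S : Matrix (F × (wordRep T l).ι) (F × (wordRep T k).ι) ℂ)
    (R : Matrix (wordRep T l).ι (wordRep T k).ι ℂ) :
    hsInner (partialTrace T k l S) R = hsInner S ((1 : Matrix F F ℂ) ⊗ₖ R) := by
  rw [hsInner_eq_sum, hsInner_eq_sum, Fintype.sum_prod_type, Finset.sum_comm]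
  simp only [Fintype.sum_prod_type]
  have h1 : ∀ a i, (∑ b, ∑ j, star (S (a, i) (b, j)) * ((1 : Matrix F F ℂ) ⊗ₖ R) (a, i) (b, j)) =
      ∑ j, star (S (a, i) (a, j)) * R i j := by
    intro a i
    rw [Finset.sum_eq_single a]
    · simp
    · intro b _ hb
      refine Finset.sum_eq_zero fun j _ => ?_
      simp [Ne.symm hb]
    · simp
  simp only [h1]
  have h2 : ∀ i j, star (partialTrace T k l S i j) * R i j =
      ∑ a, star (S (a, i) (a, j)) * R i j := by
    intro i j
    simp [partialTrace, Finset.sum_mul]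
  simp only [h2]
  rw [Finset.sum_comm, Finset.sum_comm (s := Finset.univ (α := F))]
  refine Finset.sum_congr rfl fun i _ => ?_
  rw [Finset.sum_comm]

/-- The partial trace and its adjoint R ↦ 1 ⊗ R preserve diagram spaces, so the partial trace
commutes with the projections; the formula is this fact on a matrix unit. In terms of coefficients
it says that left multiplication by the matrix u preserves the form given by the kernel. -/
lemma sum_projKernel_gen (hT : IsTrianglePresentation T q) (k l : Word) (i' : (wordRep T l).ι)
    (i : (wordRep T k).ι) (b' b : F) (j' : (wordRep T l).ι) (j : (wordRep T k).ι) :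
    ∑ a : F, projKernel (ι := fun a => (wordRep T a).ι) (diagramSpace T)
        (Word.gen.tensor k) (Word.gen.tensor l)
        ((a, i') : F × (wordRep T l).ι) ((a, i) : F × (wordRep T k).ι)
        ((b', j') : F × (wordRep T l).ι) ((b, j) : F × (wordRep T k).ι) =
      if b' = b then projKernel (ι := fun a => (wordRep T a).ι) (diagramSpace T) k l i' i j' j
        else 0 := by
  let E : Matrix (F × (wordRep T l).ι) (F × (wordRep T k).ι) ℂ := Matrix.single (b', j') (b, j) 1
  let D : Submodule ℂ (Matrix (F × (wordRep T l).ι) (F × (wordRep T k).ι) ℂ) :=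
    diagramSpace T (Word.gen.tensor k) (Word.gen.tensor l)
  have h := hsProj_comm (C := D) (C' := diagramSpace T k l) (partialTrace T k l)
    (fun R => (1 : Matrix F F ℂ) ⊗ₖ R) (hsInner_partialTrace k l) (partialTrace_mem hT k l)
    (fun R hR => kronecker_mem_diagramSpace (one_mem_diagramSpace .gen) hR) E
  have h1 : partialTrace T k l E = if b' = b then Matrix.single j' j 1 else 0 := by
    ext x y
    simp only [partialTrace, LinearMap.coe_mk, AddHom.coe_mk, Matrix.of_apply, E]
    rw [Finset.sum_eq_single b']
    · by_cases hb : b' = b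
      · subst hb
        simp [Matrix.single_apply]
      · rw [if_neg hb]
        simp only [Matrix.single_apply, Matrix.zero_apply]
        rw [if_neg]
        rintro ⟨_, h⟩
        exact hb (Prod.ext_iff.1 h).1.symm
    · intro a _ ha
      rw [Matrix.single_apply, if_neg]
      rintro ⟨h, _⟩
      exact ha (Prod.ext_iff.1 h).1.symm
    · simp
  have h2 := congrFun (congrFun h i') i
  refine Eq.trans h2.symm ?_
  rw [h1]
  split_ifs
  · rfl
  · rw [map_zero]
    rfl

end Vertices

end

section
-- The Hilbert space of a positive kernel.
/-- A positive semidefinite kernel. -/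
structure PosKernel (P : Type) where
  /-- the values -/
  val : P → P → ℂ
  star_val : ∀ p p', star (val p p') = val p' p
  nonneg : ∀ v : P →₀ ℂ, 0 ≤ v.sum fun p a => v.sum fun p' a' => star a * val p p' * a'

namespace PosKernel
variable {P : Type} (K : PosKernel P)

/-- The vector space that carries the semi-inner product of a kernel. -/
def PreSpace (_ : PosKernel P) : Type := P →₀ ℂ

instance : AddCommGroup K.PreSpace := inferInstanceAs (AddCommGroup (P →₀ ℂ))
instance : Module ℂ K.PreSpace := inferInstanceAs (Module ℂ (P →₀ ℂ))

/-- The sesquilinear form of a kernel. -/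
def form (v w : P →₀ ℂ) : ℂ := v.sum fun p a => w.sum fun p' a' => star a * K.val p p' * a'

lemma form_add_left (v v' w : P →₀ ℂ) : K.form (v + v') w = K.form v w + K.form v' w := by
  classical
  refine Finsupp.sum_add_index' (fun p => ?_) fun p a a' => ?_
  · simp
  · simp only [star_add, add_mul, Finsupp.sum_add]

lemma form_smul_left (c : ℂ) (v w : P →₀ ℂ) : K.form (c • v) w = star c * K.form v w := by
  rw [form, Finsupp.sum_smul_index' (fun p => by simp), form, Finsupp.mul_sum]
  refine Finsupp.sum_congr fun p _ => ?_
  rw [Finsupp.mul_sum]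
  refine Finsupp.sum_congr fun p' _ => ?_
  simp [mul_assoc]

lemma star_form (v w : P →₀ ℂ) : star (K.form v w) = K.form w v := by
  simp only [form, Finsupp.sum, star_sum, star_mul', star_star, K.star_val]
  rw [Finset.sum_comm]
  refine Finset.sum_congr rfl fun p _ => Finset.sum_congr rfl fun p' _ => ?_
  ring

lemma form_single (p p' : P) : K.form (Finsupp.single p 1) (Finsupp.single p' 1) = K.val p p' := by
  simp [form]

/-- The semi-inner product of a kernel. -/
abbrev core : PreInnerProductSpace.Core ℂ K.PreSpace where
  inner v w := K.form v w
  conj_inner_symm v w := K.star_form w v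
  re_inner_nonneg v := (RCLike.nonneg_iff.mp (K.nonneg v)).1
  add_left := K.form_add_left
  smul_left v w c := K.form_smul_left c v w

instance : SeminormedAddCommGroup K.PreSpace :=
  InnerProductSpace.Core.toSeminormedAddCommGroup (c := K.core)
instance : InnerProductSpace ℂ K.PreSpace := InnerProductSpace.ofCore K.core

/-- The Hilbert space of a kernel. -/
abbrev Space : Type := UniformSpace.Completion K.PreSpace

/-- The basis vectors, before completion. -/
def preVec (p : P) : K.PreSpace := (Finsupp.single p 1 : P →₀ ℂ)

/-- The vectors of the Hilbert space of a kernel that correspond to the points. -/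
def vec (p : P) : K.Space := (K.preVec p : K.PreSpace)

lemma inner_preVec (p p' : P) : inner ℂ (K.preVec p) (K.preVec p') = K.val p p' :=
  K.form_single p p'

lemma inner_vec (p p' : P) : inner ℂ (K.vec p) (K.vec p') = K.val p p' := by
  rw [vec, vec, UniformSpace.Completion.inner_coe, inner_preVec]

lemma pre_induction {motive : K.PreSpace → Prop} (v : K.PreSpace) (vec : ∀ p, motive (K.preVec p))
    (zero : motive 0) (add : ∀ v w, motive v → motive w → motive (v + w))
    (smul : ∀ (c : ℂ) v, motive v → motive (c • v)) : motive v := by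
  refine Finsupp.induction_linear (motive := motive) v zero (fun v w => add v w) fun p c => ?_
  have : (Finsupp.single p c : P →₀ ℂ) = c • Finsupp.single p 1 := by simp
  rw [this]
  exact smul c _ (vec p)

lemma eq_of_vec {E : Type*} [NormedAddCommGroup E] [NormedSpace ℂ E] {S S' : K.Space →L[ℂ] E}
    (h : ∀ p, S (K.vec p) = S' (K.vec p)) : S = S' := by
  ext v
  induction v using UniformSpace.Completion.induction_on with
  | hp => exact isClosed_eq S.continuous S'.continuous
  | ih v =>
    induction v using pre_induction with
    | vec p => exact h p
    | zero => exact (map_zero S).trans (map_zero S').symm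
    | add v w hv hw => simp [UniformSpace.Completion.coe_add, hv, hw]
    | smul c v hv => simp [UniformSpace.Completion.coe_smul, hv]

lemma eq_zero_of_inner_vec {v : K.Space} (h : ∀ p, inner ℂ (K.vec p) v = 0) : v = 0 := by
  have h1 : innerSL ℂ v = 0 := K.eq_of_vec fun p => by
    rw [innerSL_apply_apply, ← inner_conj_symm, h p]
    simp
  have h2 := congrArg (fun f => f v) h1
  simpa using h2

/-- The linear map induced by a map on the points, before completion. -/
def preMap (e : P → P) : K.PreSpace →ₗ[ℂ] K.PreSpace := Finsupp.lmapDomain ℂ ℂ e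

lemma preMap_preVec (e : P → P) (p : P) : K.preMap e (K.preVec p) = K.preVec (e p) :=
  Finsupp.mapDomain_single

/-- Both sides are sesquilinear in v and w, so the basis vectors suffice. -/
lemma sum_inner_preMap {κ : Type*} [Fintype κ] {e e' : κ → P → P} {c : ℂ}
    (h : ∀ p p', ∑ a, K.val (e a p) (e' a p') = c * K.val p p') (v w : K.PreSpace) :
    ∑ a, inner ℂ (K.preMap (e a) v) (K.preMap (e' a) w) = c * inner ℂ v w := by
  induction v using pre_induction with
  | vec p =>
    induction w using pre_induction with
    | vec p' => simpa only [preMap_preVec, inner_preVec] using h p p'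
    | zero => simp
    | add v w hv hw => simp only [map_add, inner_add_right, Finset.sum_add_distrib, hv, hw, mul_add]
    | smul c' v hv =>
      simp only [map_smul, inner_smul_right, ← Finset.mul_sum, hv]
      ring
  | zero => simp
  | add v w hv hw => simp only [map_add, inner_add_left, Finset.sum_add_distrib, hv, hw, mul_add]
  | smul c' v hv =>
    simp only [map_smul, inner_smul_left, ← Finset.mul_sum, hv]
    ring

lemma norm_preMap_le {κ : Type*} [Fintype κ] {e : κ → P → P}
    (h : ∀ p p', ∑ a, K.val (e a p) (e a p') = K.val p p') (a : κ) (v : K.PreSpace) :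
    ‖K.preMap (e a) v‖ ≤ 1 * ‖v‖ := by
  have h1 := K.sum_inner_preMap (c := 1) (fun p p' => (h p p').trans (one_mul _).symm) v v
  simp only [inner_self_eq_norm_sq_to_K, one_mul] at h1
  have h2 : ∑ a, ‖K.preMap (e a) v‖ ^ 2 = ‖v‖ ^ 2 := by
    have := h1
    simp only [Complex.coe_algebraMap] at this
    exact_mod_cast this
  -- Only the whole family is isometric; a single member is a contraction, being one term of the sum
  -- of squares.
  have h3 := Finset.single_le_sum (f := fun a => ‖K.preMap (e a) v‖ ^ 2)
    (fun a _ => by positivity) (Finset.mem_univ a)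
  rw [one_mul]
  exact le_of_sq_le_sq (h3.trans_eq h2) (norm_nonneg v)

/-- The operator induced by one of a finite family of maps on the points that is jointly isometric. -/
def shift {κ : Type*} [Fintype κ] {e : κ → P → P}
    (h : ∀ p p', ∑ a, K.val (e a p) (e a p') = K.val p p') (a : κ) : K.Space →L[ℂ] K.Space :=
  ((K.preMap (e a)).mkContinuous 1 (K.norm_preMap_le h a)).completion

lemma shift_coe {κ : Type*} [Fintype κ] {e : κ → P → P}
    (h : ∀ p p', ∑ a, K.val (e a p) (e a p') = K.val p p') (a : κ) (v : K.PreSpace) :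
    K.shift h a v = (K.preMap (e a) v : K.PreSpace) :=
  ContinuousLinearMap.completion_apply_coe _ _

lemma shift_vec {κ : Type*} [Fintype κ] {e : κ → P → P}
    (h : ∀ p p', ∑ a, K.val (e a p) (e a p') = K.val p p') (a : κ) (p : P) :
    K.shift h a (K.vec p) = K.vec (e a p) := by
  rw [vec, shift_coe, preMap_preVec, vec]

lemma sum_star_shift_mul_shift {κ : Type*} [Fintype κ] {e e' : κ → P → P} {c : ℂ}
    (h : ∀ p p', ∑ a, K.val (e a p) (e a p') = K.val p p')
    (h' : ∀ p p', ∑ a, K.val (e' a p) (e' a p') = K.val p p')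
    (hc : ∀ p p', ∑ a, K.val (e a p) (e' a p') = c * K.val p p') :
    ∑ a, star (K.shift h a) * K.shift h' a = c • 1 := by
  refine K.eq_of_vec fun p => ?_
  rw [← sub_eq_zero]
  refine K.eq_zero_of_inner_vec fun p' => ?_
  rw [inner_sub_right, sum_apply, inner_sum]
  simp only [mul_apply_eq_comp, ContinuousLinearMap.star_eq_adjoint,
    ContinuousLinearMap.adjoint_inner_right, shift_vec, inner_vec, hc]
  simp [inner_smul_right, inner_vec]

end PosKernel

/-! ### The regular representation of C(𝔾_T). -/

variable {F : Type} [Fintype F] [DecidableEq F] {T : Finset (F × F × F)} {q : ℕ}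

variable (T) in
/-- The kernel on the matrix coefficients of the tensor words. -/
def wordKernel : PosKernel (CoeffIndex fun a => (wordRep T a).ι) where
  val := coeffKernel (ι := fun a => (wordRep T a).ι) (diagramSpace T)
  star_val p p' := star_coeffKernel (C := diagramSpace T) (ι := fun a => (wordRep T a).ι)
    (fun a b _ hR => conjTranspose_mem_diagramSpace (a := a) (b := b) hR) p p'
  nonneg v := coeffKernel_nonneg (C := diagramSpace T) (ι := fun a => (wordRep T a).ι)
    (fun a b c _ hR _ hS => mul_mem_diagramSpace (a := a) (b := b) (c := c) hR hS)
    (fun a b _ hR => conjTranspose_mem_diagramSpace (a := a) (b := b) hR) v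

variable (T) in
/-- The vector of a matrix coefficient of a tensor word. -/
def coeffVec (b : Word) (i j : (wordRep T b).ι) : (wordKernel T).Space :=
  (wordKernel T).vec ⟨b, i, j⟩

lemma inner_coeffVec (d b : Word) (x y : (wordRep T d).ι) (i j : (wordRep T b).ι) :
    inner ℂ (coeffVec T d x y) (coeffVec T b i j) =
      projKernel (ι := fun a => (wordRep T a).ι) (diagramSpace T) d b i x j y :=
  (wordKernel T).inner_vec _ _

/-- Naturality of matrix coefficients with respect to intertwiners. -/
lemma sum_coeffVec {a b : Word} {R : Matrix (wordRep T b).ι (wordRep T a).ι ℂ}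
    (hR : R ∈ diagramSpace T a b) (i : (wordRep T b).ι) (k : (wordRep T a).ι) :
    ∑ j, R j k • coeffVec T b i j = ∑ j, R i j • coeffVec T a j k := by
  rw [← sub_eq_zero]
  refine (wordKernel T).eq_zero_of_inner_vec ?_
  rintro ⟨d, x, y⟩
  change inner ℂ (coeffVec T d x y) _ = 0
  rw [inner_sub_right, inner_sum, inner_sum, sub_eq_zero]
  simp only [inner_smul_right, inner_coeffVec]
  refine Eq.trans (Finset.sum_congr rfl fun _ _ => mul_comm _ _)
    (projKernel_mul_left (C := diagramSpace T) (ι := fun a => (wordRep T a).ι)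
      (fun _ _ _ _ hR _ hS => mul_mem_diagramSpace hR hS)
      (fun _ _ _ => conjTranspose_mem_diagramSpace) hR i x k y)

variable (T) in
/-- Left multiplication by a coefficient of the fundamental representation. -/
def genShift (b a : F) (p : CoeffIndex fun a => (wordRep T a).ι) :
    CoeffIndex fun a => (wordRep T a).ι :=
  ⟨Word.gen.tensor p.1, ((a, p.2.1) : F × (wordRep T p.1).ι), ((b, p.2.2) : F × (wordRep T p.1).ι)⟩

/-- The relation u^* u = 1, tested on the vectors of coefficients. -/
lemma sum_genShift (hT : IsTrianglePresentation T q) (b b' : F)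
    (p p' : CoeffIndex fun a => (wordRep T a).ι) :
    ∑ a, (wordKernel T).val (genShift T b a p) (genShift T b' a p') =
      (if b = b' then 1 else 0) * (wordKernel T).val p p' := by
  refine (sum_projKernel_gen hT p.1 p'.1 p'.2.1 p.2.1 b' b p'.2.2 p.2.2).trans ?_
  by_cases h : b = b'
  · subst h
    simp [wordKernel, coeffKernel]
  · simp [h, Ne.symm h]

lemma sum_genShift_self (hT : IsTrianglePresentation T q) (b : F)
    (p p' : CoeffIndex fun a => (wordRep T a).ι) :
    ∑ a, (wordKernel T).val (genShift T b a p) (genShift T b a p') = (wordKernel T).val p p' := by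
  simp [sum_genShift hT]

/-- The operators that represent the generators. -/
def genMatrix (hT : IsTrianglePresentation T q) :
    Matrix F F ((wordKernel T).Space →L[ℂ] (wordKernel T).Space) :=
  Matrix.of fun a b => (wordKernel T).shift (sum_genShift_self hT b) a

lemma genMatrix_coeffVec (hT : IsTrianglePresentation T q) (a b : F) (k : Word)
    (x y : (wordRep T k).ι) : genMatrix hT a b (coeffVec T k x y) =
      coeffVec T (Word.gen.tensor k) ((a, x) : F × (wordRep T k).ι)
        ((b, y) : F × (wordRep T k).ι) :=
  (wordKernel T).shift_vec (sum_genShift_self hT b) _ _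

lemma star_genMatrix_mul (hT : IsTrianglePresentation T q) :
    star (genMatrix hT) * genMatrix hT = 1 := by
  ext1 b b'
  rw [Matrix.mul_apply]
  refine ((wordKernel T).sum_star_shift_mul_shift (sum_genShift_self hT b)
    (sum_genShift_self hT b') (sum_genShift hT b b')).trans ?_
  by_cases h : b = b' <;> simp [Matrix.one_apply, h]

/-- The triangle relation says that the vertex is an intertwiner. On the vector of a coefficient of
d it is the naturality `sum_coeffVec` for the diagram that adds a vertex in front of d. -/
lemma sum_genMatrix (hT : IsTrianglePresentation T q) (i j k : F) :
    ∑ t ∈ T, genMatrix hT i t.1 * genMatrix hT j t.2.1 * genMatrix hT k t.2.2 =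
      if (i, j, k) ∈ T then 1 else 0 := by
  refine (wordKernel T).eq_of_vec ?_
  rintro ⟨d, x, y⟩
  let R : Matrix (F × (F × (F × (wordRep T d).ι))) (wordRep T d).ι ℂ := vertexMat T d
  let V : (F × (F × (F × (wordRep T d).ι))) → (F × (F × (F × (wordRep T d).ι))) →
      (wordKernel T).Space := coeffVec T (Word.gen.tensor (Word.gen.tensor (Word.gen.tensor d)))
  have h : ∑ p, R p y • V (i, j, k, x) p = ∑ x', R (i, j, k, x) x' • coeffVec T d x' y :=
    sum_coeffVec (vertexMat_mem T d) _ _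
  have h1 : ∑ p, R p y • V (i, j, k, x) p = (∑ t ∈ T, genMatrix hT i t.1 * genMatrix hT j t.2.1 *
      genMatrix hT k t.2.2) (coeffVec T d x y) := by
    rw [sum_apply]
    simp only [mul_apply_eq_comp]
    calc ∑ p, R p y • V (i, j, k, x) p
        = ∑ t : F × F × F, if t ∈ T then V (i, j, k, x) (t.1, t.2.1, t.2.2, y) else 0 := by
          simp only [Fintype.sum_prod_type]
          refine Finset.sum_congr rfl fun a _ => Finset.sum_congr rfl fun b _ =>
            Finset.sum_congr rfl fun c _ => ?_
          rw [Finset.sum_eq_single y]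
          · simp only [R, vertexMat, Matrix.of_apply, Matrix.one_apply_eq]
            split_ifs <;> simp
          · intro y' _ hy
            simp [R, vertexMat, hy]
          · simp
      _ = _ := by
          rw [Finset.sum_ite_mem, Finset.univ_inter]
          refine Finset.sum_congr rfl fun t _ => ?_
          rw [genMatrix_coeffVec]
          exact ((congrArg (genMatrix hT i t.1) (genMatrix_coeffVec hT j t.2.1 (Word.gen.tensor d)
            ((k, x) : F × (wordRep T d).ι) ((t.2.2, y) : F × (wordRep T d).ι))).trans
            (genMatrix_coeffVec hT i t.1 (Word.gen.tensor (Word.gen.tensor d))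
            ((j, k, x) : F × F × (wordRep T d).ι)
            ((t.2.1, t.2.2, y) : F × F × (wordRep T d).ι))).symm
  have h2 : ∑ x', R (i, j, k, x) x' • coeffVec T d x' y =
      (if (i, j, k) ∈ T then (1 : (wordKernel T).Space →L[ℂ] _) else 0) (coeffVec T d x y) := by
    rw [Finset.sum_eq_single x]
    · simp only [R, vertexMat, Matrix.of_apply, Matrix.one_apply_eq]
      split_ifs <;> simp
    · intro x' _ hx
      simp [R, vertexMat, Ne.symm hx]
    · simp
  exact (h1.symm.trans (h.trans h2) :)

/-- In a triangle presentation, the adjoint of a matrix `u` with the triangle relations is given by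
sums of products of two entries. -/
lemma IsTrianglePresentation.matrix_mul_eq_one {B : Type*} [Ring B]
    (hT : IsTrianglePresentation T q) {u : Matrix F F B}
    (hu : ∀ i j k, ∑ t ∈ T, u i t.1 * u j t.2.1 * u k t.2.2 = if (i, j, k) ∈ T then 1 else 0)
    {r s : F → F} (hrs : ∀ i, (i, r i, s i) ∈ T) :
    u * Matrix.of (fun a i => ∑ b, ∑ c, if (a, b, c) ∈ T then u (r i) b * u (s i) c else 0) = 1 := by
  ext1 i i'
  -- By cyclicity the last two entries of a triple determine the first, so fixing j = r i' and k = s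
  -- i' turns the triangle relation into a Kronecker delta.
  have h : (i, r i', s i') ∈ T ↔ i = i' := by
    constructor
    · intro h
      exact hT.unique _ _ _ _ (hT.cyclic _ _ _ (hT.cyclic _ _ _ h))
        (hT.cyclic _ _ _ (hT.cyclic _ _ _ (hrs i')))
    · rintro rfl
      exact hrs i
  rw [Matrix.mul_apply]
  have h2 := hu i (r i') (s i')
  rw [if_congr h rfl rfl, ← Finset.univ_inter T, ← Finset.sum_ite_mem] at h2
  simp only [Fintype.sum_prod_type] at h2
  rw [Matrix.one_apply, ← h2]
  refine Finset.sum_congr rfl fun a _ => ?_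
  simp only [Matrix.of_apply, Finset.mul_sum]
  refine Finset.sum_congr rfl fun b _ => Finset.sum_congr rfl fun c _ => ?_
  split_ifs <;> simp [mul_assoc]

lemma IsTrianglePresentation.exists_choice (hT : IsTrianglePresentation T q) :
    ∃ r s : F → F, ∀ i, (i, r i, s i) ∈ T := by
  have : ∀ i, ∃ j k, (i, j, k) ∈ T := fun i => by
    obtain ⟨j, k, h⟩ := hT.exists_triple i
    exact ⟨j, k, hT.cyclic _ _ _ h⟩
  choose r s h using this
  exact ⟨r, s, h⟩

/-- The form gives the left inverse u^*, and the triangle relations give a right inverse whose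
entries are sums of products of two generators. The two inverses coincide, so u is unitary and not
just an isometry. -/
lemma isTriangleUnitary_genMatrix (hT : IsTrianglePresentation T q) :
    IsTriangleUnitary T (genMatrix hT) where
  unitary := by
    obtain ⟨r, s, hrs⟩ := hT.exists_choice
    have h := hT.matrix_mul_eq_one (sum_genMatrix hT) hrs
    rw [Unitary.mem_iff]
    refine ⟨star_genMatrix_mul hT, ?_⟩
    rwa [left_inv_eq_right_inv (star_genMatrix_mul hT) h]
  rel := sum_genMatrix hT

/-- The representation of `C(𝔾_T)` on the Hilbert space of matrix coefficients. -/
def regularRep (hT : IsTrianglePresentation T q) :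
    CGT T →⋆ₐ[ℂ] ((wordKernel T).Space →L[ℂ] (wordKernel T).Space) :=
  CGT.lift (genMatrix hT) (isTriangleUnitary_genMatrix hT)

lemma permMat_eq_ite {ι κ : Type} [DecidableEq ι] [DecidableEq κ] (e : ι ≃ κ) (y : κ) (x : ι) :
    Rep.permMat e y x = if x = e.symm y then 1 else 0 := by
  simp only [Rep.permMat, Matrix.of_apply, Equiv.eq_symm_apply, eq_comm]

/-- Naturality for an associator or unitor: coefficients of words differing only in brackets or
units give the same vector. -/
lemma coeffVec_perm {a b : Word} (e : (wordRep T a).ι ≃ (wordRep T b).ι)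
    (he : Rep.permMat e ∈ diagramSpace T a b) (i k : (wordRep T a).ι) :
    coeffVec T b (e i) (e k) = coeffVec T a i k := by
  have h := sum_coeffVec he (e i) k
  rw [Finset.sum_eq_single (e k), Finset.sum_eq_single i] at h
  · simpa [Rep.permMat] using h
  · intro j _ hj
    simp [permMat_eq_ite, hj]
  · simp
  · intro j _ hj
    simp [Rep.permMat, hj]
  · simp

/-- The representation is left multiplication of coefficients. For a tensor product, apply the two
factors in turn and rebracket. -/
lemma regularRep_coeffVec (hT : IsTrianglePresentation T q) (a b : Word) (i j : (wordRep T a).ι)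
    (x y : (wordRep T b).ι) : regularRep hT ((wordRep T a).mat i j) (coeffVec T b x y) =
      coeffVec T (a.tensor b) ((i, x) : (wordRep T a).ι × (wordRep T b).ι)
        ((j, y) : (wordRep T a).ι × (wordRep T b).ι) := by
  induction a generalizing b with
  | unit =>
    obtain ⟨⟩ : Unit := i
    obtain ⟨⟩ : Unit := j
    have h : (wordRep T .unit).mat () () = 1 := Matrix.one_apply_eq (α := CGT T) ()
    have h2 := coeffVec_perm (T := T) (a := Word.unit.tensor b) (b := b)
      (Equiv.punitProd (wordRep T b).ι) ⟨.leftUnitor b, rfl⟩ ((), x) ((), y)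
    refine (congrArg (fun z => regularRep hT z (coeffVec T b x y)) h).trans ?_
    simp only [map_one]
    exact h2
  | gen =>
    have h : regularRep hT ((wordRep T .gen).mat i j) = genMatrix hT i j :=
      CGT.lift_fundMatrix _ _ _
    rw [h]
    exact genMatrix_coeffVec hT _ _ _ _ _
  | tensor a a' ih ih' =>
    obtain ⟨(i : (wordRep T a).ι), (i' : (wordRep T a').ι)⟩ := i
    obtain ⟨(j : (wordRep T a).ι), (j' : (wordRep T a').ι)⟩ := j
    have h : (wordRep T (a.tensor a')).mat (i, i') (j, j') =
      (wordRep T a).mat i j * (wordRep T a').mat i' j' := rfl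
    have h2 := coeffVec_perm (T := T) (a := (a.tensor a').tensor b) (b := a.tensor (a'.tensor b))
      (Equiv.prodAssoc (wordRep T a).ι (wordRep T a').ι (wordRep T b).ι) ⟨.assoc a a' b, rfl⟩
      ((i, i'), x) ((j, j'), y)
    refine (congrArg (fun z => regularRep hT z (coeffVec T b x y)) h).trans ?_
    rw [map_mul, mul_apply_eq_comp, ih']
    exact (ih (a'.tensor b) i j ((i', x) : (wordRep T a').ι × (wordRep T b).ι)
      ((j', y) : (wordRep T a').ι × (wordRep T b).ι)).trans h2

variable (T) in
/-- The vector of the coefficient of the trivial representation. -/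
def vacuumVec : (wordKernel T).Space := coeffVec T .unit () ()

lemma regularRep_vacuumVec (hT : IsTrianglePresentation T q) (a : Word) (i j : (wordRep T a).ι) :
    regularRep hT ((wordRep T a).mat i j) (vacuumVec T) = coeffVec T a i j := by
  refine (regularRep_coeffVec hT a .unit i j () ()).trans ?_
  exact (coeffVec_perm (T := T) (a := a.tensor .unit) (b := a)
    (Equiv.prodPUnit (wordRep T a).ι) ⟨.rightUnitor a, rfl⟩ (i, ()) (j, ())).symm

lemma norm_vacuumVec : ‖vacuumVec T‖ = 1 := by
  have h : inner ℂ (vacuumVec T) (vacuumVec T) = 1 := by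
    refine (inner_coeffVec .unit .unit () () () ()).trans ?_
    have h1 : (Matrix.single () () 1 : Matrix Unit Unit ℂ) = 1 := by
      ext i j
      simp
    have h2 : hsProj (diagramSpace T .unit .unit) (Matrix.single () () 1 : Matrix Unit Unit ℂ) =
        (1 : Matrix Unit Unit ℂ) := by
      rw [h1]
      exact hsProj_of_mem (one_mem_diagramSpace .unit)
    exact congrFun (congrFun h2 ()) ()
  rw [inner_self_eq_norm_sq_to_K] at h
  simp only [Complex.coe_algebraMap] at h
  have h' : ‖vacuumVec T‖ ^ 2 = 1 := by exact_mod_cast h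
  nlinarith [norm_nonneg (vacuumVec T)]

end

section
-- States separate points; product functionals on the minimal tensor product.
section States
attribute [local instance] CStarAlgebra.spectralOrder CStarAlgebra.spectralOrderedRing
variable {A B : Type*} [CStarAlgebra A] [CStarAlgebra B]

/-- The linear functional of a state. -/
def State.fn (f : State A) : A →L[ℂ] ℂ :=
  ⟨f.1.toLinearMap, by
    obtain ⟨C, hC⟩ := f.1.exists_norm_apply_le
    exact AddMonoidHomClass.continuous_of_bound f.1.toLinearMap C hC⟩

lemma State.fn_one (f : State A) : f.fn 1 = 1 := f.2

lemma State.fn_star (f : State A) (a : A) : f.fn (star a) = star (f.fn a) :=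
  map_star f.1 a

/-- The state given by a positive functional. -/
def State.mk' (f : A →ₗ[ℂ] ℂ) (hf : ∀ a, 0 ≤ f (star a * a)) (h1 : f 1 = 1) : State A :=
  ⟨PositiveLinearMap.mk₀ f fun a ha => by
    obtain ⟨b, rfl⟩ := CStarAlgebra.nonneg_iff_eq_star_mul_self.1 ha
    exact hf b, h1⟩

/-- Hahn-Banach: a real functional separates a from the closed cone of positive elements, and it is
then symmetrized, complexified and normalized. -/
lemma exists_state_of_not_nonneg {a : A} (ha : IsSelfAdjoint a) (h : ¬ 0 ≤ a) :
    ∃ f : State A, f.fn a ≠ 0 := by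
  let C : ProperCone ℝ A :=
    { carrier := {b | 0 ≤ b}
      add_mem' := fun {a b} (h : 0 ≤ a) (h' : 0 ≤ b) => (add_nonneg h h' : 0 ≤ a + b)
      zero_mem' := (le_rfl : (0 : A) ≤ 0)
      smul_mem' := fun c b (hb : 0 ≤ b) => (smul_nonneg c.2 hb : 0 ≤ (c : ℝ) • b)
      isClosed' := CStarAlgebra.isClosed_nonneg }
  obtain ⟨φ, hφ', hφa⟩ := ProperCone.hyperplane_separation_point C (x₀ := a) h
  have hφ : ∀ b : A, 0 ≤ b → 0 ≤ φ b := hφ'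
  -- Averaging over the involution makes the functional vanish on skew-adjoint elements, so its
  -- complexification still equals φ on self-adjoint ones.
  let ψ : Module.Dual ℝ A :=
    { toFun := fun b => (φ b + φ (star b)) / 2
      map_add' := fun b c => by simp only [map_add, star_add]; ring
      map_smul' := fun c b => by
        simp only [map_smul, star_smul, star_trivial, smul_eq_mul, RingHom.id_apply]; ring }
  let g : Module.Dual ℂ A := ψ.extendRCLike
  have hg : ∀ b, IsSelfAdjoint b → g b = φ b := by
    intro b hb
    have h1 : ψ b = φ b := by
      change (φ b + φ (star b)) / 2 = _
      rw [hb.star_eq]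
      ring
    have h2 : ψ (Complex.I • b) = 0 := by
      change (φ (Complex.I • b) + φ (star (Complex.I • b))) / 2 = _
      rw [star_smul, hb.star_eq]
      simp
    refine (Module.Dual.extendRCLike_apply ψ b).trans ?_
    have h3 : ψ ((RCLike.I : ℂ) • b) = 0 := h2
    rw [h1, h3]
    simp
  have hpos : ∀ b, 0 ≤ g (star b * b) := by
    intro b
    rw [hg _ (IsSelfAdjoint.star_mul_self b)]
    exact_mod_cast hφ _ (star_mul_self_nonneg b)
  -- If φ 1 = 0, then -‖a‖ ≤ a ≤ ‖a‖ would force φ a = 0.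
  have h1 : 0 < φ 1 := by
    refine lt_of_le_of_ne (hφ 1 zero_le_one) fun h0 => hφa.ne ?_
    have hn : ∀ r : ℝ, φ (algebraMap ℝ A r) = 0 := fun r => by
      rw [Algebra.algebraMap_eq_smul_one, map_smul, ← h0, smul_zero]
    have h2 := hφ _ (sub_nonneg.2 ha.le_algebraMap_norm_self)
    have h3 := hφ _ (sub_nonneg.2 ha.neg_algebraMap_norm_le_self)
    rw [map_sub, hn] at h2
    rw [map_sub, map_neg, hn] at h3
    linarith
  have hg1 : g 1 = (φ 1 : ℂ) := hg 1 (IsSelfAdjoint.one A)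
  have h1c : (φ 1 : ℂ) ≠ 0 := by exact_mod_cast h1.ne'
  refine ⟨State.mk' ((φ 1 : ℂ)⁻¹ • g) (fun b => ?_) ?_, ?_⟩
  · exact mul_nonneg (by rw [← Complex.ofReal_inv]; exact_mod_cast (inv_pos.2 h1).le) (hpos b)
  · change (φ 1 : ℂ)⁻¹ * g 1 = 1
    rw [hg1, inv_mul_cancel₀ h1c]
  · change (φ 1 : ℂ)⁻¹ * g a ≠ 0
    rw [hg a ha]
    exact mul_ne_zero (inv_ne_zero h1c) (by exact_mod_cast hφa.ne)

/-- States separate points. -/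
lemma eq_zero_of_states {a : A} (h : ∀ f : State A, f.fn a = 0) : a = 0 := by
  have key : ∀ b : A, IsSelfAdjoint b → (∀ f : State A, f.fn b = 0) → b = 0 := by
    intro b hb hf
    refine le_antisymm ?_ ?_
    · by_contra hn
      obtain ⟨f, hfb⟩ := exists_state_of_not_nonneg hb.neg fun h => hn (neg_nonneg.1 h)
      exact hfb (by rw [map_neg, hf, neg_zero])
    · by_contra hn
      obtain ⟨f, hfb⟩ := exists_state_of_not_nonneg hb hn
      exact hfb (hf f)
  -- The real and imaginary parts of a are treated separately.
  have h1 : a + star a = 0 := key _ (IsSelfAdjoint.add_star_self a) fun f => by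
    rw [map_add, f.fn_star, h f]
    simp
  have h2 : Complex.I • (a - star a) = 0 := by
    refine key _ ?_ fun f => ?_
    · rw [isSelfAdjoint_iff, star_smul, star_sub, star_star, Complex.star_def, Complex.conj_I,
        neg_smul, ← smul_neg, neg_sub]
    · rw [map_smul, map_sub, f.fn_star, h f]
      simp
  have h3 : a - star a = 0 := (smul_eq_zero.1 h2).resolve_left Complex.I_ne_zero
  have h4 : (2 : ℂ) • a = 0 := by
    rw [two_smul]
    calc a + a = (a + star a) + (a - star a) := by abel
      _ = 0 := by rw [h1, h3, add_zero]
  exact (smul_eq_zero.1 h4).resolve_left two_ne_zero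

lemma mtmul_mul (a a' : A) (b b' : B) : mtmul a b * mtmul a' b' = mtmul (a * a') (b * b') := by
  have h := inclRight_mul_inclLeft a' b
  rw [mtmul] at h
  rw [mtmul, mtmul, mtmul, map_mul, map_mul]
  calc _ = inclLeft A B a * (inclRight A B b * inclLeft A B a') * inclRight A B b' := by
        simp only [mul_assoc]
    _ = _ := by rw [h]; simp only [mul_assoc]

lemma star_mtmul (a : A) (b : B) : star (mtmul a b) = mtmul (star a) (star b) := by
  rw [← inclRight_mul_inclLeft, mtmul, star_mul, map_star, map_star]

lemma State.inner_vec_rep (f : State A) (a : A) : inner ℂ f.vec (f.rep a f.vec) = f.fn a := by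
  have h : f.rep a f.vec = ((f.1.toPreGNS a : f.1.PreGNS) : f.1.GNS) := by
    refine (PositiveLinearMap.gnsNonUnitalStarAlgHom_apply_coe (f := f.1)).trans ?_
    rw [PositiveLinearMap.leftMulMapPreGNS_apply]
    simp
  rw [h, State.vec, UniformSpace.Completion.inner_coe, PositiveLinearMap.preGNS_inner_def]
  simp
  rfl

/-- The cyclic vector of a pair of states. -/
def pairVec (p : State A × State B) : HilbertTensor p.1.Space p.2.Space :=
  ((p.1.vec ⊗ₜ[ℂ] p.2.vec : p.1.Space ⊗[ℂ] p.2.Space) : HilbertTensor p.1.Space p.2.Space)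

/-- A component of a bounded family. -/
def BoundedProduct.eval {I : Type*} {B : I → Type*} [∀ i, Nontrivial (B i)]
    [∀ i, CStarAlgebra (B i)] (i : I) : BoundedProduct B →ₗ[ℂ] B i where
  toFun x := x i
  map_add' _ _ := rfl
  map_smul' _ _ := rfl

lemma BoundedProduct.norm_eval_le {I : Type*} {B : I → Type*} [∀ i, Nontrivial (B i)]
    [∀ i, CStarAlgebra (B i)] (i : I) (x : BoundedProduct B) : ‖BoundedProduct.eval i x‖ ≤ ‖x‖ :=
  lp.norm_apply_le_norm (p := ∞) (by simp) x i

variable (A B) in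
/-- The bounded family given by an element of the minimal tensor product. -/
def MinTensor.incl : MinTensor A B →ₗ[ℂ] MinTensorAmbient A B where
  toFun z := z.1
  map_add' _ _ := rfl
  map_smul' _ _ := rfl

lemma MinTensor.norm_incl (z : MinTensor A B) : ‖MinTensor.incl A B z‖ = ‖z‖ := rfl

lemma MinTensor.incl_mtmul (a : A) (b : B) (p : State A × State B) :
    BoundedProduct.eval p (MinTensor.incl A B (mtmul a b)) = tensorOp (p.1.rep a) (p.2.rep b) :=
  leftOp_mul_rightOp (p.1.rep a) (p.2.rep b)

/-- The vector functional on operators. -/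
def vecFn {H : Type*} [NormedAddCommGroup H] [InnerProductSpace ℂ H] (v : H) :
    (H →L[ℂ] H) →L[ℂ] ℂ :=
  (innerSL ℂ v).comp (ContinuousLinearMap.apply ℂ H v)

/-- The product functional of a pair of states on the minimal tensor product. -/
def pairFn (p : State A × State B) : MinTensor A B →L[ℂ] ℂ :=
  LinearMap.mkContinuous
    ((vecFn (pairVec p)).toLinearMap ∘ₗ BoundedProduct.eval p ∘ₗ MinTensor.incl A B)
    ‖vecFn (pairVec p)‖ fun z => by
      refine ((vecFn (pairVec p)).le_opNorm _).trans ?_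
      refine mul_le_mul_of_nonneg_left ?_ (norm_nonneg _)
      exact (BoundedProduct.norm_eval_le p _).trans_eq (MinTensor.norm_incl z)

lemma pairFn_mtmul (p : State A × State B) (a : A) (b : B) :
    pairFn p (mtmul a b) = p.1.fn a * p.2.fn b := by
  have h : pairFn p (mtmul a b) =
      vecFn (pairVec p) (BoundedProduct.eval p (MinTensor.incl A B (mtmul a b))) := rfl
  rw [h, MinTensor.incl_mtmul]
  have h2 : vecFn (pairVec p) (tensorOp (p.1.rep a) (p.2.rep b)) =
      inner ℂ (pairVec p) (tensorOp (p.1.rep a) (p.2.rep b) (pairVec p)) := rfl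
  rw [h2, pairVec, tensorOp_coe, UniformSpace.Completion.inner_coe]
  simp [State.inner_vec_rep]

end States

end

section
-- The Haar state, and fullness of the diagrams.
variable {F : Type} [Fintype F] [DecidableEq F] {T : Finset (F × F × F)} {q : ℕ}

/-- The Haar state. -/
def haar (hT : IsTrianglePresentation T q) : State (CGT T) :=
  State.mk' ((vecFn (vacuumVec T)).toLinearMap ∘ₗ (regularRep hT).toAlgHom.toLinearMap)
    (fun a => by
      change 0 ≤ inner ℂ (vacuumVec T) (regularRep hT (star a * a) (vacuumVec T))
      rw [map_mul, map_star, mul_apply_eq_comp, ContinuousLinearMap.star_eq_adjoint,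
        ContinuousLinearMap.adjoint_inner_right]
      rw [inner_self_eq_norm_sq_to_K]
      simp)
    (by
      change inner ℂ (vacuumVec T) (regularRep hT 1 (vacuumVec T)) = 1
      rw [map_one, one_apply_eq_self, inner_self_eq_norm_sq_to_K, norm_vacuumVec]
      simp)

lemma haar_apply (hT : IsTrianglePresentation T q) (a : CGT T) :
    (haar hT).fn a = inner ℂ (vacuumVec T) (regularRep hT a (vacuumVec T)) := rfl

/-- The orthogonality relations hold by construction: applied to the vacuum, coefficients give
exactly the vectors whose inner products were prescribed. -/
lemma haar_star_mul (hT : IsTrianglePresentation T q) (d b : Word) (x y : (wordRep T d).ι)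
    (i j : (wordRep T b).ι) :
    (haar hT).fn (star ((wordRep T d).mat x y) * (wordRep T b).mat i j) =
      projKernel (ι := fun a => (wordRep T a).ι) (diagramSpace T) d b i x j y := by
  rw [haar_apply, map_mul, map_star, mul_apply_eq_comp, ContinuousLinearMap.star_eq_adjoint,
    ContinuousLinearMap.adjoint_inner_right, regularRep_vacuumVec, regularRep_vacuumVec,
    inner_coeffVec]

lemma haar_coeff (hT : IsTrianglePresentation T q) (b : Word) (i j : (wordRep T b).ι) :
    (haar hT).fn ((wordRep T b).mat i j) =
      projKernel (ι := fun a => (wordRep T a).ι) (diagramSpace T) .unit b i () j () := by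
  have h : (wordRep T .unit).mat () () = 1 := Matrix.one_apply_eq (α := CGT T) ()
  have h2 := haar_star_mul hT .unit b () () i j
  rwa [show star ((wordRep T .unit).mat () ()) = 1 from (congrArg star h).trans (star_one _),
    one_mul] at h2

lemma exists_hom_of_mem {a b : Word} {R : Matrix (wordRep T b).ι (wordRep T a).ι ℂ}
    (hR : R ∈ diagramSpace T a b) : ∃ d : Diagram a b, (d.hom T).mat = R := hR

/-- Coefficients are natural with respect to intertwiners. -/
lemma sum_coeff {a b : Word} {R : Matrix (wordRep T b).ι (wordRep T a).ι ℂ}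
    (hR : R ∈ diagramSpace T a b) (i : (wordRep T b).ι) (j : (wordRep T a).ι) :
    ∑ k, R k j • (wordRep T b).mat i k = ∑ k, R i k • (wordRep T a).mat k j := by
  obtain ⟨d, rfl⟩ := exists_hom_of_mem hR
  exact (Rep.intertwine_iff _).1 (d.hom T).comm i j

/-- Invariance of the Haar state on coefficients. -/
lemma sum_haar_smul (hT : IsTrianglePresentation T q) (b : Word) (i j : (wordRep T b).ι) :
    ∑ k, (haar hT).fn ((wordRep T b).mat i k) • (wordRep T b).mat k j =
      (haar hT).fn ((wordRep T b).mat i j) • 1 := by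
  -- The row of Haar values at i is the adjoint of a projected matrix unit, hence an intertwiner
  -- from b to the trivial representation. Its intertwining property is the invariance.
  let R : Matrix (wordRep T b).ι (wordRep T .unit).ι ℂ :=
    hsProj (diagramSpace T .unit b) (Matrix.single i () 1)
  have hR : R.conjTranspose ∈ diagramSpace T b .unit := conjTranspose_mem_diagramSpace (hsProj_mem _)
  have h1 : ∀ k, (haar hT).fn ((wordRep T b).mat i k) = R.conjTranspose () k := by
    intro k
    rw [haar_coeff]
    exact (star_projKernel (ι := fun a => (wordRep T a).ι) (C := diagramSpace T) .unit b k () i ()).symm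
  simp only [h1]
  refine (sum_coeff hR () j).symm.trans ?_
  have h2 : (wordRep T .unit).mat () () = 1 := Matrix.one_apply_eq (α := CGT T) ()
  exact (Fintype.sum_unique (ι := Unit) (fun k => R.conjTranspose k j • (wordRep T .unit).mat () k)).trans
    (congrArg (R.conjTranspose () j • ·) h2)

variable (T) in
/-- The span of the coefficients of the tensor words. -/
def coeffSpan : Submodule ℂ (CGT T) :=
  Submodule.span ℂ {z | ∃ (a : Word) (i j : (wordRep T a).ι), (wordRep T a).mat i j = z}

lemma coeff_mem_coeffSpan (a : Word) (i j : (wordRep T a).ι) :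
    (wordRep T a).mat i j ∈ coeffSpan T := Submodule.subset_span ⟨a, i, j, rfl⟩

lemma mul_mem_coeffSpan {x y : CGT T} (hx : x ∈ coeffSpan T) (hy : y ∈ coeffSpan T) :
    x * y ∈ coeffSpan T := by
  induction hx using Submodule.span_induction with
  | mem x hx =>
    obtain ⟨a, i, j, rfl⟩ := hx
    induction hy using Submodule.span_induction with
    | mem y hy =>
      obtain ⟨b, k, l, rfl⟩ := hy
      exact coeff_mem_coeffSpan (a.tensor b) ((i, k) : (wordRep T a).ι × (wordRep T b).ι)
        ((j, l) : (wordRep T a).ι × (wordRep T b).ι)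
    | zero => rw [mul_zero]; exact zero_mem _
    | add x y _ _ hx hy => rw [mul_add]; exact add_mem hx hy
    | smul c x _ hx => rw [mul_smul_comm]; exact Submodule.smul_mem _ _ hx
  | zero => rw [zero_mul]; exact zero_mem _
  | add x y _ _ hx hy => rw [add_mul]; exact add_mem hx hy
  | smul c x _ hx => rw [smul_mul_assoc]; exact Submodule.smul_mem _ _ hx

lemma one_mem_coeffSpan : (1 : CGT T) ∈ coeffSpan T := by
  have h : (wordRep T .unit).mat () () = 1 := Matrix.one_apply_eq (α := CGT T) ()
  rw [← h]
  exact coeff_mem_coeffSpan _ _ _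

lemma fundMatrix_mem_coeffSpan (i j : F) : fundMatrix T i j ∈ coeffSpan T :=
  coeff_mem_coeffSpan .gen i j

/-- The adjoint of u is its inverse, and the triangle relations write the inverse through products
of two generators. So the conjugate of u does not need words of its own. -/
lemma star_fundMatrix_mem_coeffSpan (hT : IsTrianglePresentation T q) (i j : F) :
    star (fundMatrix T i j) ∈ coeffSpan T := by
  obtain ⟨r, s, hrs⟩ := hT.exists_choice
  have h := hT.matrix_mul_eq_one (fundMatrix_isTriangleUnitary T).rel hrs
  have h2 := left_inv_eq_right_inv
    (Unitary.mem_iff.1 (fundMatrix_isTriangleUnitary T).unitary).1 h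
  have h3 := congrFun (congrFun h2 j) i
  rw [Matrix.star_apply] at h3
  rw [h3]
  refine Submodule.sum_mem _ fun b _ => Submodule.sum_mem _ fun c _ => ?_
  split_ifs
  · exact mul_mem_coeffSpan (fundMatrix_mem_coeffSpan _ _) (fundMatrix_mem_coeffSpan _ _)
  · exact zero_mem _

lemma star_coeff_mem_coeffSpan (hT : IsTrianglePresentation T q) (a : Word)
    (i j : (wordRep T a).ι) : star ((wordRep T a).mat i j) ∈ coeffSpan T := by
  induction a with
  | unit =>
    have h : (wordRep T .unit).mat i j = 1 := Matrix.one_apply_eq (α := CGT T) ()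
    rw [h, star_one]
    exact one_mem_coeffSpan
  | gen => exact star_fundMatrix_mem_coeffSpan hT i j
  | tensor a b iha ihb =>
    obtain ⟨(i : (wordRep T a).ι), (i' : (wordRep T b).ι)⟩ := i
    obtain ⟨(j : (wordRep T a).ι), (j' : (wordRep T b).ι)⟩ := j
    have h : (wordRep T (a.tensor b)).mat (i, i') (j, j') =
      (wordRep T a).mat i j * (wordRep T b).mat i' j' := rfl
    refine (congrArg (fun z => star z ∈ coeffSpan T) h).mpr ?_
    rw [star_mul]
    exact mul_mem_coeffSpan (ihb _ _) (iha _ _)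

lemma star_mem_coeffSpan (hT : IsTrianglePresentation T q) {x : CGT T} (hx : x ∈ coeffSpan T) :
    star x ∈ coeffSpan T := by
  induction hx using Submodule.span_induction with
  | mem x hx =>
    obtain ⟨a, i, j, rfl⟩ := hx
    exact star_coeff_mem_coeffSpan hT a i j
  | zero => rw [star_zero]; exact zero_mem _
  | add x y _ _ hx hy => rw [star_add]; exact add_mem hx hy
  | smul c x _ hx => rw [star_smul]; exact Submodule.smul_mem _ _ hx

/-- The span of the coefficients is a *-subalgebra containing the generators. -/
lemma dense_coeffSpan (hT : IsTrianglePresentation T q) : Dense (coeffSpan T : Set (CGT T)) := by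
  let S : StarSubalgebra ℂ (CGT T) :=
    { carrier := coeffSpan T
      mul_mem' := mul_mem_coeffSpan
      add_mem' := add_mem
      algebraMap_mem' := fun c => by
        rw [Algebra.algebraMap_eq_smul_one]
        exact Submodule.smul_mem _ _ one_mem_coeffSpan
      star_mem' := star_mem_coeffSpan hT }
  have h : StarAlgebra.adjoin ℂ (Set.range fun x : F × F => fundMatrix T x.1 x.2) ≤ S :=
    StarAlgebra.adjoin_le (by rintro _ ⟨x, rfl⟩; exact fundMatrix_mem_coeffSpan _ _)
  intro x
  have hx : x ∈ (StarAlgebra.adjoin ℂ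
      (Set.range fun x : F × F => fundMatrix T x.1 x.2)).topologicalClosure := by
    rw [CGT.dense]
    exact StarSubalgebra.mem_top
  exact closure_mono h hx

/-- Continuous functionals on `C(𝔾_T)` are determined by the coefficients of the tensor words. -/
lemma fn_eq_of_coeff (hT : IsTrianglePresentation T q) {φ ψ : CGT T →L[ℂ] ℂ}
    (h : ∀ (a : Word) (i j : (wordRep T a).ι), φ ((wordRep T a).mat i j) =
      ψ ((wordRep T a).mat i j)) : φ = ψ := by
  refine ContinuousLinearMap.coe_inj.1 ?_
  refine LinearMap.ext fun x => ?_
  refine congrFun (Continuous.ext_on (dense_coeffSpan hT) φ.continuous ψ.continuous ?_) x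
  refine fun x hx => ?_
  induction hx using Submodule.span_induction with
  | mem x hx =>
    obtain ⟨a, i, j, rfl⟩ := hx
    exact h a i j
  | zero => simp
  | add x y _ _ hx hy => simp [hx, hy]
  | smul c x _ hx => simp [hx]

lemma continuous_comul : Continuous (comul T) :=
  AddMonoidHomClass.continuous_of_bound (comul T) 1 fun x => by
    simpa using NonUnitalStarAlgHom.norm_apply_le (comul T) x

/-- Invariance of the Haar state. -/
lemma pairFn_haar_comul (hT : IsTrianglePresentation T q) (g : State (CGT T)) (a : CGT T) :
    pairFn (haar hT, g) (comul T a) = (haar hT).fn a := by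
  let φ : CGT T →L[ℂ] ℂ := (pairFn (haar hT, g)).comp
    ⟨(comul T).toAlgHom.toLinearMap, continuous_comul⟩
  have h : φ = (haar hT).fn := fn_eq_of_coeff hT fun b i j => by
    change pairFn (haar hT, g) (comul T ((wordRep T b).mat i j)) = _
    rw [(wordRep T b).comul, map_sum]
    simp only [pairFn_mtmul]
    have h1 := congrArg g.fn (sum_haar_smul hT b i j)
    rw [map_sum, map_smul, State.fn_one] at h1
    simpa only [map_smul, smul_eq_mul, mul_one] using h1
  exact congrArg (fun f => f a) h

/-- Every intertwiner between tensor words is given by a diagram. -/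
lemma mat_mem_diagramSpace (hT : IsTrianglePresentation T q) {b d : Word}
    (f : wordRep T b ⟶ wordRep T d) : f.mat ∈ diagramSpace T b d := by
  -- It is enough that the projection onto the diagrams from d to b fixes f^*; its kernel entries
  -- are Haar values, so this can be computed with coefficients.
  have h1 : hsProj (diagramSpace T d b) f.mat.conjTranspose = f.mat.conjTranspose := by
    ext j y
    refine (hsProj_apply (ι := fun a => (wordRep T a).ι) (C := diagramSpace T) d b
      f.mat.conjTranspose j y).trans ?_
    have h2 : ∀ i x, projKernel (ι := fun a => (wordRep T a).ι) (diagramSpace T) d b j y i x *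
        f.mat.conjTranspose i x = star ((haar hT).fn
          (star ((wordRep T d).mat x y) * (f.mat x i • (wordRep T b).mat i j))) := by
      intro i x
      rw [mul_smul_comm, map_smul, haar_star_mul, smul_eq_mul, star_mul, Matrix.conjTranspose_apply]
      congr 1
      exact (star_projKernel (ι := fun a => (wordRep T a).ι) (C := diagramSpace T) d b i x j y).symm
    simp only [h2]
    -- Intertwining turns coefficients of b into coefficients of d, after which unitarity of d
    -- leaves only an entry of f.
    have h3 : ∀ x, ∑ i, f.mat x i • (wordRep T b).mat i j = ∑ k, f.mat k j • (wordRep T d).mat x k :=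
      fun x => ((Rep.intertwine_iff _).1 f.comm x j).symm
    have h4 : ∀ k, ∑ x, star ((wordRep T d).mat x y) * (wordRep T d).mat x k =
        if y = k then 1 else 0 := by
      intro k
      have := congrFun (congrFun (Unitary.mem_iff.1 (wordRep T d).unitary).1 y) k
      simpa [Matrix.mul_apply, Matrix.one_apply] using this
    rw [Finset.sum_comm]
    simp only [← star_sum, ← map_sum, ← Finset.mul_sum, h3]
    rw [Matrix.conjTranspose_apply]
    congr 1
    have h5 : ∑ x, star ((wordRep T d).mat x y) * ∑ k, f.mat k j • (wordRep T d).mat x k =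
        ∑ k, f.mat k j • ∑ x, star ((wordRep T d).mat x y) * (wordRep T d).mat x k := by
      simp only [Finset.mul_sum, Finset.smul_sum, mul_smul_comm]
      exact Finset.sum_comm
    rw [h5]
    simp only [h4, smul_ite, smul_zero, Finset.sum_ite_eq, Finset.mem_univ, if_true, map_smul,
      State.fn_one, smul_eq_mul, mul_one]
  have h2 := conjTranspose_mem_diagramSpace (hsProj_mem (C := diagramSpace T d b)
    f.mat.conjTranspose)
  rwa [h1, Matrix.conjTranspose_conjTranspose] at h2

lemma exists_diagram (hT : IsTrianglePresentation T q) {b d : Word}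
    (f : wordRep T b ⟶ wordRep T d) : ∃ e : Diagram b d, e.hom T = f := by
  obtain ⟨e, he⟩ := exists_hom_of_mem (mat_mem_diagramSpace hT f)
  exact ⟨e, Rep.hom_ext he⟩

end

section
-- Inverse square roots, and normalization of families of intertwiners.
section InverseSqrt
variable {m : Type} [Fintype m] [DecidableEq m]

/-- The inverse square root of a positive definite matrix. -/
def invSqrt (M : Matrix m m ℂ) : Matrix m m ℂ := cfc (fun x : ℝ => (√x)⁻¹) M

lemma invSqrt_mul_mul_invSqrt {M : Matrix m m ℂ} (hM : M.PosDef) :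
    invSqrt M * M * invSqrt M = 1 := by
  have hsa : IsSelfAdjoint M := hM.isHermitian
  have hpos : ∀ x ∈ spectrum ℝ M, 0 < x := by
    intro x hx
    rw [hM.isHermitian.spectrum_real_eq_range_eigenvalues] at hx
    obtain ⟨i, rfl⟩ := hx
    exact hM.eigenvalues_pos i
  have hc : ContinuousOn (fun x : ℝ => (√x)⁻¹) (spectrum ℝ M) := fun x hx =>
    (ContinuousAt.inv₀ Real.continuous_sqrt.continuousAt
      (Real.sqrt_pos.2 (hpos x hx)).ne').continuousWithinAt
  have h1 : M = cfc (fun x : ℝ => x) M := (cfc_id ℝ M).symm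
  calc invSqrt M * M * invSqrt M
      = cfc (fun x : ℝ => (√x)⁻¹) M * cfc (fun x : ℝ => x) M * cfc (fun x : ℝ => (√x)⁻¹) M := by
        rw [← h1]
        rfl
    _ = cfc (fun x : ℝ => (√x)⁻¹ * x * (√x)⁻¹) M := by
        rw [cfc_mul (fun x : ℝ => (√x)⁻¹ * x) (fun x : ℝ => (√x)⁻¹) M (hc.mul continuousOn_id) hc,
          cfc_mul (fun x : ℝ => (√x)⁻¹) (fun x : ℝ => x) M hc continuousOn_id]
    _ = cfc (fun _ : ℝ => (1 : ℝ)) M := by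
        refine cfc_congr fun x hx => ?_
        have h := (Real.sqrt_pos.2 (hpos x hx)).ne'
        have h2 := Real.mul_self_sqrt (hpos x hx).le
        field_simp
        rw [sq, h2]
    _ = 1 := cfc_const_one ℝ M

lemma conjTranspose_invSqrt (M : Matrix m m ℂ) : (invSqrt M).conjTranspose = invSqrt M :=
  (cfc_predicate (R := ℝ) (p := IsSelfAdjoint) (fun x : ℝ => (√x)⁻¹) M).star_eq

lemma commute_invSqrt {M N : Matrix m m ℂ} (h : Commute M N) : Commute (invSqrt M) N :=
  h.cfc_real _

end InverseSqrt

section Intertwiners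
variable {A : Type} [CStarAlgebra A] {Δ : A →⋆ₐ[ℂ] MinTensor A A}

lemma Rep.sum_mat {X Y : Rep Δ} {κ : Type*} (J : Finset κ) (f : κ → (X ⟶ Y)) :
    (∑ p ∈ J, f p).mat = ∑ p ∈ J, (f p).mat :=
  map_sum (AddMonoidHom.mk' (fun f : X ⟶ Y => f.mat) Rep.add_mat) f J

/-- The inverse square root of an endomorphism. -/
def Rep.invSqrtHom {X : Rep Δ} (f : X ⟶ X) : X ⟶ X where
  mat := invSqrt f.mat
  comm := by
    refine (Rep.intertwine_iff _).2 fun i j => ?_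
    rw [← sub_eq_zero]
    -- A state turns the intertwining relation into commutation of two complex matrices, which
    -- passes to the functional calculus; states separate points.
    refine eq_zero_of_states fun g => ?_
    have h : Commute f.mat (X.mat.map g.fn) := by
      ext i j
      have := congrArg g.fn ((Rep.intertwine_iff _).1 f.comm i j)
      simp only [map_sum, map_smul, smul_eq_mul] at this
      simp only [Matrix.mul_apply, Matrix.map_apply]
      rw [← this]
      exact Finset.sum_congr rfl fun _ _ => mul_comm _ _
    have h2 := congrFun (congrFun (commute_invSqrt h).eq i) j
    simp only [Matrix.mul_apply, Matrix.map_apply] at h2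
    simp only [map_sub, map_sum, map_smul, smul_eq_mul]
    rw [h2, sub_eq_zero]
    exact Finset.sum_congr rfl fun _ _ => mul_comm _ _

/-- A family of intertwiners into `X` with no common orthogonal vector can be normalized. -/
lemma Rep.exists_resolution {X : Rep Δ} {κ : Type} {Y : κ → Rep Δ} (s : ∀ p, Y p ⟶ X)
    (h : ∀ ξ : X.ι → ℂ, (∀ p, (s p).mat.conjTranspose.mulVec ξ = 0) → ξ = 0) :
    ∃ (J : Finset κ) (t : ∀ p, Y p ⟶ X), ∑ p ∈ J, adj (t p) ≫ t p = 𝟙 X := by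
  classical
  let K : κ → Submodule ℂ (X.ι → ℂ) := fun p => LinearMap.ker (s p).mat.conjTranspose.mulVecLin
  -- Finite dimension: a minimal intersection of finitely many kernels is contained in every other
  -- kernel, hence is 0.
  obtain ⟨_, ⟨J, rfl⟩, hJ⟩ := WellFounded.has_min
    (wellFounded_lt (α := Submodule ℂ (X.ι → ℂ))) (Set.range fun J : Finset κ => J.inf K)
    (Set.range_nonempty _)
  have hJ0 : ∀ ξ ∈ J.inf K, ξ = 0 := by
    intro ξ hξ
    refine h ξ fun p => ?_
    have h1 : (insert p J).inf K ≤ J.inf K := Finset.inf_mono (Finset.subset_insert p J)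
    have h2 : (insert p J).inf K = J.inf K :=
      h1.eq_of_not_lt (hJ _ ⟨insert p J, rfl⟩)
    rw [← h2, Finset.inf_insert] at hξ
    exact hξ.1
  -- The sum of all s_p s_p^* with p ∈ J is positive definite, and the maps f^{-1/2} s_p are the
  -- resolution sought.
  let f : X ⟶ X := ∑ p ∈ J, adj (s p) ≫ s p
  have hf : f.mat = ∑ p ∈ J, (s p).mat * (s p).mat.conjTranspose := Rep.sum_mat _ _
  have hpos : f.mat.PosDef := by
    refine Matrix.PosDef.of_dotProduct_mulVec_pos ?_ fun ξ hξ => ?_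
    · rw [Matrix.IsHermitian, hf, Matrix.conjTranspose_sum]
      simp
    · have h1 : star ξ ⬝ᵥ f.mat.mulVec ξ = ∑ p ∈ J, star ((s p).mat.conjTranspose.mulVec ξ) ⬝ᵥ
          (s p).mat.conjTranspose.mulVec ξ := by
        rw [hf, Matrix.sum_mulVec, dotProduct_sum]
        refine Finset.sum_congr rfl fun p _ => ?_
        rw [← Matrix.mulVec_mulVec, Matrix.dotProduct_mulVec, Matrix.star_mulVec,
          Matrix.conjTranspose_conjTranspose]
      rw [h1]
      refine Finset.sum_pos' (fun p _ => dotProduct_star_self_nonneg _) ?_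
      by_contra! hne
      refine hξ (hJ0 ξ ?_)
      rw [Submodule.mem_finsetInf]
      intro p hp
      by_contra hn
      exact hne p hp (Matrix.dotProduct_star_self_pos_iff.2 hn)
  refine ⟨J, fun p => s p ≫ invSqrtHom f, ?_⟩
  ext1
  rw [Rep.sum_mat]
  have h2 : ∀ p, (adj (s p ≫ invSqrtHom f) ≫ s p ≫ invSqrtHom f).mat =
      invSqrt f.mat * ((s p).mat * (s p).mat.conjTranspose) * invSqrt f.mat := by
    intro p
    change invSqrt f.mat * (s p).mat * (invSqrt f.mat * (s p).mat).conjTranspose = _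
    rw [Matrix.conjTranspose_mul, conjTranspose_invSqrt]
    simp only [Matrix.mul_assoc]
  simp only [h2]
  rw [← Finset.sum_mul, ← Finset.mul_sum, ← hf, invSqrt_mul_mul_invSqrt hpos, Rep.id_mat]

end Intertwiners

variable {F : Type} [Fintype F] [DecidableEq F] {T : Finset (F × F × F)} {q : ℕ}

/-! ### Averaging with the Haar state: tensor words exhaust all representations. -/

section Averaging
variable (X : Rep (comul T)) (b : Word)

/-- This is (h ⊗ id) Δ(z) = h(z) 1 for z = X_{xy}^* u^b_{ij}. It is tested with states in the second
leg, where it is `pairFn_haar_comul`. -/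
lemma sum_haar_smul_star_mul (hT : IsTrianglePresentation T q) (y : X.ι) (j : (wordRep T b).ι) (x : X.ι) (i : (wordRep T b).ι) :
    ∑ z, ∑ k, (haar hT).fn (star (X.mat x z) * (wordRep T b).mat i k) •
      (star (X.mat z y) * (wordRep T b).mat k j) =
    (haar hT).fn (star (X.mat x y) * (wordRep T b).mat i j) • 1 := by
  rw [← sub_eq_zero]
  refine eq_zero_of_states fun g => ?_
  have h := pairFn_haar_comul hT g (star (X.mat x y) * (wordRep T b).mat i j)
  have h2 : comul T (star (X.mat x y) * (wordRep T b).mat i j) = ∑ z, ∑ k,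
      mtmul (star (X.mat x z) * (wordRep T b).mat i k)
        (star (X.mat z y) * (wordRep T b).mat k j) := by
    rw [map_mul, map_star, X.comul, (wordRep T b).comul, star_sum, Finset.sum_mul_sum]
    simp only [star_mtmul, mtmul_mul]
  rw [h2] at h
  simp only [map_sum, pairFn_mtmul] at h
  simp only [map_sub, map_sum, map_smul, smul_eq_mul, State.fn_one, mul_one]
  rw [h, sub_self]

/-- The intertwiner obtained by averaging a matrix unit. -/
def averageHom (hT : IsTrianglePresentation T q) (x : X.ι) (i : (wordRep T b).ι) : wordRep T b ⟶ X where
  mat := Matrix.of fun y j => (haar hT).fn (star (X.mat x y) * (wordRep T b).mat i j)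
  comm := by
    refine (Rep.intertwine_iff _).2 fun w j => ?_
    simp only [Matrix.of_apply]
    -- Invariance replaces the scalar by a sum with an extra factor X^* on the left, which X_{wy}
    -- then cancels by unitarity.
    have h1 : ∀ y, (haar hT).fn (star (X.mat x y) * (wordRep T b).mat i j) • X.mat w y =
        X.mat w y * ∑ z, ∑ k, (haar hT).fn (star (X.mat x z) * (wordRep T b).mat i k) •
          (star (X.mat z y) * (wordRep T b).mat k j) := by
      intro y
      rw [sum_haar_smul_star_mul, mul_smul_comm, mul_one]
    have h2 : ∀ z, ∑ y, X.mat w y * star (X.mat z y) = if w = z then 1 else 0 := by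
      intro z
      have := congrFun (congrFun (Unitary.mem_iff.1 X.unitary).2 w) z
      simpa [Matrix.mul_apply, Matrix.one_apply] using this
    calc _ = ∑ y, ∑ z, ∑ k, (haar hT).fn (star (X.mat x z) * (wordRep T b).mat i k) •
          (X.mat w y * star (X.mat z y) * (wordRep T b).mat k j) := by
          refine Finset.sum_congr rfl fun y _ => ?_
          rw [h1, Finset.mul_sum]
          refine Finset.sum_congr rfl fun z _ => ?_
          rw [Finset.mul_sum]
          refine Finset.sum_congr rfl fun k _ => ?_
          rw [mul_smul_comm, mul_assoc]
      _ = ∑ z, ∑ k, (haar hT).fn (star (X.mat x z) * (wordRep T b).mat i k) •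
          ((∑ y, X.mat w y * star (X.mat z y)) * (wordRep T b).mat k j) := by
          rw [Finset.sum_comm]
          refine Finset.sum_congr rfl fun z _ => ?_
          rw [Finset.sum_comm]
          refine Finset.sum_congr rfl fun k _ => ?_
          rw [Finset.sum_mul, Finset.smul_sum]
      _ = _ := by
          simp only [h2]
          rw [Finset.sum_eq_single w]
          · simp
          · intro z _ hz
            simp [Ne.symm hz]
          · simp

variable {X} in
/-- No vector of `X` is orthogonal to the images of all intertwiners from tensor words. -/
lemma eq_zero_of_orthogonal (hT : IsTrianglePresentation T q) {ξ : X.ι → ℂ}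
    (h : ∀ (b : Word) (s : wordRep T b ⟶ X), s.mat.conjTranspose.mulVec ξ = 0) : ξ = 0 := by
  -- The functional h(η_x^* ·) vanishes on every coefficient of a tensor word, because ξ is
  -- orthogonal to the averaged intertwiners. By density it vanishes at η_x.
  let η : X.ι → CGT T := fun x => ∑ y, ξ y • X.mat x y
  have h1 : ∀ x, (haar hT).fn (star (η x) * η x) = 0 := by
    intro x
    let φ : CGT T →L[ℂ] ℂ := (haar hT).fn.comp (ContinuousLinearMap.mul ℂ (CGT T) (star (η x)))
    have hφ : φ = 0 := fn_eq_of_coeff hT fun b i j => by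
      have h2 := congrFun (h b (averageHom X b hT x i)) j
      simp only [Matrix.mulVec, dotProduct, Matrix.conjTranspose_apply, averageHom,
        Matrix.of_apply, Pi.zero_apply] at h2
      have h3 := congrArg star h2
      rw [star_sum, star_zero] at h3
      simp only [star_mul', star_star] at h3
      change (haar hT).fn (star (η x) * (wordRep T b).mat i j) = 0
      simp only [η, star_sum, star_smul, Finset.sum_mul, map_sum, smul_mul_assoc, map_smul,
        smul_eq_mul]
      refine Eq.trans ?_ h3
      exact Finset.sum_congr rfl fun _ _ => mul_comm _ _
    exact congrArg (fun f => f (η x)) hφ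
  -- Unitarity of X: the sum is ‖ξ‖² times 1, so applying h gives ξ = 0.
  have h2 : ∑ x, star (η x) * η x = (∑ y, star (ξ y) * ξ y) • (1 : CGT T) := by
    have hu : ∀ y y', ∑ x, star (X.mat x y) * X.mat x y' = if y = y' then 1 else 0 := by
      intro y y'
      have := congrFun (congrFun (Unitary.mem_iff.1 X.unitary).1 y) y'
      simpa [Matrix.mul_apply, Matrix.one_apply] using this
    calc ∑ x, star (η x) * η x
        = ∑ x, ∑ y, ∑ y', (star (ξ y) * ξ y') • (star (X.mat x y) * X.mat x y') := by
          refine Finset.sum_congr rfl fun x _ => ?_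
          simp only [η, star_sum, star_smul, Finset.sum_mul_sum, smul_mul_smul_comm]
      _ = ∑ y, ∑ y', (star (ξ y) * ξ y') • ∑ x, star (X.mat x y) * X.mat x y' := by
          rw [Finset.sum_comm]
          refine Finset.sum_congr rfl fun y _ => ?_
          rw [Finset.sum_comm]
          refine Finset.sum_congr rfl fun y' _ => ?_
          rw [Finset.smul_sum]
      _ = _ := by
          simp [hu, Finset.sum_smul]
  have h3 := congrArg (haar hT).fn h2
  rw [map_sum, map_smul, State.fn_one, smul_eq_mul, mul_one, Finset.sum_eq_zero fun x _ => h1 x] at h3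
  have h4 : star ξ ⬝ᵥ ξ = 0 := h3.symm
  exact dotProduct_star_self_eq_zero.1 h4

/-- Every representation is a direct summand of a direct sum of tensor words. -/
lemma exists_word_resolution (hT : IsTrianglePresentation T q) : ∃ (κ : Type) (_ : Fintype κ) (a : κ → Word)
    (s : ∀ p, wordRep T (a p) ⟶ X), ∑ p, Rep.adj (s p) ≫ s p = 𝟙 X := by
  obtain ⟨J, t, ht⟩ := Rep.exists_resolution (κ := Σ b : Word, wordRep T b ⟶ X)
    (Y := fun p => wordRep T p.1) (fun p => p.2) fun ξ hξ =>
      eq_zero_of_orthogonal hT fun b s => hξ ⟨b, s⟩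
  refine ⟨J, inferInstance, fun p => p.1.1, fun p => t p.1, ?_⟩
  rw [← ht]
  exact Finset.sum_coe_sort J fun p => Rep.adj (t p) ≫ t p

end Averaging

end

section
-- Splitting projections in the representation category.
/-- An orthogonal projection is `W W^*` for an isometry `W`. -/
lemma exists_isometry_of_projection {m : Type} [Fintype m] [DecidableEq m] {P : Matrix m m ℂ}
    (hP : P * P = P) (hP' : P.conjTranspose = P) :
    ∃ (n : ℕ) (W : Matrix m (Fin n) ℂ), W.conjTranspose * W = 1 ∧ W * W.conjTranspose = P := by
  let L : EuclideanSpace ℂ m →ₗ[ℂ] EuclideanSpace ℂ m := Matrix.toEuclideanLin P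
  let V : Submodule ℂ (EuclideanSpace ℂ m) := LinearMap.range L
  let b := stdOrthonormalBasis ℂ V
  refine ⟨_, Matrix.of fun i a => (b a : EuclideanSpace ℂ m) i, ?_, ?_⟩
  · ext a a'
    have h := orthonormal_iff_ite.1 b.orthonormal a a'
    rw [Submodule.coe_inner, PiLp.inner_apply] at h
    rw [Matrix.mul_apply, Matrix.one_apply, ← h]
    refine Finset.sum_congr rfl fun i _ => ?_
    simp [mul_comm]
  · ext i j
    have hL : ∀ v ∈ V, L v = v := by
      rintro _ ⟨w, rfl⟩
      change (L ∘ₗ L) w = L w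
      congr 1
      change Matrix.toEuclideanLin P ∘ₗ Matrix.toEuclideanLin P = Matrix.toEuclideanLin P
      rw [← Matrix.toLpLin_mul_same, hP]
    let e : EuclideanSpace ℂ m := EuclideanSpace.single j 1
    have h1 : L e = ∑ a, inner ℂ (b a : EuclideanSpace ℂ m) e • (b a : EuclideanSpace ℂ m) := by
      have h2 := b.sum_repr' ⟨L e, e, rfl⟩
      have h3 := congrArg (Subtype.val) h2
      simp only [Submodule.coe_sum, Submodule.coe_smul, Submodule.coe_inner] at h3
      rw [← h3]
      refine Finset.sum_congr rfl fun a _ => ?_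
      congr 1
      have hadj : LinearMap.adjoint L = L := by
        rw [← Matrix.toEuclideanLin_conjTranspose_eq_adjoint, hP']
      rw [← LinearMap.adjoint_inner_left, hadj, hL _ (b a).2]
    have h4 := congrArg (fun v : EuclideanSpace ℂ m => v i) h1
    have h5 : L e i = P i j := by
      simp [L, e, Matrix.toLpLin_apply]
    rw [Matrix.mul_apply, ← h5]
    refine Eq.trans ?_ h4.symm
    simp [e, EuclideanSpace.inner_single_right, mul_comm]

section Splitting
variable {A : Type} [CStarAlgebra A] {Δ : A →⋆ₐ[ℂ] MinTensor A A}

lemma Rep.map_comul (X : Rep Δ) :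
    X.mat.map Δ = X.mat.map (inclLeft A A) * X.mat.map (inclRight A A) := by
  ext1 i j
  rw [Matrix.map_apply, X.comul, Matrix.mul_apply]
  rfl

lemma map_algebraMap_conjTranspose {A : Type*} [CStarAlgebra A] {m n : Type} (M : Matrix m n ℂ) :
    (M.map (algebraMap ℂ A)).conjTranspose = M.conjTranspose.map (algebraMap ℂ A) := by
  ext i j
  rw [Matrix.conjTranspose_apply, Matrix.map_apply, Matrix.map_apply, Matrix.conjTranspose_apply,
    algebraMap_star_comm]

lemma map_map_algebraMap {A B : Type*} [CStarAlgebra A] [CStarAlgebra B] (φ : A →⋆ₐ[ℂ] B)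
    {m n : Type} (M : Matrix m n ℂ) :
    (M.map (algebraMap ℂ A)).map φ = M.map (algebraMap ℂ B) := by
  ext i j
  exact AlgHomClass.commutes φ (M i j)

/-- A finite matrix of intertwiners that is an orthogonal projection is given by a representation. -/
lemma Rep.exists_splitting {κ : Type} [Fintype κ] {Y : κ → Rep Δ} (p : ∀ i j, Y i ⟶ Y j)
    (hp : ∀ i k, ∑ j, p i j ≫ p j k = p i k) (hadj : ∀ i j, adj (p i j) = p j i) :
    ∃ (X : Rep Δ) (s : ∀ j, Y j ⟶ X), (∀ i j, s i ≫ adj (s j) = p i j) ∧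
      ∑ j, adj (s j) ≫ s j = 𝟙 X := by
  classical
  -- The family p as one block matrix on the direct sum of the spaces of the Y j, with source and
  -- target swapped to match matrix multiplication.
  let P : Matrix (Σ j, (Y j).ι) (Σ j, (Y j).ι) ℂ := Matrix.of fun u v => (p v.1 u.1).mat u.2 v.2
  have hP : P * P = P := by
    ext ⟨k, x⟩ ⟨i, y⟩
    have := congrFun (congrFun (congrArg Hom.mat (hp i k)) x) y
    rw [Rep.sum_mat, Matrix.sum_apply] at this
    simp only [P, Matrix.mul_apply, Matrix.of_apply, Fintype.sum_sigma]
    exact this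
  have hP' : P.conjTranspose = P := by
    ext ⟨k, x⟩ ⟨i, y⟩
    simp only [P, Matrix.conjTranspose_apply, Matrix.of_apply]
    rw [← hadj k i]
    rfl
  obtain ⟨n, W, hW1, hW2⟩ := exists_isometry_of_projection hP hP'
  let w : ∀ j, Matrix (Y j).ι (Fin n) ℂ := fun j => Matrix.of fun x a => W ⟨j, x⟩ a
  have hw1 : ∑ j, (w j).conjTranspose * w j = 1 := by
    rw [← hW1]
    ext a b
    simp only [Matrix.sum_apply, Matrix.mul_apply, Fintype.sum_sigma]
    rfl
  have hw2 : ∀ i j, w j * (w i).conjTranspose = (p i j).mat := by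
    intro i j
    ext x y
    exact congrFun (congrFun hW2 ⟨j, x⟩) ⟨i, y⟩
  have lift1 : ∀ (B : Type) [CStarAlgebra B], ∑ j, ((w j).conjTranspose.map (algebraMap ℂ B)) *
      ((w j).map (algebraMap ℂ B)) = 1 := by
    intro B _
    have := congrArg (fun M => Matrix.map M (algebraMap ℂ B)) hw1
    simp only [Matrix.map_one _ (map_zero (algebraMap ℂ B)) (map_one (algebraMap ℂ B))] at this
    rw [← this]
    ext a b
    simp [Matrix.sum_apply, Matrix.mul_apply]
  let a : ∀ j, Matrix (Y j).ι (Fin n) A := fun j => (w j).map (algebraMap ℂ A)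
  let b : ∀ j, Matrix (Fin n) (Y j).ι A := fun j => (w j).conjTranspose.map (algebraMap ℂ A)
  have hba : ∑ j, b j * a j = 1 := lift1 A
  have hab : ∀ i j, a j * b i = (p i j).mat.map (algebraMap ℂ A) := by
    intro i j
    rw [← hw2, Matrix.map_mul]
  have hcomm : ∀ i j, (Y j).mat * (a j * b i) = a j * b i * (Y i).mat := by
    intro i j
    rw [hab]
    exact (p i j).comm
  have ha : ∀ j, (a j).conjTranspose = b j := fun j => map_algebraMap_conjTranspose _
  have hb : ∀ j, (b j).conjTranspose = a j := fun j => by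
    rw [← ha, Matrix.conjTranspose_conjTranspose]
  -- The compression W^* (⊕ Y_j) W. Since the blocks W_j W_i^* are intertwiners, W W^* commutes with
  -- ⊕ Y_j, and this gives unitarity and compatibility with Δ.
  let M : Matrix (Fin n) (Fin n) A := ∑ j, b j * (Y j).mat * a j
  have hM : star M = ∑ j, b j * star (Y j).mat * a j := by
    simp only [M, star_sum, Matrix.star_eq_conjTranspose, Matrix.conjTranspose_mul, ha, hb,
      Matrix.mul_assoc]
  have hYs : ∀ j, star (Y j).mat * (Y j).mat = 1 := fun j => (Unitary.mem_iff.1 (Y j).unitary).1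
  have hYs' : ∀ j, (Y j).mat * star (Y j).mat = 1 := fun j => (Unitary.mem_iff.1 (Y j).unitary).2
  have hone : ∑ j, ∑ i, b j * (a j * b i) * a i = 1 := by
    calc _ = ∑ j, ∑ i, (b j * a j) * (b i * a i) := by simp only [Matrix.mul_assoc]
      _ = 1 := by rw [← Finset.sum_mul_sum, hba, one_mul]
  have hunit : M ∈ _root_.unitary (Matrix (Fin n) (Fin n) A) := by
    rw [Unitary.mem_iff, hM]
    constructor
    · rw [Finset.sum_mul_sum, ← hone]
      refine Finset.sum_congr rfl fun j _ => Finset.sum_congr rfl fun i _ => ?_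
      calc b j * star (Y j).mat * a j * (b i * (Y i).mat * a i)
          = b j * (star (Y j).mat * (a j * b i * (Y i).mat)) * a i := by simp only [Matrix.mul_assoc]
        _ = b j * (star (Y j).mat * (Y j).mat * (a j * b i)) * a i := by
          rw [← hcomm, Matrix.mul_assoc (star _)]
        _ = _ := by rw [hYs, Matrix.one_mul]
    · rw [Finset.sum_mul_sum, ← hone]
      refine Finset.sum_congr rfl fun j _ => Finset.sum_congr rfl fun i _ => ?_
      calc b j * (Y j).mat * a j * (b i * star (Y i).mat * a i)
          = b j * ((Y j).mat * (a j * b i) * star (Y i).mat) * a i := by simp only [Matrix.mul_assoc]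
        _ = b j * (a j * b i * ((Y i).mat * star (Y i).mat)) * a i := by
          rw [hcomm, Matrix.mul_assoc (a j * b i)]
        _ = _ := by rw [hYs', Matrix.mul_one]
  have hMs : ∀ j, M * b j = b j * (Y j).mat := by
    intro j
    calc M * b j = ∑ i, b i * a i * (b j * (Y j).mat) := by
          rw [Matrix.sum_mul]
          refine Finset.sum_congr rfl fun i _ => ?_
          rw [Matrix.mul_assoc, Matrix.mul_assoc, hcomm]
          simp only [Matrix.mul_assoc]
      _ = _ := by rw [← Matrix.sum_mul, hba, Matrix.one_mul]
  have hcomul : M.map Δ = M.map (inclLeft A A) * M.map (inclRight A A) := by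
    let B := MinTensor A A
    let a' : ∀ j, Matrix (Y j).ι (Fin n) B := fun j => (w j).map (algebraMap ℂ B)
    let b' : ∀ j, Matrix (Fin n) (Y j).ι B := fun j => (w j).conjTranspose.map (algebraMap ℂ B)
    have hba' : ∑ j, b' j * a' j = 1 := lift1 B
    have hφ : ∀ φ : A →⋆ₐ[ℂ] B, M.map φ = ∑ j, b' j * (Y j).mat.map φ * a' j := by
      intro φ
      have h1 : M.map φ = ∑ j, (b j * (Y j).mat * a j).map φ := by
        ext x y
        simp only [M, Matrix.map_apply, Matrix.sum_apply, map_sum]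
      rw [h1]
      refine Finset.sum_congr rfl fun j _ => ?_
      rw [Matrix.map_mul, Matrix.map_mul, map_map_algebraMap, map_map_algebraMap]
    have hcomm' : ∀ (φ : A →⋆ₐ[ℂ] B) i j, (Y j).mat.map φ * (a' j * b' i) =
        a' j * b' i * (Y i).mat.map φ := by
      intro φ i j
      have := congrArg (fun M => Matrix.map M φ) (hcomm i j)
      simpa only [Matrix.map_mul, a, b, map_map_algebraMap] using this
    -- After the identity ∑ b'_j a'_j = 1 is inserted in front, the intertwiner a'_j b'_i is moved
    -- past the coefficients in the left leg only.
    rw [hφ, hφ, hφ, Finset.sum_mul_sum]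
    calc ∑ i, b' i * (Y i).mat.map Δ * a' i
        = (∑ j, b' j * a' j) * ∑ i, b' i * (Y i).mat.map Δ * a' i := by rw [hba', Matrix.one_mul]
      _ = ∑ j, ∑ i, (b' j * a' j) * (b' i * (Y i).mat.map Δ * a' i) := Finset.sum_mul_sum _ _ _ _
      _ = _ := by
        refine Finset.sum_congr rfl fun j _ => Finset.sum_congr rfl fun i _ => ?_
        rw [Rep.map_comul]
        calc _ = b' j * (a' j * b' i * (Y i).mat.map (inclLeft A A)) *
              (Y i).mat.map (inclRight A A) * a' i := by simp only [Matrix.mul_assoc]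
          _ = _ := by
            rw [← hcomm']
            simp only [Matrix.mul_assoc]
  let X : Rep Δ :=
    { ι := Fin n
      mat := M
      unitary := hunit
      comul := fun i j => by
        have := congrFun (congrFun hcomul i) j
        rw [Matrix.map_apply, Matrix.mul_apply] at this
        exact this }
  refine ⟨X, fun j => ⟨(w j).conjTranspose, hMs j⟩, fun i j => ?_, ?_⟩
  · ext1
    change (w j).conjTranspose.conjTranspose * (w i).conjTranspose = _
    rw [Matrix.conjTranspose_conjTranspose, hw2]
  · ext1
    rw [Rep.sum_mat]
    change ∑ j, (w j).conjTranspose * (w j).conjTranspose.conjTranspose = 1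
    simpa only [Matrix.conjTranspose_conjTranspose] using hw1

end Splitting

end

section
variable {F : Type} [Fintype F] [DecidableEq F] {T : Finset (F × F × F)}
  {F' : Type} [Fintype F'] [DecidableEq F'] {T' : Finset (F' × F' × F')} {q q' : ℕ}

/-! ### Morphisms out of tensor words, and the transfer of their intertwiners. -/

section WordMorphisms
variable {a b c d : Word} {X Y Z X' Y' : Rep (comul T)}

/-- The tensor product of morphisms from tensor words. -/
def wordTensor (f : wordRep T a ⟶ X) (g : wordRep T b ⟶ Y) : wordRep T (a.tensor b) ⟶ X ⊗ Y :=
  (f ⊗ₘ g : wordRep T a ⊗ wordRep T b ⟶ X ⊗ Y)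

/-- The tensor product of morphisms between tensor words. -/
def wordMap (f : wordRep T a ⟶ wordRep T c) (g : wordRep T b ⟶ wordRep T d) :
    wordRep T (a.tensor b) ⟶ wordRep T (c.tensor d) :=
  (f ⊗ₘ g : wordRep T a ⊗ wordRep T b ⟶ wordRep T c ⊗ wordRep T d)

variable (T) in
/-- The trivial representation as a tensor word. -/
def wordUnit : wordRep T .unit ⟶ 𝟙_ (Rep (comul T)) := 𝟙 (𝟙_ (Rep (comul T)))

variable (T) in
/-- The associator of tensor words. -/
def wordAssoc (a b c : Word) :
    wordRep T ((a.tensor b).tensor c) ⟶ wordRep T (a.tensor (b.tensor c)) :=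
  (α_ (wordRep T a) (wordRep T b) (wordRep T c)).hom

variable (T) in
/-- The left unitor of tensor words. -/
def wordLeft (a : Word) : wordRep T (Word.unit.tensor a) ⟶ wordRep T a := (λ_ (wordRep T a)).hom

variable (T) in
/-- The right unitor of tensor words. -/
def wordRight (a : Word) : wordRep T (a.tensor Word.unit) ⟶ wordRep T a := (ρ_ (wordRep T a)).hom

lemma wordTensor_comp (f : wordRep T a ⟶ X) (g : wordRep T b ⟶ Y) (u : X ⟶ X') (v : Y ⟶ Y') :
    wordTensor f g ≫ (u ⊗ₘ v) = wordTensor (f ≫ u) (g ≫ v) :=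
  tensorHom_comp_tensorHom f g u v

lemma wordMap_comp_wordTensor (f : wordRep T a ⟶ wordRep T c) (g : wordRep T b ⟶ wordRep T d)
    (u : wordRep T c ⟶ X) (v : wordRep T d ⟶ Y) :
    wordMap f g ≫ wordTensor u v = wordTensor (f ≫ u) (g ≫ v) :=
  tensorHom_comp_tensorHom f g u v

lemma wordTensor_comp_adj (f : wordRep T a ⟶ X) (g : wordRep T b ⟶ Y) (u : wordRep T c ⟶ X)
    (v : wordRep T d ⟶ Y) :
    wordTensor f g ≫ Rep.adj (wordTensor u v) = wordMap (f ≫ Rep.adj u) (g ≫ Rep.adj v) := by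
  refine Eq.trans ?_ (tensorHom_comp_tensorHom f g (Rep.adj u) (Rep.adj v))
  exact congrArg ((f ⊗ₘ g) ≫ ·) (Rep.adj_tensor u v)

lemma adj_wordTensor_comp (f : wordRep T a ⟶ X) (g : wordRep T b ⟶ Y) (u : wordRep T a ⟶ X')
    (v : wordRep T b ⟶ Y') :
    Rep.adj (wordTensor f g) ≫ wordTensor u v = (Rep.adj f ≫ u) ⊗ₘ (Rep.adj g ≫ v) := by
  refine Eq.trans ?_ (tensorHom_comp_tensorHom (Rep.adj f) (Rep.adj g) u v)
  exact congrArg (· ≫ (u ⊗ₘ v)) (Rep.adj_tensor f g)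

lemma wordTensor_assoc (f : wordRep T a ⟶ X) (g : wordRep T b ⟶ Y) (k : wordRep T c ⟶ Z) :
    wordTensor (wordTensor f g) k ≫ (α_ X Y Z).hom =
      wordAssoc T a b c ≫ wordTensor f (wordTensor g k) :=
  associator_naturality f g k

lemma wordTensor_left (f : wordRep T a ⟶ X) :
    wordTensor (wordUnit T) f ≫ (λ_ X).hom = wordLeft T a ≫ f := by
  refine Eq.trans ?_ (leftUnitor_naturality f)
  exact congrArg (· ≫ (λ_ X).hom) (id_tensorHom _ f)

lemma wordTensor_right (f : wordRep T a ⟶ X) :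
    wordTensor f (wordUnit T) ≫ (ρ_ X).hom = wordRight T a ≫ f := by
  refine Eq.trans ?_ (rightUnitor_naturality f)
  exact congrArg (· ≫ (ρ_ X).hom) (tensorHom_id f _)

lemma sum_wordTensor {κ : Type*} (s : Finset κ) (f : κ → (wordRep T a ⟶ X)) (g : wordRep T b ⟶ Y) :
    wordTensor (∑ i ∈ s, f i) g = ∑ i ∈ s, wordTensor (f i) g :=
  Rep.sum_tensor s f g

lemma wordTensor_sum {κ : Type*} (s : Finset κ) (f : wordRep T a ⟶ X) (g : κ → (wordRep T b ⟶ Y)) :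
    wordTensor f (∑ i ∈ s, g i) = ∑ i ∈ s, wordTensor f (g i) :=
  Rep.tensor_sum s f g

end WordMorphisms

/-- An equivalence between the intertwiners of the tensor words of two quantum groups that preserves
the structure of a C*-tensor category. -/
structure WordTransfer (T : Finset (F × F × F)) (T' : Finset (F' × F' × F')) where
  /-- the map on intertwiners -/
  map : ∀ {a b : Word}, (wordRep T a ⟶ wordRep T b) →ₗ[ℂ] (wordRep T' a ⟶ wordRep T' b)
  injective : ∀ {a b : Word}, Function.Injective (map (a := a) (b := b))
  surjective : ∀ {a b : Word}, Function.Surjective (map (a := a) (b := b))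
  map_id : ∀ a, map (𝟙 (wordRep T a)) = 𝟙 (wordRep T' a)
  map_comp : ∀ {a b c} (f : wordRep T a ⟶ wordRep T b) (g : wordRep T b ⟶ wordRep T c),
    map (f ≫ g) = map f ≫ map g
  map_adj : ∀ {a b} (f : wordRep T a ⟶ wordRep T b), map (Rep.adj f) = Rep.adj (map f)
  map_wordMap : ∀ {a b c d} (f : wordRep T a ⟶ wordRep T b) (g : wordRep T c ⟶ wordRep T d),
    map (wordMap f g) = wordMap (map f) (map g)
  map_assoc : ∀ a b c, map (wordAssoc T a b c) = wordAssoc T' a b c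
  map_left : ∀ a, map (wordLeft T a) = wordLeft T' a
  map_right : ∀ a, map (wordRight T a) = wordRight T' a

/-- Equality of the scalar products of partition vectors gives an equivalence between the
intertwiners of the tensor words. -/
lemma nonempty_wordTransfer (hT : IsTrianglePresentation T q) (hT' : IsTrianglePresentation T' q')
    (h : ∀ (n : ℕ) (p₁ p₂ : NC3 n), inner ℂ (partitionVector T p₁) (partitionVector T p₂) =
      inner ℂ (partitionVector T' p₁) (partitionVector T' p₂)) : Nonempty (WordTransfer T T') := by
  choose D hD using fun (a b : Word) (f : wordRep T a ⟶ wordRep T b) => exists_diagram hT f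
  -- The choice of a diagram does not matter: diagrams with the same intertwiner for T have the same
  -- one for T'.
  have key : ∀ {a b : Word} (d : Diagram a b), (D a b (d.hom T)).hom T' = d.hom T' := fun d =>
    (Diagram.hom_eq_iff hT hT' h _ _).1 (hD _ _ (d.hom T))
  let θ : ∀ a b : Word, (wordRep T a ⟶ wordRep T b) →ₗ[ℂ] (wordRep T' a ⟶ wordRep T' b) := fun a b =>
    { toFun := fun f => (D a b f).hom T'
      map_add' := fun f g => by
        obtain ⟨d, rfl⟩ := exists_diagram hT f
        obtain ⟨e, rfl⟩ := exists_diagram hT g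
        rw [key, key]
        exact key (.add d e)
      map_smul' := fun c f => by
        obtain ⟨d, rfl⟩ := exists_diagram hT f
        rw [key]
        exact key (.smul c d) }
  have hθ : ∀ {a b : Word} (d : Diagram a b), θ a b (d.hom T) = d.hom T' := key
  exact ⟨{
    map := fun {a b} => θ a b
    injective := fun {a b} f g hfg => by
      obtain ⟨d, rfl⟩ := exists_diagram hT f
      obtain ⟨e, rfl⟩ := exists_diagram hT g
      rw [hθ, hθ] at hfg
      exact (Diagram.hom_eq_iff hT hT' h d e).2 hfg
    surjective := fun {a b} f => by
      obtain ⟨d, rfl⟩ := exists_diagram hT' f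
      exact ⟨d.hom T, hθ d⟩
    map_id := fun a => hθ (.id a)
    map_comp := fun {a b c} f g => by
      obtain ⟨d, rfl⟩ := exists_diagram hT f
      obtain ⟨e, rfl⟩ := exists_diagram hT g
      rw [hθ, hθ]
      exact hθ (.comp d e)
    map_adj := fun {a b} f => by
      obtain ⟨d, rfl⟩ := exists_diagram hT f
      rw [hθ, ← Diagram.hom_dag, ← Diagram.hom_dag, hθ]
    map_wordMap := fun {a b c d} f g => by
      obtain ⟨d, rfl⟩ := exists_diagram hT f
      obtain ⟨e, rfl⟩ := exists_diagram hT g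
      rw [hθ, hθ]
      exact hθ (.tensor d e)
    map_assoc := fun a b c => hθ (.assoc a b c)
    map_left := fun a => hθ (.leftUnitor a)
    map_right := fun a => hθ (.rightUnitor a) }⟩

/-! ### Resolutions, corresponding representations and corresponding morphisms. -/

/-- A finite family of intertwiners from tensor words that is a resolution of the identity. -/
structure Resolution (X : Rep (comul T)) where
  /-- the index set -/
  κ : Type
  [fintype : Fintype κ]
  /-- the tensor words -/
  word : κ → Word
  /-- the intertwiners -/
  map : ∀ p, wordRep T (word p) ⟶ X
  sum_map : ∑ p, Rep.adj (map p) ≫ map p = 𝟙 X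

attribute [instance] Resolution.fintype

namespace Resolution
variable {X Y Z : Rep (comul T)}

lemma nonempty (hT : IsTrianglePresentation T q) (X : Rep (comul T)) : Nonempty (Resolution X) := by
  obtain ⟨κ, _, a, s, h⟩ := exists_word_resolution X hT
  exact ⟨⟨κ, a, s, h⟩⟩

lemma hom_ext_left (R : Resolution X) {u v : X ⟶ Z} (h : ∀ p, R.map p ≫ u = R.map p ≫ v) :
    u = v := by
  rw [← Category.id_comp u, ← Category.id_comp v, ← R.sum_map, Preadditive.sum_comp,
    Preadditive.sum_comp]
  simp only [Category.assoc, h]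

lemma hom_ext_right (R : Resolution X) {u v : Z ⟶ X}
    (h : ∀ p, u ≫ Rep.adj (R.map p) = v ≫ Rep.adj (R.map p)) : u = v := by
  rw [← Category.comp_id u, ← Category.comp_id v, ← R.sum_map, Preadditive.comp_sum,
    Preadditive.comp_sum]
  simp only [← Category.assoc, h]

/-- The tensor product of resolutions. -/
def tensor (R : Resolution X) (S : Resolution Y) : Resolution (X ⊗ Y) where
  κ := R.κ × S.κ
  word p := (R.word p.1).tensor (S.word p.2)
  map p := wordTensor (R.map p.1) (S.map p.2)
  sum_map := by
    rw [Fintype.sum_prod_type]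
    simp only [adj_wordTensor_comp]
    simp only [← Rep.tensor_sum, ← Rep.sum_tensor, R.sum_map, S.sum_map]
    exact id_tensorHom_id X Y

variable (T) in
/-- The resolution of the trivial representation. -/
def unit : Resolution (𝟙_ (Rep (comul T))) where
  κ := Unit
  word _ := .unit
  map _ := wordUnit T
  sum_map := by
    rw [Fintype.sum_unique]
    change Rep.adj (𝟙 (𝟙_ (Rep (comul T)))) ≫ 𝟙 (𝟙_ (Rep (comul T))) = _
    rw [Rep.adj_id, Category.comp_id]

end Resolution

/-- A representation `obj` of `𝔾_T'` that corresponds to the representation `X` of `𝔾_T`. -/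
structure Model (θ : WordTransfer T T') (X : Rep (comul T)) extends Resolution X where
  /-- the corresponding representation -/
  obj : Rep (comul T')
  /-- the intertwiners into the corresponding representation -/
  map' : ∀ p, wordRep T' (word p) ⟶ obj
  map'_comp_adj : ∀ i j, map' i ≫ Rep.adj (map' j) = θ.map (map i ≫ Rep.adj (map j))
  sum_map' : ∑ p, Rep.adj (map' p) ≫ map' p = 𝟙 obj

namespace Model
variable {θ : WordTransfer T T'} {X Y Z : Rep (comul T)}

/-- The matrix of intertwiners s_j^* s_i of a resolution is an orthogonal projection. This is
expressed by composition and adjoints alone, so its image under θ is one too, and it splits over T'.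
-/
lemma nonempty (hT : IsTrianglePresentation T q) (θ : WordTransfer T T') (X : Rep (comul T)) :
    Nonempty (Model θ X) := by
  obtain ⟨R⟩ := Resolution.nonempty hT X
  obtain ⟨X', s, hs, hs'⟩ := Rep.exists_splitting
    (fun i j => θ.map (R.map i ≫ Rep.adj (R.map j)))
    (fun i k => by
      have h : ∀ j, θ.map (R.map i ≫ Rep.adj (R.map j)) ≫ θ.map (R.map j ≫ Rep.adj (R.map k)) =
          θ.map (R.map i ≫ (Rep.adj (R.map j) ≫ R.map j) ≫ Rep.adj (R.map k)) := by
        intro j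
        rw [← θ.map_comp]
        simp only [Category.assoc]
      simp only [h]
      rw [← map_sum, ← Preadditive.comp_sum, ← Preadditive.sum_comp, R.sum_map, Category.id_comp])
    (fun i j => by rw [← θ.map_adj, Rep.adj_comp, Rep.adj_adj])
  exact ⟨⟨R, X', s, hs, hs'⟩⟩

/-- The intertwiner from a tensor word that corresponds to `g`. -/
def hat (m : Model θ X) {c : Word} (g : wordRep T c ⟶ X) : wordRep T' c ⟶ m.obj :=
  ∑ p, θ.map (g ≫ Rep.adj (m.map p)) ≫ m.map' p

lemma hat_sum (m : Model θ X) {c : Word} {κ : Type*} (s : Finset κ)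
    (g : κ → (wordRep T c ⟶ X)) : m.hat (∑ i ∈ s, g i) = ∑ i ∈ s, m.hat (g i) := by
  simp only [hat]
  rw [Finset.sum_comm]
  refine Finset.sum_congr rfl fun p _ => ?_
  rw [Preadditive.sum_comp, map_sum, Preadditive.sum_comp]

lemma hat_add (m : Model θ X) {c : Word} (g g' : wordRep T c ⟶ X) :
    m.hat (g + g') = m.hat g + m.hat g' := by
  simp only [hat, Preadditive.add_comp, map_add, Finset.sum_add_distrib]

lemma hat_smul (m : Model θ X) {c : Word} (z : ℂ) (g : wordRep T c ⟶ X) :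
    m.hat (z • g) = z • m.hat g := by
  simp only [hat, Linear.smul_comp, map_smul, Finset.smul_sum]

lemma map_comp_hat (m : Model θ X) {b c : Word} (f : wordRep T b ⟶ wordRep T c)
    (g : wordRep T c ⟶ X) : θ.map f ≫ m.hat g = m.hat (f ≫ g) := by
  simp only [hat, Preadditive.comp_sum, Category.assoc, θ.map_comp]

lemma hat_map (m : Model θ X) (p : m.κ) : m.hat (m.map p) = m.map' p := by
  simp only [hat, ← m.map'_comp_adj, Category.assoc]
  rw [← Preadditive.comp_sum, m.sum_map', Category.comp_id]

lemma hat_comp_adj_map' (m : Model θ X) {b : Word} (g : wordRep T b ⟶ X) (p : m.κ) :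
    m.hat g ≫ Rep.adj (m.map' p) = θ.map (g ≫ Rep.adj (m.map p)) := by
  rw [hat, Preadditive.sum_comp]
  simp only [Category.assoc, m.map'_comp_adj, ← θ.map_comp]
  rw [← map_sum]
  have h : ∀ r, g ≫ Rep.adj (m.map r) ≫ m.map r ≫ Rep.adj (m.map p) =
      g ≫ (Rep.adj (m.map r) ≫ m.map r) ≫ Rep.adj (m.map p) := fun r => by
    simp only [Category.assoc]
  simp only [h]
  rw [← Preadditive.comp_sum, ← Preadditive.sum_comp, m.sum_map, Category.id_comp]

/-- Compatibility of `hat` with θ: the operators k^* g between words correspond. In particular `hat`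
does not depend on how a map is expanded in the resolution. -/
lemma hat_comp_adj_hat (m : Model θ X) {b c : Word} (g : wordRep T b ⟶ X) (k : wordRep T c ⟶ X) :
    m.hat g ≫ Rep.adj (m.hat k) = θ.map (g ≫ Rep.adj k) := by
  have h1 : Rep.adj (m.hat k) = ∑ p, Rep.adj (m.map' p) ≫ θ.map (m.map p ≫ Rep.adj k) := by
    rw [hat, Rep.adj_sum]
    refine Finset.sum_congr rfl fun p _ => ?_
    rw [Rep.adj_comp, ← θ.map_adj, Rep.adj_comp, Rep.adj_adj]
  have h2 : ∀ p, m.hat g ≫ Rep.adj (m.map' p) ≫ θ.map (m.map p ≫ Rep.adj k) =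
      θ.map (g ≫ (Rep.adj (m.map p) ≫ m.map p) ≫ Rep.adj k) := by
    intro p
    rw [← Category.assoc, hat_comp_adj_map', ← θ.map_comp]
    simp only [Category.assoc]
  rw [h1, Preadditive.comp_sum]
  simp only [h2]
  rw [← map_sum, ← Preadditive.comp_sum, ← Preadditive.sum_comp, m.sum_map, Category.id_comp]

/-- The resolution of the corresponding representation. -/
def resolution' (m : Model θ X) : Resolution m.obj where
  κ := m.κ
  word := m.word
  map := m.map'
  sum_map := m.sum_map'

lemma hom_ext (m : Model θ X) {Z : Rep (comul T')} {u v : m.obj ⟶ Z}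
    (h : ∀ (c : Word) (g : wordRep T c ⟶ X), m.hat g ≫ u = m.hat g ≫ v) : u = v :=
  m.resolution'.hom_ext_left fun (p : m.κ) => by
    change m.map' p ≫ u = m.map' p ≫ v
    rw [← hat_map, h]

lemma hom_ext_adj (m : Model θ X) {Z : Rep (comul T')} {u v : Z ⟶ m.obj}
    (h : ∀ (c : Word) (g : wordRep T c ⟶ X), u ≫ Rep.adj (m.hat g) = v ≫ Rep.adj (m.hat g)) :
    u = v :=
  m.resolution'.hom_ext_right fun (p : m.κ) => by
    change u ≫ Rep.adj (m.map' p) = v ≫ Rep.adj (m.map' p)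
    rw [← hat_map, h]

lemma hom_ext_tensor (m : Model θ X) (n : Model θ Y) {Z : Rep (comul T')} {u v : m.obj ⊗ n.obj ⟶ Z}
    (h : ∀ (c d : Word) (g : wordRep T c ⟶ X) (k : wordRep T d ⟶ Y),
      wordTensor (m.hat g) (n.hat k) ≫ u = wordTensor (m.hat g) (n.hat k) ≫ v) : u = v :=
  (m.resolution'.tensor n.resolution').hom_ext_left fun (p : m.κ × n.κ) => by
    change wordTensor (m.map' p.1) (n.map' p.2) ≫ u = wordTensor (m.map' p.1) (n.map' p.2) ≫ v
    rw [← hat_map, ← hat_map, h]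

lemma hom_ext_tensor_tensor {W : Rep (comul T)} (m : Model θ X) (n : Model θ Y) (r : Model θ W)
    {Z : Rep (comul T')} {u v : (m.obj ⊗ n.obj) ⊗ r.obj ⟶ Z}
    (h : ∀ (c d e : Word) (g : wordRep T c ⟶ X) (k : wordRep T d ⟶ Y) (l : wordRep T e ⟶ W),
      wordTensor (wordTensor (m.hat g) (n.hat k)) (r.hat l) ≫ u =
        wordTensor (wordTensor (m.hat g) (n.hat k)) (r.hat l) ≫ v) : u = v :=
  ((m.resolution'.tensor n.resolution').tensor r.resolution').hom_ext_left
    fun (p : (m.κ × n.κ) × r.κ) => by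
    change wordTensor (wordTensor (m.map' p.1.1) (n.map' p.1.2)) (r.map' p.2) ≫ u =
      wordTensor (wordTensor (m.map' p.1.1) (n.map' p.1.2)) (r.map' p.2) ≫ v
    rw [← hat_map, ← hat_map, ← hat_map, h]

lemma hom_ext_unit_tensor (m : Model θ X) {Z : Rep (comul T')} {u v : 𝟙_ _ ⊗ m.obj ⟶ Z}
    (h : ∀ (c : Word) (g : wordRep T c ⟶ X),
      wordTensor (wordUnit T') (m.hat g) ≫ u = wordTensor (wordUnit T') (m.hat g) ≫ v) : u = v :=
  ((Resolution.unit T').tensor m.resolution').hom_ext_left fun (p : Unit × m.κ) => by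
    change wordTensor (wordUnit T') (m.map' p.2) ≫ u = wordTensor (wordUnit T') (m.map' p.2) ≫ v
    rw [← hat_map, h]

lemma hom_ext_tensor_unit (m : Model θ X) {Z : Rep (comul T')} {u v : m.obj ⊗ 𝟙_ _ ⟶ Z}
    (h : ∀ (c : Word) (g : wordRep T c ⟶ X),
      wordTensor (m.hat g) (wordUnit T') ≫ u = wordTensor (m.hat g) (wordUnit T') ≫ v) : u = v :=
  (m.resolution'.tensor (Resolution.unit T')).hom_ext_left fun (p : m.κ × Unit) => by
    change wordTensor (m.map' p.1) (wordUnit T') ≫ u = wordTensor (m.map' p.1) (wordUnit T') ≫ v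
    rw [← hat_map, h]

/-- The intertwiner that corresponds to `f`. -/
def homMap (m : Model θ X) (n : Model θ Y) (f : X ⟶ Y) : m.obj ⟶ n.obj :=
  ∑ p, Rep.adj (m.map' p) ≫ n.hat (m.map p ≫ f)

/-- This property characterizes `homMap`, as the maps `hat` generate the object (`eq_homMap`).
Functoriality, linearity and adjoints are all derived from it rather than from the defining sum. -/
lemma hat_comp_homMap (m : Model θ X) (n : Model θ Y) (f : X ⟶ Y) {c : Word}
    (g : wordRep T c ⟶ X) : m.hat g ≫ homMap m n f = n.hat (g ≫ f) := by
  rw [homMap, Preadditive.comp_sum]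
  simp only [← Category.assoc, hat_comp_adj_map']
  simp only [map_comp_hat]
  rw [← hat_sum]
  have h : ∀ p, (g ≫ Rep.adj (m.map p)) ≫ m.map p ≫ f =
      g ≫ (Rep.adj (m.map p) ≫ m.map p) ≫ f := fun p => by
    simp only [Category.assoc]
  simp only [h]
  rw [← Preadditive.comp_sum, ← Preadditive.sum_comp, m.sum_map, Category.id_comp]

lemma eq_homMap {m : Model θ X} {n : Model θ Y} {f : X ⟶ Y} {u : m.obj ⟶ n.obj}
    (h : ∀ (c : Word) (g : wordRep T c ⟶ X), m.hat g ≫ u = n.hat (g ≫ f)) : u = homMap m n f :=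
  m.hom_ext fun c g => by rw [h, hat_comp_homMap]

lemma homMap_id (m : Model θ X) : homMap m m (𝟙 X) = 𝟙 m.obj :=
  (eq_homMap fun c g => by rw [Category.comp_id, Category.comp_id]).symm

lemma homMap_comp (m : Model θ X) (n : Model θ Y) (r : Model θ Z) (f : X ⟶ Y) (g : Y ⟶ Z) :
    homMap m n f ≫ homMap n r g = homMap m r (f ≫ g) :=
  eq_homMap fun c k => by
    rw [← Category.assoc, hat_comp_homMap, hat_comp_homMap, Category.assoc]

lemma homMap_add (m : Model θ X) (n : Model θ Y) (f g : X ⟶ Y) :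
    homMap m n (f + g) = homMap m n f + homMap m n g :=
  (eq_homMap fun c k => by
    rw [Preadditive.comp_add, Preadditive.comp_add, hat_comp_homMap, hat_comp_homMap, hat_add]).symm

lemma homMap_smul (m : Model θ X) (n : Model θ Y) (z : ℂ) (f : X ⟶ Y) :
    homMap m n (z • f) = z • homMap m n f :=
  (eq_homMap fun c k => by
    rw [Linear.comp_smul, Linear.comp_smul, hat_comp_homMap, hat_smul]).symm

lemma homMap_adj (m : Model θ X) (n : Model θ Y) (f : X ⟶ Y) :
    homMap n m (Rep.adj f) = Rep.adj (homMap m n f) :=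
  (eq_homMap fun c g => m.hom_ext_adj fun d k => by
    rw [Category.assoc, ← Rep.adj_comp, hat_comp_homMap, hat_comp_adj_hat, hat_comp_adj_hat,
      Rep.adj_comp, Category.assoc]).symm

lemma homMap_injective (m : Model θ X) (n : Model θ Y) : Function.Injective (homMap m n) := by
  intro f f' h
  refine m.toResolution.hom_ext_left fun p => n.toResolution.hom_ext_right fun r => ?_
  apply θ.injective
  rw [← hat_comp_adj_hat, ← hat_comp_adj_hat, ← hat_comp_homMap m n, ← hat_comp_homMap m n, h]

/-- The matrix entries of u with respect to the two resolutions are intertwiners between words over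
T'. They lift through θ, and the lifted matrix reassembles to a preimage. -/
lemma homMap_surjective (m : Model θ X) (n : Model θ Y) : Function.Surjective (homMap m n) := by
  intro u
  choose w hw using fun p r => θ.surjective (m.map' p ≫ u ≫ Rep.adj (n.map' r))
  refine ⟨∑ p, ∑ r, Rep.adj (m.map p) ≫ w p r ≫ n.map r, ?_⟩
  refine m.resolution'.hom_ext_left fun (p : m.κ) =>
    n.resolution'.hom_ext_right fun (r : n.κ) => ?_
  change (m.map' p ≫ _) ≫ Rep.adj (n.map' r) = (m.map' p ≫ u) ≫ Rep.adj (n.map' r)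
  rw [← hat_map, hat_comp_homMap, hat_comp_adj_map', Category.assoc, hat_map]
  simp only [Preadditive.comp_sum, Preadditive.sum_comp, map_sum]
  have h : ∀ p' r', θ.map (m.map p ≫ (Rep.adj (m.map p') ≫ w p' r' ≫ n.map r') ≫
      Rep.adj (n.map r)) = m.map' p ≫ (Rep.adj (m.map' p') ≫ m.map' p') ≫ u ≫
        (Rep.adj (n.map' r') ≫ n.map' r') ≫ Rep.adj (n.map' r) := by
    intro p' r'
    have h1 : m.map p ≫ (Rep.adj (m.map p') ≫ w p' r' ≫ n.map r') ≫ Rep.adj (n.map r) =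
        (m.map p ≫ Rep.adj (m.map p')) ≫ w p' r' ≫ (n.map r' ≫ Rep.adj (n.map r)) := by
      simp only [Category.assoc]
    rw [h1, θ.map_comp, θ.map_comp, hw, ← m.map'_comp_adj, ← n.map'_comp_adj]
    simp only [Category.assoc]
  simp only [h]
  simp only [← Preadditive.comp_sum, ← Preadditive.sum_comp]
  simp only [n.sum_map', m.sum_map', Category.id_comp, Category.assoc]

/-- Corresponding representations are unique up to isomorphism. -/
def uniqueIso (m n : Model θ X) : m.obj ≅ n.obj where
  hom := homMap m n (𝟙 X)
  inv := homMap n m (𝟙 X)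
  hom_inv_id := by rw [homMap_comp, Category.comp_id, homMap_id]
  inv_hom_id := by rw [homMap_comp, Category.comp_id, homMap_id]

/-- Every representation of `𝔾_T'` corresponds to a representation of `𝔾_T`. -/
lemma exists_obj_eq (hT' : IsTrianglePresentation T' q') (θ : WordTransfer T T')
    (Y : Rep (comul T')) : ∃ (X : Rep (comul T)) (m : Model θ X), m.obj = Y := by
  obtain ⟨R⟩ := Resolution.nonempty hT' Y
  -- The projection of a resolution of Y is pulled back through θ and split over T; Y itself then
  -- completes the model.
  choose w hw using fun i j => θ.surjective (R.map i ≫ Rep.adj (R.map j))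
  obtain ⟨X, s, hs, hs'⟩ := Rep.exists_splitting w
    (fun i k => θ.injective (by
      rw [map_sum]
      have h : ∀ j, θ.map (w i j ≫ w j k) =
          R.map i ≫ (Rep.adj (R.map j) ≫ R.map j) ≫ Rep.adj (R.map k) := by
        intro j
        rw [θ.map_comp, hw, hw]
        simp only [Category.assoc]
      simp only [h]
      rw [← Preadditive.comp_sum, ← Preadditive.sum_comp, R.sum_map, Category.id_comp, hw]))
    (fun i j => θ.injective (by rw [θ.map_adj, hw, hw, Rep.adj_comp, Rep.adj_adj]))
  exact ⟨X, ⟨⟨R.κ, R.word, s, hs'⟩, Y, R.map, fun i j => by rw [hs, hw], R.sum_map⟩, rfl⟩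

/-- The hypothesis `hu` makes u an isometry, and its range contains the images of all maps `hat`,
which fill the whole object. So u is unitary. -/
lemma adj_comp_self {Z : Rep (comul T')} (m : Model θ X) {u : Z ⟶ m.obj} (hu : u ≫ Rep.adj u = 𝟙 Z)
    (h : ∀ (c : Word) (g : wordRep T c ⟶ X), ∃ z : wordRep T' c ⟶ Z, m.hat g = z ≫ u) :
    Rep.adj u ≫ u = 𝟙 m.obj :=
  m.hom_ext fun c g => by
    obtain ⟨z, hz⟩ := h c g
    rw [hz, Category.assoc, ← Category.assoc u, hu, Category.id_comp, Category.comp_id]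

/-- The structure isomorphism on the trivial representation. -/
def unitMap (m : Model θ (𝟙_ (Rep (comul T)))) : 𝟙_ (Rep (comul T')) ⟶ m.obj :=
  Rep.adj (wordUnit T') ≫ m.hat (wordUnit T)

lemma wordUnit_comp_unitMap (m : Model θ (𝟙_ (Rep (comul T)))) :
    wordUnit T' ≫ unitMap m = m.hat (wordUnit T) := by
  change 𝟙 (𝟙_ (Rep (comul T'))) ≫ Rep.adj (𝟙 (𝟙_ (Rep (comul T')))) ≫ m.hat (wordUnit T) = _
  rw [Rep.adj_id, Category.id_comp]
  exact Category.id_comp (m.hat (wordUnit T))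

lemma unitMap_comp_adj (m : Model θ (𝟙_ (Rep (comul T)))) :
    unitMap m ≫ Rep.adj (unitMap m) = 𝟙 _ := by
  refine (Resolution.unit T').hom_ext_left fun _ => (Resolution.unit T').hom_ext_right fun _ => ?_
  change (wordUnit T' ≫ unitMap m ≫ Rep.adj (unitMap m)) ≫ Rep.adj (wordUnit T') =
    (wordUnit T' ≫ 𝟙 _) ≫ Rep.adj (wordUnit T')
  rw [← Category.assoc, Category.assoc, ← Rep.adj_comp, wordUnit_comp_unitMap, hat_comp_adj_hat,
    Category.comp_id]
  change θ.map (𝟙 (wordRep T .unit) ≫ Rep.adj (𝟙 (wordRep T .unit))) =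
    𝟙 (wordRep T' .unit) ≫ Rep.adj (𝟙 (wordRep T' .unit))
  rw [Rep.adj_id, Rep.adj_id, Category.comp_id, Category.comp_id, θ.map_id]

lemma adj_comp_unitMap (m : Model θ (𝟙_ (Rep (comul T)))) :
    Rep.adj (unitMap m) ≫ unitMap m = 𝟙 _ :=
  m.adj_comp_self (unitMap_comp_adj m) fun c g => by
    -- The trivial representation is itself a tensor word, so θ applies to g directly.
    let g' : wordRep T c ⟶ wordRep T .unit := g
    refine ⟨θ.map g' ≫ wordUnit T', ?_⟩
    rw [Category.assoc, wordUnit_comp_unitMap, map_comp_hat]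
    congr 1
    exact (Category.comp_id g).symm

/-- The structure isomorphism on a tensor product. -/
def tensorMap (m : Model θ X) (n : Model θ Y) (r : Model θ (X ⊗ Y)) : m.obj ⊗ n.obj ⟶ r.obj :=
  ∑ p, ∑ p', Rep.adj (wordTensor (m.map' p) (n.map' p')) ≫ r.hat (wordTensor (m.map p) (n.map p'))

/-- This characterizes `tensorMap` on tensor products of maps `hat`. Naturality, coherence and
unitarity are checked by composing with these. -/
lemma wordTensor_comp_tensorMap (m : Model θ X) (n : Model θ Y) (r : Model θ (X ⊗ Y)) {c d : Word}
    (g : wordRep T c ⟶ X) (k : wordRep T d ⟶ Y) :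
    wordTensor (m.hat g) (n.hat k) ≫ tensorMap m n r = r.hat (wordTensor g k) := by
  rw [tensorMap]
  simp only [Preadditive.comp_sum]
  have h : ∀ p p', wordTensor (m.hat g) (n.hat k) ≫ Rep.adj (wordTensor (m.map' p) (n.map' p')) ≫
      r.hat (wordTensor (m.map p) (n.map p')) = r.hat (wordTensor
        (g ≫ Rep.adj (m.map p) ≫ m.map p) (k ≫ Rep.adj (n.map p') ≫ n.map p')) := by
    intro p p'
    rw [← Category.assoc, wordTensor_comp_adj, hat_comp_adj_map', hat_comp_adj_map',
      ← θ.map_wordMap, map_comp_hat, wordMap_comp_wordTensor, Category.assoc, Category.assoc]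
  simp only [h]
  simp only [← hat_sum, ← wordTensor_sum, ← sum_wordTensor, ← Preadditive.comp_sum, m.sum_map,
    n.sum_map, Category.comp_id]

lemma tensorMap_comp_adj (m : Model θ X) (n : Model θ Y) (r : Model θ (X ⊗ Y)) :
    tensorMap m n r ≫ Rep.adj (tensorMap m n r) = 𝟙 _ := by
  refine m.hom_ext_tensor n fun c d g k => ?_
  refine (m.resolution'.tensor n.resolution').hom_ext_right fun (p : m.κ × n.κ) => ?_
  change _ ≫ Rep.adj (wordTensor (m.map' p.1) (n.map' p.2)) =
    _ ≫ Rep.adj (wordTensor (m.map' p.1) (n.map' p.2))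
  rw [← hat_map, ← hat_map, ← Category.assoc, wordTensor_comp_tensorMap, Category.assoc,
    ← Rep.adj_comp, wordTensor_comp_tensorMap, hat_comp_adj_hat, wordTensor_comp_adj,
    Category.comp_id, wordTensor_comp_adj, θ.map_wordMap, hat_comp_adj_hat, hat_comp_adj_hat]

lemma adj_comp_tensorMap (m : Model θ X) (n : Model θ Y) (r : Model θ (X ⊗ Y)) :
    Rep.adj (tensorMap m n r) ≫ tensorMap m n r = 𝟙 _ :=
  r.adj_comp_self (tensorMap_comp_adj m n r) fun c g => by
    refine ⟨∑ p, ∑ p', θ.map (g ≫ Rep.adj (wordTensor (m.map p) (n.map p'))) ≫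
      wordTensor (m.hat (m.map p)) (n.hat (n.map p')), ?_⟩
    simp only [Preadditive.sum_comp, Category.assoc, wordTensor_comp_tensorMap, map_comp_hat]
    simp only [← hat_sum, ← Preadditive.comp_sum]
    have h : ∑ p, ∑ p', Rep.adj (wordTensor (m.map p) (n.map p')) ≫
        wordTensor (m.map p) (n.map p') = 𝟙 (X ⊗ Y) :=
      (Fintype.sum_prod_type _).symm.trans (m.toResolution.tensor n.toResolution).sum_map
    conv_lhs => rw [← Category.comp_id g, ← h]

lemma tensorMap_natural {X₁ Y₁ : Rep (comul T)} (m : Model θ X) (n : Model θ Y)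
    (r : Model θ (X ⊗ Y)) (m₁ : Model θ X₁) (n₁ : Model θ Y₁) (r₁ : Model θ (X₁ ⊗ Y₁))
    (f : X ⟶ X₁) (g : Y ⟶ Y₁) :
    (homMap m m₁ f ⊗ₘ homMap n n₁ g) ≫ tensorMap m₁ n₁ r₁ =
      tensorMap m n r ≫ homMap r r₁ (f ⊗ₘ g) := by
  refine m.hom_ext_tensor n fun c d k l => ?_
  rw [← Category.assoc, wordTensor_comp, hat_comp_homMap, hat_comp_homMap,
    wordTensor_comp_tensorMap, ← Category.assoc, wordTensor_comp_tensorMap, hat_comp_homMap,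
    wordTensor_comp]

end Model

end

section
variable {F : Type} [Fintype F] [DecidableEq F] {T : Finset (F × F × F)}
  {F' : Type} [Fintype F'] [DecidableEq F'] {T' : Finset (F' × F' × F')} {q q' : ℕ}
  {θ : WordTransfer T T'}

/-! ### The unitary monoidal equivalence. -/

namespace Model

/-- The functor given by a choice of corresponding representations. -/
def functor (m : ∀ X, Model θ X) : Rep (comul T) ⥤ Rep (comul T') where
  obj X := (m X).obj
  map f := homMap (m _) (m _) f
  map_id X := homMap_id (m X)
  map_comp f g := (homMap_comp _ _ _ f g).symm

/-- The structure isomorphisms of the functor are isomorphisms. -/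
def coreMonoidal (m : ∀ X, Model θ X) : (functor m).CoreMonoidal where
  εIso :=
    { hom := unitMap (m _)
      inv := Rep.adj (unitMap (m _))
      hom_inv_id := unitMap_comp_adj (m _)
      inv_hom_id := adj_comp_unitMap (m _) }
  μIso X Y :=
    { hom := tensorMap (m X) (m Y) (m _)
      inv := Rep.adj (tensorMap (m X) (m Y) (m _))
      hom_inv_id := tensorMap_comp_adj _ _ _
      inv_hom_id := adj_comp_tensorMap _ _ _ }
  μIso_hom_natural_left {X Y} f Z := by
    have h := tensorMap_natural (m X) (m Z) (m _) (m Y) (m Z) (m _) f (𝟙 Z)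
    rw [homMap_id, tensorHom_id, tensorHom_id] at h
    exact h
  μIso_hom_natural_right {X Y} Z f := by
    have h := tensorMap_natural (m Z) (m X) (m _) (m Z) (m Y) (m _) (𝟙 Z) f
    rw [homMap_id, id_tensorHom, id_tensorHom] at h
    exact h
  associativity X Y Z := by
    change tensorMap (m X) (m Y) (m (X ⊗ Y)) ▷ (m Z).obj ≫
        tensorMap (m (X ⊗ Y)) (m Z) (m ((X ⊗ Y) ⊗ Z)) ≫ homMap (m _) (m _) (α_ X Y Z).hom =
      (α_ (m X).obj (m Y).obj (m Z).obj).hom ≫ (m X).obj ◁ tensorMap (m Y) (m Z) (m (Y ⊗ Z)) ≫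
        tensorMap (m X) (m (Y ⊗ Z)) (m (X ⊗ (Y ⊗ Z)))
    -- On tensor products of three maps `hat`, both composites reduce to `hat` of a tensor product,
    -- up to the associator of words, which θ preserves.
    refine (m X).hom_ext_tensor_tensor (m Y) (m Z) fun c d e g k l => ?_
    rw [← tensorHom_id, ← id_tensorHom, ← Category.assoc, ← Category.assoc, wordTensor_comp,
      wordTensor_comp_tensorMap, Category.comp_id, wordTensor_comp_tensorMap, hat_comp_homMap,
      wordTensor_assoc, ← map_comp_hat, θ.map_assoc, ← Category.assoc, wordTensor_assoc,
      Category.assoc, ← Category.assoc (wordTensor _ _), wordTensor_comp,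
      wordTensor_comp_tensorMap, Category.comp_id, wordTensor_comp_tensorMap]
  left_unitality X := by
    change (λ_ (m X).obj).hom = unitMap (m _) ▷ (m X).obj ≫ tensorMap (m _) (m X) (m _) ≫
      homMap (m _) (m _) (λ_ X).hom
    refine (m X).hom_ext_unit_tensor fun c g => ?_
    rw [← tensorHom_id, ← Category.assoc, ← Category.assoc, wordTensor_comp, wordUnit_comp_unitMap,
      Category.comp_id, wordTensor_comp_tensorMap, hat_comp_homMap, wordTensor_left,
      wordTensor_left, ← map_comp_hat, θ.map_left]
  right_unitality X := by
    change (ρ_ (m X).obj).hom = (m X).obj ◁ unitMap (m _) ≫ tensorMap (m X) (m _) (m _) ≫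
      homMap (m _) (m _) (ρ_ X).hom
    refine (m X).hom_ext_tensor_unit fun c g => ?_
    rw [← id_tensorHom, ← Category.assoc, ← Category.assoc, wordTensor_comp, wordUnit_comp_unitMap,
      Category.comp_id, wordTensor_comp_tensorMap, hat_comp_homMap, wordTensor_right,
      wordTensor_right, ← map_comp_hat, θ.map_right]

end Model

/-- Quantum groups with equivalent intertwiners of tensor words are monoidally equivalent. -/
lemma WordTransfer.monoidallyEquivalent (θ : WordTransfer T T') (hT : IsTrianglePresentation T q)
    (hT' : IsTrianglePresentation T' q') : MonoidallyEquivalent (comul T) (comul T') := by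
  let m : ∀ X, Model θ X := fun X => (Model.nonempty hT θ X).some
  have hfaithful : (Model.functor m).Faithful :=
    ⟨fun {X Y} f g h => Model.homMap_injective (m X) (m Y) h⟩
  have hfull : (Model.functor m).Full := ⟨fun {X Y} => Model.homMap_surjective (m X) (m Y)⟩
  have hsurj : (Model.functor m).EssSurj := ⟨fun Y => by
    obtain ⟨X, n, rfl⟩ := Model.exists_obj_eq hT' θ Y
    exact ⟨X, ⟨Model.uniqueIso (m X) n⟩⟩⟩
  refine ⟨Model.functor m, (Model.coreMonoidal m).toMonoidal, { }, ⟨?_⟩, ⟨?_⟩, ?_, ?_, ?_⟩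
  · intro X Y f g
    exact Model.homMap_add _ _ f g
  · intro X Y f z
    exact Model.homMap_smul _ _ z f
  · intro X Y f
    exact Model.homMap_adj _ _ f
  -- Unitarity is built in: `coreMonoidal` takes the adjoints as the inverses.
  · rfl
  · intro X Y
    rfl

end

end TriangleQG

end

/-- If the scalar products of the vectors `[p₁]` and `[p₂]`, for all noncrossing partitions in
blocks of size `3`, agree for two triangle presentations of the same order, then the associated
compact quantum groups are monoidally equivalent. -/
theorem proposition7p5 {F F' : Type} [Fintype F] [DecidableEq F] [Fintype F'] [DecidableEq F']
    (q : ℕ) (T : Finset (F × F × F)) (T' : Finset (F' × F' × F'))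
    (hT : TriangleQG.IsTrianglePresentation T q) (hT' : TriangleQG.IsTrianglePresentation T' q)
    (h : ∀ (n : ℕ) (p₁ p₂ : TriangleQG.NC3 n),
      inner ℂ (TriangleQG.partitionVector T p₁) (TriangleQG.partitionVector T p₂) =
        inner ℂ (TriangleQG.partitionVector T' p₁) (TriangleQG.partitionVector T' p₂)) :
    TriangleQG.MonoidallyEquivalent (TriangleQG.comul T) (TriangleQG.comul T') := by
  obtain ⟨θ⟩ := TriangleQG.nonempty_wordTransfer hT hT' h
  exact θ.monoidallyEquivalent hT hT'
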